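/- **Language.** Consider the two-sorted first-order language with equality with sorts $B$ (bodies) and $Q$ (quantities), unary relation symbols $IOb$ (inertial observer) and $Ph$ (light signal) on $B$, binary operations $+,\cdot$ and a binary relation $\le$ on $Q$, and a worldview relation $W(k,b,x_0,x_1,x_2,x_3)$ of sort $B^2\times Q^4$ ("$k$ coordinatizes $b$ at $\bar x$"). Write $\vdash$ for derivability in classical first-order logic. Quantities such as differences, quotients, square roots, speeds and velocities are partial functions; a formula in which such an expression occurs says in particular that it is defined. Notation: $ev_k(\bar x)=\{b: W(k,b,\bar x)\}$; $wl_k(b)=\{\bar x: W(k,b,\bar x)\}$; $w_{kk'}(\bar x,\bar y)$ iff $ev_k(\bar x)=ev_{k'}(\bar y)$; $space(\bar x,\bar y)=\sqrt{\sum_{i=1}^3(x_i-y_i)^2}$; $time(\bar x,\bar y)=|x_0-y_0|$. We have $speed_k(b)=v$ (resp. $\bar v_k(b)=\bar v$) iff $wl_k(b)$ has at least two points and $space(\bar x,\bar y)=v\cdot time(\bar x,\bar y)$ (resp. $(y_1-x_1,y_2-x_2,y_3-x_3)=\bar v\,(y_0-x_0)$) for all $\bar x,\bar y\in wl_k(b)$.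 For $k\in B$, $c\in Q$, let $L(k,c)$ say that $c>0$ and, for all $\bar x,\bar y\in Q^4$, there is a light signal $p$ with $\bar x,\bar y\in wl_k(p)$ if and only if $space(\bar x,\bar y)=c\cdot time(\bar x,\bar y)$. **Theories.** $\mathsf{Kin_{Full}}$ consists of: * AxEField: $\langle Q,+,\cdot,\le\rangle$ is a linearly ordered field in which every positive element has a square root. * AxEv: for all $k,h\in IOb$ and $\bar x$ there is $\bar y$ with $ev_k(\bar x)=ev_h(\bar y)$. * AxSelf: for all $k\in IOb$, $W(k,k,\bar x)\leftrightarrow x_1=x_2=x_3=0$. * AxSymD: for all $k,k'\in IOb$, if $time(\bar x,\bar y)=time(\bar x',\bar y')=0$, $ev_k(\bar x)=ev_{k'}(\bar x')$ and $ev_k(\bar y)=ev_{k'}(\bar y')$, then $space(\bar x,\bar y)=space(\bar x',\bar y')$. * AxLine: for all $k,h\in IOb$ and $\bar x,\bar y,\bar z\in wl_k(h)$ there is $a\in Q$ with $\bar z-\bar x=a(\bar y-\bar x)$ or $\bar y-\bar z=a(\bar z-\bar x)$. * AxTriv: for every trivial transformation $T$ (a map $(t,p)\mapsto(t+t_0,Ap+d)$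 of $Q^4$ with $p\mapsto Ap+d$ an isometry of $Q^3$) and every $k\in IOb$ there is $k'\in IOb$ with $w_{kk'}=T$. * AxNoAcc: every $k\in B$ with $W(k,b,\bar x)$ for some $b,\bar x$ is in $IOb$. $\mathsf{ClassicalKin_{Full}}$ is $\mathsf{Kin_{Full}}$ together with: * AxAbsTime: for all $k,k'\in IOb$, if $ev_k(\bar x)=ev_{k'}(\bar x')$ and $ev_k(\bar y)=ev_{k'}(\bar y')$, then $time(\bar x,\bar y)=time(\bar x',\bar y')$. * AxThExp$_+$: $IOb$ is nonempty, and for all $k\in IOb$ and $\bar x,\bar y$ with $x_0\ne y_0$ there is $k'\in IOb$ with $\bar x,\bar y\in wl_k(k')$. * AxEther: there is an ether observer, where $Ether(e)$ means $IOb(e)\wedge\exists c\,L(e,c)$. $\mathsf{SpecRel_{Full}}$ is $\mathsf{Kin_{Full}}$ together with: * AxPh$_c$: there is $\mathfrak c$ with $L(k,\mathfrak c)$ for all $k\in IOb$. * AxThExp: $IOb$ is nonempty, and for all $k\in IOb$ and $\bar x,\bar y$ with $space(\bar x,\bar y)<\mathfrak c\cdot time(\bar x,\bar y)$ there is $k'\in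 IOb$ with $\bar x,\bar y\in wl_k(k')$. **Radarization.** In $\mathsf{ClassicalKin_{Full}}$ let $\mathfrak{c_e}$ be the quantity $c$ such that $L(e,c)$ for all ether observers $e$. For $\bar v=(v_x,v_y,v_z)\in Q^3$ with $v=|\bar v|<\mathfrak{c_e}$ (and only for such $\bar v$) let $Rad_{\bar v}=R_{\bar v}^{-1}\circ S_v\circ E_v\circ G_v\circ R_{\bar v}$, where, with $d=1-v^2/\mathfrak{c_e}^2$, $$G_v=\begin{bmatrix}1&0&0&0\\v&1&0&0\\0&0&1&0\\0&0&0&1\end{bmatrix},\qquad E_v=\begin{bmatrix}\frac1d&\frac{-v/\mathfrak{c_e}^2}{d}&0&0\\ \frac{-v}{d}&\frac1d&0&0\\0&0&\frac1{\sqrt d}&0\\0&0&0&\frac1{\sqrt d}\end{bmatrix},$$ $S_v$ is multiplication by $\sqrt d$, and $R_{\bar v}$ is the following orthogonal map that fixes the time axis and takes $(1,\bar v)$ to $(1,-v,0,0)$: if $v_y\neq0$ or $v_z\ne0$, $$R_{\bar v}=\frac1v\begin{bmatrix}v&0&0&0\\0&-v_x&-v_y&-v_z\\0&v_y&-v_x-\frac{v_z^2(v-v_x)}{v_y^2+v_z^2}&\frac{v_yv_z(v-v_x)}{v_y^2+v_z^2}\\0&v_z&\frac{v_yv_z(v-v_x)}{v_y^2+v_z^2}&-v_x-\frac{v_y^2(v-v_x)}{v_y^2+v_z^2}\end{bmatrix};$$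 if $v_y=v_z=0$, then $R_{\bar v}$ is the identity for $v_x\le0$ and $\mathrm{diag}(1,-1,-1,-1)$ for $v_x>0$. **Translation.** $Tr$ is the translation of the language into itself that leaves $+$, $\cdot$, $\le$, $Ph$ and equality unchanged, preserves connectives and quantifiers, and satisfies $$Tr(IOb(k)) := IOb(k)\wedge\forall e\,\bigl(Ether(e)\to speed_e(k)<\mathfrak{c_e}\bigr),$$ $$Tr(W(k,b,\bar x)) := \forall e\,\bigl(Ether(e)\to W(k,b,Rad^{-1}_{\bar v_k(e)}(\bar x))\bigr).$$ (By the convention on partial functions, the last formula includes that $\bar v_k(e)$ is defined and $|\bar v_k(e)|<\mathfrak{c_e}$.) **Theorem.** $Tr$ is an interpretation of $\mathsf{SpecRel_{Full}}$ in $\mathsf{ClassicalKin_{Full}}$: for every formula $\varphi$ of the language, $$\mathsf{SpecRel_{Full}}\vdash\varphi\quad\text{implies}\quad\mathsf{ClassicalKin_{Full}}\vdash Tr(\varphi).$$ -/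

import Mathlib

namespace CompKin

/-! ### The two-sorted first-order language of bodies and quantities

Variables of both sorts are de Bruijn indices, counted separately for the two sorts: index `0` is
the variable bound by the innermost enclosing quantifier of that sort, and the indices that point
beyond all enclosing quantifiers are the free variables.  Body terms are just body variables. -/

/-- Quantity terms: quantity variables, sums and products. -/
inductive Tm : Type
  | var : ℕ → Tm
  | add : Tm → Tm → Tm
  | mul : Tm → Tm → Tm

/-- Quadruples of quantity terms (coordinate points `x₀, x₁, x₂, x₃`, with `x₀` the time). -/
abbrev Pt : Type := Fin 4 → Tm

/-- Formulas. `wv k b x` is the worldview relation `W(k, b, x₀, x₁, x₂, x₃)`. -/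
inductive Fml : Type
  | eqB : ℕ → ℕ → Fml
  | eqQ : Tm → Tm → Fml
  | le : Tm → Tm → Fml
  | iob : ℕ → Fml
  | ph : ℕ → Fml
  | wv : ℕ → ℕ → Pt → Fml
  | fls : Fml
  | imp : Fml → Fml → Fml
  | allB : Fml → Fml
  | allQ : Fml → Fml

namespace Fml

def neg (φ : Fml) : Fml := imp φ fls
def and (φ ψ : Fml) : Fml := neg (imp φ (neg ψ))
def or (φ ψ : Fml) : Fml := imp (neg φ) ψ
def iff (φ ψ : Fml) : Fml := and (imp φ ψ) (imp ψ φ)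
def exB (φ : Fml) : Fml := neg (allB (neg φ))
def exQ (φ : Fml) : Fml := neg (allQ (neg φ))

/-- A block of `n` universal quantifiers over quantities. -/
def allsQ : ℕ → Fml → Fml
  | 0, φ => φ
  | n + 1, φ => allQ (allsQ n φ)

/-- A block of `n` existential quantifiers over quantities. -/
def exsQ : ℕ → Fml → Fml
  | 0, φ => φ
  | n + 1, φ => exQ (exsQ n φ)

end Fml

scoped prefix:max "∼" => Fml.neg
scoped infixr:63 " ⋏ " => Fml.and
scoped infixr:62 " ⋎ " => Fml.or
scoped infixr:61 " ⇒ " => Fml.imp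
scoped infix:60 " ⇔ " => Fml.iff

open Fml

/-! ### Substitution -/

/-- Simultaneous substitution of quantity terms for quantity variables. -/
def Tm.subst (σ : ℕ → Tm) : Tm → Tm
  | var n => σ n
  | add s t => add (s.subst σ) (t.subst σ)
  | mul s t => mul (s.subst σ) (t.subst σ)

/-- Shift the variables of a term by `k`, for use under `k` further quantity quantifiers. -/
def Tm.lift (k : ℕ) (t : Tm) : Tm := t.subst fun n => .var (n + k)

def Pt.lift (k : ℕ) (x : Pt) : Pt := fun i => (x i).lift k

/-- A substitution of body variables, carried under a body quantifier. -/
def upB (β : ℕ → ℕ) : ℕ → ℕ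
  | 0 => 0
  | n + 1 => β n + 1

/-- A substitution of quantity terms, carried under a quantity quantifier. -/
def upQ (σ : ℕ → Tm) : ℕ → Tm
  | 0 => .var 0
  | n + 1 => (σ n).lift 1

/-- Simultaneous capture-avoiding substitution of body variables and quantity terms. -/
def Fml.subst : (ℕ → ℕ) → (ℕ → Tm) → Fml → Fml
  | β, _, eqB k b => eqB (β k) (β b)
  | _, σ, eqQ s t => eqQ (s.subst σ) (t.subst σ)
  | _, σ, le s t => le (s.subst σ) (t.subst σ)
  | β, _, iob k => iob (β k)
  | β, _, ph k => ph (β k)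
  | β, σ, wv k b x => wv (β k) (β b) fun i => (x i).subst σ
  | _, _, fls => fls
  | β, σ, imp φ ψ => imp (subst β σ φ) (subst β σ ψ)
  | β, σ, allB φ => allB (subst (upB β) σ φ)
  | β, σ, allQ φ => allQ (subst β (upQ σ) φ)

/-- Shift the free body variables by one. -/
def Fml.shiftB (φ : Fml) : Fml := φ.subst (fun n => n + 1) .var

/-- Shift the free quantity variables by one. -/
def Fml.shiftQ (φ : Fml) : Fml := φ.subst id fun n => .var (n + 1)

/-- Instantiate the body variable `0` by the body variable `b` (and lower the others). -/
def Fml.instB (φ : Fml) (b : ℕ) : Fml :=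
  φ.subst (fun n => match n with | 0 => b | n + 1 => n) .var

/-- Instantiate the quantity variable `0` by the term `t` (and lower the others). -/
def Fml.instQ (φ : Fml) (t : Tm) : Fml :=
  φ.subst id fun n => match n with | 0 => t | n + 1 => .var n

/-! ### Syntactic consequence: natural deduction for classical two-sorted logic with equality -/

inductive Provable : Set Fml → Fml → Prop
  | hyp {Γ : Set Fml} {φ : Fml} : φ ∈ Γ → Provable Γ φ
  | impI {Γ : Set Fml} {φ ψ : Fml} : Provable (insert φ Γ) ψ → Provable Γ (φ ⇒ ψ)
  | impE {Γ : Set Fml} {φ ψ : Fml} : Provable Γ (φ ⇒ ψ) → Provable Γ φ → Provable Γ ψ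
  | raa {Γ : Set Fml} {φ : Fml} : Provable (insert (∼φ) Γ) fls → Provable Γ φ
  | allBI {Γ : Set Fml} {φ : Fml} : Provable (shiftB '' Γ) φ → Provable Γ (allB φ)
  | allBE {Γ : Set Fml} {φ : Fml} (b : ℕ) : Provable Γ (allB φ) → Provable Γ (φ.instB b)
  | allQI {Γ : Set Fml} {φ : Fml} : Provable (shiftQ '' Γ) φ → Provable Γ (allQ φ)
  | allQE {Γ : Set Fml} {φ : Fml} (t : Tm) : Provable Γ (allQ φ) → Provable Γ (φ.instQ t)
  | reflB {Γ : Set Fml} (b : ℕ) : Provable Γ (eqB b b)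
  | reflQ {Γ : Set Fml} (t : Tm) : Provable Γ (eqQ t t)
  | replB {Γ : Set Fml} (φ : Fml) {b c : ℕ} :
      Provable Γ (eqB b c) → Provable Γ (φ.instB b) → Provable Γ (φ.instB c)
  | replQ {Γ : Set Fml} (φ : Fml) {s t : Tm} :
      Provable Γ (eqQ s t) → Provable Γ (φ.instQ s) → Provable Γ (φ.instQ t)

/-! ### Translations and interpretations -/

/-- The variables of the term are among the first `n` ones. -/
def Tm.closedIn (n : ℕ) : Tm → Bool
  | var i => decide (i < n)
  | add s t => s.closedIn n && t.closedIn n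
  | mul s t => s.closedIn n && t.closedIn n

/-- The free variables of the formula are among the first `m` body variables and the first `n`
quantity variables. -/
def Fml.closedIn : ℕ → ℕ → Fml → Bool
  | m, _, eqB k b => decide (k < m) && decide (b < m)
  | _, n, eqQ s t => s.closedIn n && t.closedIn n
  | _, n, le s t => s.closedIn n && t.closedIn n
  | m, _, iob k => decide (k < m)
  | m, _, ph k => decide (k < m)
  | m, n, wv k b x => decide (k < m) && decide (b < m) &&
      ((x 0).closedIn n && (x 1).closedIn n && (x 2).closedIn n && (x 3).closedIn n)
  | _, _, fls => true
  | m, n, imp φ ψ => closedIn m n φ && closedIn m n ψ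
  | m, n, allB φ => closedIn (m + 1) n φ
  | m, n, allQ φ => closedIn m (n + 1) φ

/-- A translation (of the language into itself) is given by one formula for each relation symbol,
whose free variables stand for the arguments of the symbol.  The operations `+`, `·` and the
equality of both sorts are translated into themselves. -/
structure Translation where
  /-- the translation of `α₀ ≤ α₁` (quantity variables `0`, `1`) -/
  le : Fml
  /-- the translation of `IOb(k)` (body variable `0`) -/
  iob : Fml
  /-- the translation of `Ph(p)` (body variable `0`) -/
  ph : Fml
  /-- the translation of `W(k, b, x₀, x₁, x₂, x₃)`
  (body variables `0` for `k`, `1` for `b`; quantity variables `0`, `1`, `2`, `3`) -/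
  wv : Fml
  le_closed : le.closedIn 0 2 = true
  iob_closed : iob.closedIn 1 0 = true
  ph_closed : ph.closedIn 1 0 = true
  wv_closed : wv.closedIn 2 4 = true

/-- The translation of an arbitrary formula: relation symbols are replaced by the given formulas,
equality, connectives and quantifiers are preserved. -/
def Translation.apply (τ : Translation) : Fml → Fml
  | eqB k b => eqB k b
  | eqQ s t => eqQ s t
  | .le s t => τ.le.subst id fun n => match n with | 0 => s | 1 => t | n + 2 => .var n
  | .iob k => τ.iob.subst (fun _ => k) .var
  | .ph p => τ.ph.subst (fun _ => p) .var
  | .wv k b x => τ.wv.subst (fun n => match n with | 0 => k | _ + 1 => b)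
      fun n => match n with | 0 => x 0 | 1 => x 1 | 2 => x 2 | 3 => x 3 | n + 4 => .var n
  | fls => fls
  | imp φ ψ => imp (τ.apply φ) (τ.apply ψ)
  | allB φ => allB (τ.apply φ)
  | allQ φ => allQ (τ.apply φ)

/-- `τ` is an interpretation of the theory `T₁` in the theory `T₂`: the translation of every
formula provable from `T₁` is provable from `T₂`. -/
def IsInterpretation (τ : Translation) (T₁ T₂ : Set Fml) : Prop :=
  ∀ φ : Fml, Provable T₁ φ → Provable T₂ (τ.apply φ)

/-! ### Expressions with partial functions

The language has only `+` and `·`.  `Ex` are expressions that also use `0`, `1`, subtraction,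
division, square root and absolute value.  They occur in formulas only through their graph, so that
a formula in which an expression occurs says in particular that the expression is defined. -/

inductive Ex : Type
  | tm : Tm → Ex
  | zero : Ex
  | one : Ex
  | add : Ex → Ex → Ex
  | sub : Ex → Ex → Ex
  | mul : Ex → Ex → Ex
  | div : Ex → Ex → Ex
  | sqrt : Ex → Ex
  | abs : Ex → Ex

instance : Coe Tm Ex := ⟨Ex.tm⟩
instance : Zero Ex := ⟨Ex.zero⟩
instance : One Ex := ⟨Ex.one⟩
instance : Add Ex := ⟨Ex.add⟩
instance : Sub Ex := ⟨Ex.sub⟩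
instance : Mul Ex := ⟨Ex.mul⟩
instance : Div Ex := ⟨Ex.div⟩
instance : Neg Ex := ⟨fun a => Ex.sub Ex.zero a⟩

def Ex.sq (a : Ex) : Ex := a * a

/-- `t = 0` -/
def isZero (t : Tm) : Fml := eqQ (.add t t) t

/-- `0 ≤ t` -/
def nonneg (t : Tm) : Fml := exQ (isZero (.var 0) ⋏ le (.var 0) (t.lift 1))

/-- `graph e k t`: the expression `e`, with its variables shifted by `k`, is defined and equal
to `t`. -/
def Ex.graph : Ex → ℕ → Tm → Fml
  | tm s, k, t => eqQ (s.lift k) t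
  | zero, _, t => isZero t
  | one, _, t => eqQ (.mul t t) t ⋏ ∼(isZero t)
  | add a b, k, t => exsQ 2 (a.graph (k + 2) (.var 0) ⋏ b.graph (k + 2) (.var 1) ⋏
      eqQ (.add (.var 0) (.var 1)) (t.lift 2))
  | sub a b, k, t => exsQ 2 (a.graph (k + 2) (.var 0) ⋏ b.graph (k + 2) (.var 1) ⋏
      eqQ (.add (t.lift 2) (.var 1)) (.var 0))
  | mul a b, k, t => exsQ 2 (a.graph (k + 2) (.var 0) ⋏ b.graph (k + 2) (.var 1) ⋏
      eqQ (.mul (.var 0) (.var 1)) (t.lift 2))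
  | div a b, k, t => exsQ 2 (a.graph (k + 2) (.var 0) ⋏ b.graph (k + 2) (.var 1) ⋏
      ∼(isZero (.var 1)) ⋏ eqQ (.mul (t.lift 2) (.var 1)) (.var 0))
  | sqrt a, k, t => exQ (a.graph (k + 1) (.var 0) ⋏ nonneg (t.lift 1) ⋏
      eqQ (.mul (t.lift 1) (t.lift 1)) (.var 0))
  | abs a, k, t => exQ (a.graph (k + 1) (.var 0) ⋏ nonneg (t.lift 1) ⋏
      (eqQ (t.lift 1) (.var 0) ⋎ isZero (.add (t.lift 1) (.var 0))))

/-- `a = b` -/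
def eqE (a b : Ex) : Fml :=
  exsQ 2 (a.graph 2 (.var 0) ⋏ b.graph 2 (.var 1) ⋏ eqQ (.var 0) (.var 1))

/-- `a ≤ b` -/
def leE (a b : Ex) : Fml :=
  exsQ 2 (a.graph 2 (.var 0) ⋏ b.graph 2 (.var 1) ⋏ le (.var 0) (.var 1))

/-- `a < b` -/
def ltE (a b : Ex) : Fml :=
  exsQ 2 (a.graph 2 (.var 0) ⋏ b.graph 2 (.var 1) ⋏ le (.var 0) (.var 1) ⋏
    ∼(eqQ (.var 0) (.var 1)))

/-! ### Defined notions of kinematics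

In these definitions `k`, `b`, `e`, … are body variables and `x`, `y`, `c`, … are quantity terms
of the context; they are shifted explicitly when they are used under further quantifiers. -/

/-- The point with the coordinates `var i, var (i + 1), var (i + 2), var (i + 3)`. -/
def pt (i : ℕ) : Pt := fun j => .var (i + j)

/-- `x = y` for points -/
def eqPt (x y : Pt) : Fml :=
  eqQ (x 0) (y 0) ⋏ eqQ (x 1) (y 1) ⋏ eqQ (x 2) (y 2) ⋏ eqQ (x 3) (y 3)

/-- Spatial distance. -/
def space (x y : Pt) : Ex :=
  .sqrt (((x 1 : Ex) - y 1).sq + ((x 2 : Ex) - y 2).sq + ((x 3 : Ex) - y 3).sq)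

/-- Time difference. -/
def time (x y : Pt) : Ex := .abs ((x 0 : Ex) - y 0)

/-- `x` and `y` are on the worldline of `b` according to `k`. -/
def onWl (k b : ℕ) (x y : Pt) : Fml := wv k b x ⋏ wv k b y

/-- `ev_k(x) = ev_h(y)`; this is also the worldview transformation `w_{kh}(x, y)`. -/
def sameEv (k : ℕ) (x : Pt) (h : ℕ) (y : Pt) : Fml :=
  allB (wv (k + 1) 0 x ⇔ wv (h + 1) 0 y)

/-- The worldline of `b` according to `k` has at least two points. -/
def twoPoints (k b : ℕ) : Fml := exsQ 8 (onWl k b (pt 0) (pt 4) ⋏ ∼(eqPt (pt 0) (pt 4)))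

/-- `speed_k(b) = v` -/
def isSpeed (k b : ℕ) (v : Tm) : Fml :=
  twoPoints k b ⋏ allsQ 8 (onWl k b (pt 0) (pt 4) ⇒
    eqE (space (pt 0) (pt 4)) (v.lift 8 * time (pt 0) (pt 4)))

/-- The velocity of `b` according to `k` is `v`. -/
def isVelocity (k b : ℕ) (v : Fin 3 → Tm) : Fml :=
  twoPoints k b ⋏ allsQ 8 (onWl k b (pt 0) (pt 4) ⇒
    let x := pt 0
    let y := pt 4
    eqE ((y 1 : Ex) - x 1) ((v 0).lift 8 * ((y 0 : Ex) - x 0)) ⋏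
    eqE ((y 2 : Ex) - x 2) ((v 1).lift 8 * ((y 0 : Ex) - x 0)) ⋏
    eqE ((y 3 : Ex) - x 3) ((v 2).lift 8 * ((y 0 : Ex) - x 0)))

/-- According to `k`, two points are on the worldline of a common light signal if and only if
`space = c · time`. -/
def lightSpeedAt (k : ℕ) (c : Tm) : Fml :=
  allsQ 8 (exB (ph 0 ⋏ onWl (k + 1) 0 (pt 0) (pt 4)) ⇔
    eqE (space (pt 0) (pt 4)) (c.lift 8 * time (pt 0) (pt 4)))

/-! ### The common axioms -/

/-- `⟨Q, +, ·, ≤⟩` is a Euclidean field: a field, linearly ordered, with the order compatible with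
`+` and `·`, in which every positive element has a square root. -/
def AxEField : Fml :=
  let a := Tm.var 0
  let b := Tm.var 1
  let c := Tm.var 2
  -- commutativity, associativity, distributivity
  allsQ 3 (eqQ (.add a b) (.add b a) ⋏ eqQ (.mul a b) (.mul b a) ⋏
    eqQ (.add (.add a b) c) (.add a (.add b c)) ⋏
    eqQ (.mul (.mul a b) c) (.mul a (.mul b c)) ⋏
    eqQ (.mul a (.add b c)) (.add (.mul a b) (.mul a c))) ⋏
  -- zero (variable 0, below 1 and 2), one (variable 1, below 2 and 3), inverses
  exsQ 2 (∼(eqQ (.var 0) (.var 1)) ⋏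
    allQ (eqQ (.add (.var 0) (.var 1)) (.var 0) ⋏
      eqQ (.mul (.var 0) (.var 2)) (.var 0) ⋏
      exQ (eqQ (.add (.var 1) (.var 0)) (.var 2)) ⋏
      (∼(eqQ (.var 0) (.var 1)) ⇒ exQ (eqQ (.mul (.var 1) (.var 0)) (.var 3))))) ⋏
  -- linear order
  allsQ 3 (le a a ⋏ (le a b ⋎ le b a) ⋏ (le a b ⋏ le b a ⇒ eqQ a b) ⋏
    (le a b ⋏ le b c ⇒ le a c)) ⋏
  -- compatibility
  allsQ 3 ((le a b ⇒ le (.add a c) (.add b c)) ⋏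
    (leE 0 a ⋏ leE 0 b ⇒ leE 0 (Tm.mul a b))) ⋏
  -- square roots
  allQ (ltE 0 a ⇒ exQ (eqQ (.mul (.var 0) (.var 0)) (.var 1)))

/-- All inertial observers coordinatize the same events. -/
def AxEv : Fml :=
  allB (allB (iob 1 ⋏ iob 0 ⇒ allsQ 4 (exsQ 4 (sameEv 1 (pt 4) 0 (pt 0)))))

/-- Any inertial observer is stationary in his own coordinate system. -/
def AxSelf : Fml :=
  allB (iob 0 ⇒ allsQ 4 (wv 0 0 (pt 0) ⇔ isZero (.var 1) ⋏ isZero (.var 2) ⋏ isZero (.var 3)))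

/-- Any two inertial observers agree on the spatial distance of two events that are simultaneous
for both. -/
def AxSymD : Fml :=
  let x := pt 0
  let y := pt 4
  let x' := pt 8
  let y' := pt 12
  allB (allB (iob 1 ⋏ iob 0 ⇒ allsQ 16
    (eqE (time x y) (time x' y') ⋏ eqE (time x' y') 0 ⋏ sameEv 1 x 0 x' ⋏ sameEv 1 y 0 y' ⇒
      eqE (space x y) (space x' y'))))

/-- `p - q = a (r - s)` for points -/
def diffEqMul (a : Tm) (p q r s : Pt) : Fml :=
  eqE ((p 0 : Ex) - q 0) (a * ((r 0 : Ex) - s 0)) ⋏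
  eqE ((p 1 : Ex) - q 1) (a * ((r 1 : Ex) - s 1)) ⋏
  eqE ((p 2 : Ex) - q 2) (a * ((r 2 : Ex) - s 2)) ⋏
  eqE ((p 3 : Ex) - q 3) (a * ((r 3 : Ex) - s 3))

/-- The worldline of an inertial observer is a straight line according to inertial observers. -/
def AxLine : Fml :=
  let x := pt 1
  let y := pt 5
  let z := pt 9
  allB (allB (iob 1 ⋏ iob 0 ⇒ allsQ 12
    (wv 1 0 (pt 0) ⋏ wv 1 0 (pt 4) ⋏ wv 1 0 (pt 8) ⇒
      exQ (diffEqMul (.var 0) z x y x ⋎ diffEqMul (.var 0) y z z x))))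

/-- The transformation with parameters `t`, `d`, `A` maps `x` to `y`, where the time coordinate is
translated by `t` and the spatial coordinates are mapped by `p ↦ A p + d`. -/
def trivMaps (t : Tm) (d : Fin 3 → Tm) (A : Fin 3 → Fin 3 → Tm) (x y : Pt) : Fml :=
  let row (i : Fin 3) : Ex := (A i 0 : Ex) * x 1 + (A i 1 : Ex) * x 2 + (A i 2 : Ex) * x 3 + d i
  eqE (y 0) ((x 0 : Ex) + t) ⋏ eqE (y 1) (row 0) ⋏ eqE (y 2) (row 1) ⋏ eqE (y 3) (row 2)

/-- The same transformation, with the parameters read off from the variables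
`i` (for `t`), `i + 1, …, i + 3` (for `d`) and `i + 4, …, i + 12` (for `A`). -/
def trivMapsAt (i : ℕ) (x y : Pt) : Fml :=
  trivMaps (.var i) (fun j => .var (i + 1 + j)) (fun j l => .var (i + 4 + (3 * j + l))) x y

/-- Any trivial transformation (isometry on space and translation along the time axis) of an
inertial coordinate system is also an inertial coordinate system. -/
def AxTriv : Fml :=
  allsQ 13
    (allsQ 16 (trivMapsAt 16 (pt 0) (pt 8) ⋏ trivMapsAt 16 (pt 4) (pt 12) ⇒
      eqE (space (pt 0) (pt 4)) (space (pt 8) (pt 12))) ⇒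
    allB (iob 0 ⇒ exB (iob 0 ⋏
      allsQ 8 (sameEv 1 (pt 0) 0 (pt 4) ⇔ trivMapsAt 8 (pt 0) (pt 4)))))

/-- All observers are inertial observers. -/
def AxNoAcc : Fml := allB (exB (exsQ 4 (wv 1 0 (pt 0))) ⇒ iob 0)

/-- The axioms shared by classical and relativistic kinematics. -/
def KinFull : Set Fml := {AxEField, AxEv, AxSelf, AxSymD, AxLine, AxTriv, AxNoAcc}

/-! ### Classical kinematics -/

/-- The time difference between any two events is the same for all inertial observers. -/
def AxAbsTime : Fml :=
  let x := pt 0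
  let y := pt 4
  let x' := pt 8
  let y' := pt 12
  allB (allB (iob 1 ⋏ iob 0 ⇒ allsQ 16
    (sameEv 1 x 0 x' ⋏ sameEv 1 y 0 y' ⇒ eqE (time x y) (time x' y'))))

/-- Inertial observers can move along any non-horizontal straight line. -/
def AxThExpPlus : Fml :=
  exB (iob 0) ⋏
  allB (iob 0 ⇒ allsQ 8 (∼(eqQ (pt 0 0) (pt 4 0)) ⇒ exB (iob 0 ⋏ onWl 1 0 (pt 0) (pt 4))))

/-- `e` is an ether observer. -/
def ether (e : ℕ) : Fml := iob e ⋏ exQ (ltE 0 (Tm.var 0) ⋏ lightSpeedAt e (.var 0))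

/-- There is an ether observer. -/
def AxEther : Fml := exB (ether 0)

def ClassicalKinFull : Set Fml := KinFull ∪ {AxAbsTime, AxThExpPlus, AxEther}

/-! ### Special relativity -/

/-- `c` is the observer-independent speed of light. -/
def isLightSpeed (c : Tm) : Fml := ltE 0 c ⋏ allB (iob 0 ⇒ lightSpeedAt 0 c)

/-- For any inertial observer, the speed of light is the same everywhere and in every direction. -/
def AxPhc : Fml := exQ (isLightSpeed (.var 0))

/-- Inertial observers can move along any straight line of any speed less than that of light. -/
def AxThExp : Fml :=
  exB (iob 0) ⋏
  allB (iob 0 ⇒ allsQ 8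
    (exQ (isLightSpeed (.var 0) ⋏ ltE (space (pt 1) (pt 5)) (Tm.var 0 * time (pt 1) (pt 5))) ⇒
      exB (iob 0 ⋏ onWl 1 0 (pt 0) (pt 4))))

def SpecRelFull : Set Fml := KinFull ∪ {AxPhc, AxThExp}

/-! ### Radarization -/

/-- `c` is the speed of light according to the ether observers. -/
def isEtherLightSpeed (c : Tm) : Fml := ltE 0 c ⋏ allB (ether 0 ⇒ lightSpeedAt 0 c)

/-- The length of a vector. -/
def norm3 (v : Fin 3 → Tm) : Ex :=
  .sqrt ((v 0 : Ex).sq + (v 1 : Ex).sq + (v 2 : Ex).sq)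

/-- `M x = y` -/
def matMaps (M : Matrix (Fin 4) (Fin 4) Ex) (x y : Pt) : Fml :=
  let row (i : Fin 4) : Ex := M i 0 * x 0 + M i 1 * x 1 + M i 2 * x 2 + M i 3 * x 3
  eqE (row 0) (y 0) ⋏ eqE (row 1) (y 1) ⋏ eqE (row 2) (y 2) ⋏ eqE (row 3) (y 3)

/-- The matrix that takes `(1, v)` to `(1, -|v|, 0, 0)`, for `v` not on the first axis. -/
def rotMat (v : Fin 3 → Tm) : Matrix (Fin 4) (Fin 4) Ex :=
  let n := norm3 v
  let vx : Ex := v 0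
  let vy : Ex := v 1
  let vz : Ex := v 2
  let s : Ex := vy.sq + vz.sq
  let M : Matrix (Fin 4) (Fin 4) Ex :=
    !![n, 0, 0, 0;
       0, -vx, -vy, -vz;
       0, vy, -vx - vz.sq * (n - vx) / s, vy * vz * (n - vx) / s;
       0, vz, vy * vz * (n - vx) / s, -vx - vy.sq * (n - vx) / s]
  Matrix.of fun i j => 1 / n * M i j

/-- `R_v(x) = y`, where `R_v` is the orthogonal map of space taking `v` to `(-|v|, 0, 0)`. -/
def rotMaps (v : Fin 3 → Tm) (x y : Pt) : Fml :=
  ((∼(eqE (v 1) 0) ⋎ ∼(eqE (v 2) 0)) ⋏ matMaps (rotMat v) x y) ⋎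
  (leE (v 0) 0 ⋏ eqE (v 1) 0 ⋏ eqE (v 2) 0 ⋏ eqPt x y) ⋎
  (ltE 0 (v 0) ⋏ eqE (v 1) 0 ⋏ eqE (v 2) 0 ⋏
    matMaps !![1, 0, 0, 0; 0, -1, 0, 0; 0, 0, -1, 0; 0, 0, 0, -1] x y)

/-- The Galilean boost `G_n`. -/
def galMat (n : Ex) : Matrix (Fin 4) (Fin 4) Ex :=
  !![1, 0, 0, 0; n, 1, 0, 0; 0, 0, 1, 0; 0, 0, 0, 1]

/-- The scale factor `S_n = √(1 - n² / c²)`. -/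
def scale (c : Tm) (n : Ex) : Ex := .sqrt (1 - n.sq / (c : Ex).sq)

/-- The matrix `E_n` of Poincaré–Einstein synchronisation. -/
def synMat (c : Tm) (n : Ex) : Matrix (Fin 4) (Fin 4) Ex :=
  let d : Ex := 1 - n.sq / (c : Ex).sq
  !![1 / d, -(n / (c : Ex).sq) / d, 0, 0;
     -n / d, 1 / d, 0, 0;
     0, 0, 1 / scale c n, 0;
     0, 0, 0, 1 / scale c n]

/-- Scaling by the factor `S_n`. -/
def scaleMat (c : Tm) (n : Ex) : Matrix (Fin 4) (Fin 4) Ex :=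
  !![scale c n, 0, 0, 0; 0, scale c n, 0, 0; 0, 0, scale c n, 0; 0, 0, 0, scale c n]

/-- `Rad_v(x) = y`, where `Rad_v = R_v⁻¹ ∘ S_n ∘ E_n ∘ G_n ∘ R_v` for `n = |v|`, and `Rad_v` is
defined only if `|v|` is less than the speed `c` of light according to the ether observers. The
intermediate points are `R_v x = p`, `G_n p = q`, `E_n q = r`, `S_n r = s`, with `R_v y = s`. -/
def radMaps (v : Fin 3 → Tm) (x y : Pt) : Fml :=
  exsQ 17
    (let p := pt 0
     let q := pt 4
     let r := pt 8
     let s := pt 12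
     let c := Tm.var 16
     let u : Fin 3 → Tm := fun i => (v i).lift 17
     isEtherLightSpeed c ⋏ ltE (norm3 u) c ⋏
     rotMaps u (Pt.lift 17 x) p ⋏ matMaps (galMat (norm3 u)) p q ⋏
     matMaps (synMat c (norm3 u)) q r ⋏ matMaps (scaleMat c (norm3 u)) r s ⋏
     rotMaps u (Pt.lift 17 y) s)

/-! ### The translation -/

/-- The speed of `k` according to `e` is less than the ether speed of light. -/
def slowerThanLight (e k : ℕ) : Fml :=
  exsQ 2 (isSpeed e k (.var 0) ⋏ isEtherLightSpeed (.var 1) ⋏ ltE (Tm.var 0) (Tm.var 1))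

/-- `W(k, b, Rad⁻¹(x))` with `Rad = Rad_v` for the velocity `v` of `e` according to `k`. -/
def wvRadInv (e k b : ℕ) (x : Pt) : Fml :=
  exsQ 7
    (let y := pt 0
     let v : Fin 3 → Tm := fun i => .var (4 + i)
     isVelocity k e v ⋏ radMaps v y (Pt.lift 7 x) ⋏ wv k b y)

set_option maxRecDepth 50000 in
/-- The translation of special relativity into classical kinematics. -/
def Tr : Translation where
  le := .le (.var 0) (.var 1)
  iob := .iob 0 ⋏ allB (ether 0 ⇒ slowerThanLight 0 1)
  ph := .ph 0
  wv := allB (ether 0 ⇒ wvRadInv 0 1 2 (pt 0))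
  le_closed := by rfl
  iob_closed := by rfl
  ph_closed := by rfl
  wv_closed := by rfl

end CompKin

set_option linter.unusedSectionVars false

namespace CompKin

open Fml

/-! ### Substitution algebra -/

/-! The statement is about derivations, but the argument is semantic. In a model `S` of classical
kinematics the formulas of `Tr` define new relations on the same bodies and quantities, which gives
the structure `S.radarized`. `S` satisfies the translation of a formula exactly when `S.radarized`
satisfies the formula (`Str.realize_apply_Tr`). Once `S.radarized` is known to be a model of special
relativity (`ClassicalKin.specRel_radarized`), soundness (`Provable.sound`) makes every theorem of
special relativity true in it. Its translation then holds in all models of classical kinematics and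
is derivable by completeness (`Provable.complete`). Completeness is a Henkin construction; since
`ClassicalKinFull` is finite, fresh variables never run out and no new constants are needed.

The kinematics rests on four facts. (1) Between two classical inertial observers the coordinate
change preserves time differences, distances of simultaneous events and non-horizontal lines, so it
is Galilean: `(t, p) ↦ (ε t + t₀, A p + t u + d)` with `ε = ±1` and `A` orthogonal
(`ClassicalKin.exists_gal`). (2) If light has a direction-independent speed for both observers, then
`u = 0` and the two speeds agree; so the ether observers share one light speed `c`, and a given
observer sees all of them with one velocity `ε u`. (3) The rotation `R_v` cancels from `Rad_v`,
which leaves the coordinate-free formula `rad` (`rotFun_eq_stdRad_iff`). (4) Radarization after the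
Galilean map from an ether observer preserves the Minkowski form `c² Δt² - |Δp|²`
(`mink_rad_galMap`).

Consequently every observer slower than light is linked, in the new structure, to a fixed ether
observer `e` by an affine bijection that preserves the Minkowski form (`ClassicalKin.exists_frame`).
Most axioms are then read off in the coordinates of `e`: `AxPhc` is the invariance of the light
cone, `AxSymD` that of the form on simultaneous pairs, and `AxThExp` follows from `AxThExpPlus`
along timelike lines. `AxSelf` holds because radarization keeps the time axis, and `AxTriv` because
it commutes with rotations. -/

/-- Prepend a value to an assignment of variables. -/
def cons {α : Type} (a : α) (f : ℕ → α) : ℕ → α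
  | 0 => a
  | n + 1 => f n

@[simp] theorem cons_zero {α : Type} (a : α) (f : ℕ → α) : cons a f 0 = a := rfl

@[simp] theorem cons_succ {α : Type} (a : α) (f : ℕ → α) (n : ℕ) : cons a f (n + 1) = f n := rfl

theorem Fml.instB_eq (φ : Fml) (b : ℕ) : φ.instB b = φ.subst (cons b id) .var := by
  unfold Fml.instB
  congr 1

theorem Fml.instQ_eq (φ : Fml) (t : Tm) : φ.instQ t = φ.subst id (cons t .var) := by
  unfold Fml.instQ
  congr 1

theorem Tm.subst_subst (σ τ : ℕ → Tm) (t : Tm) :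
    (t.subst σ).subst τ = t.subst fun n => (σ n).subst τ := by
  induction t with
  | var n => rfl
  | add s t hs ht => simp only [Tm.subst, hs, ht]
  | mul s t hs ht => simp only [Tm.subst, hs, ht]

@[simp] theorem Tm.subst_var (t : Tm) : t.subst .var = t := by
  induction t with
  | var n => rfl
  | add s t hs ht => simp only [Tm.subst, hs, ht]
  | mul s t hs ht => simp only [Tm.subst, hs, ht]

theorem upB_comp (β β' : ℕ → ℕ) : upB β' ∘ upB β = upB (β' ∘ β) := by
  funext n
  cases n <;> rfl

theorem upB_id : upB id = id := by
  funext n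
  cases n <;> rfl

theorem upQ_comp (σ τ : ℕ → Tm) :
    (fun n => (upQ σ n).subst (upQ τ)) = upQ fun n => (σ n).subst τ := by
  funext n
  cases n with
  | zero => rfl
  | succ n => simp only [upQ, Tm.lift, Tm.subst_subst, Tm.subst]

theorem upQ_var : upQ Tm.var = Tm.var := by
  funext n
  cases n <;> rfl

theorem Fml.subst_subst (φ : Fml) : ∀ (β : ℕ → ℕ) (σ : ℕ → Tm) (β' : ℕ → ℕ) (σ' : ℕ → Tm),
    (φ.subst β σ).subst β' σ' = φ.subst (β' ∘ β) fun n => (σ n).subst σ' := by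
  induction φ with
  | imp φ ψ hφ hψ => intros; simp only [Fml.subst, hφ, hψ]
  | allB φ ih => intros; simp only [Fml.subst, ih, upB_comp]
  | allQ φ ih => intros; simp only [Fml.subst, ih, upQ_comp]
  | _ => intros; simp only [Fml.subst, Tm.subst_subst, Function.comp]

@[simp] theorem Fml.subst_id (φ : Fml) : φ.subst id .var = φ := by
  induction φ with
  | imp φ ψ hφ hψ => simp only [Fml.subst, hφ, hψ]
  | allB φ ih => simp only [Fml.subst, ih, upB_id]
  | allQ φ ih => simp only [Fml.subst, ih, upQ_var]
  | _ => simp only [Fml.subst, Tm.subst_var, id]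

theorem Fml.subst_shiftB (φ : Fml) (β : ℕ → ℕ) (σ : ℕ → Tm) :
    φ.shiftB.subst (upB β) σ = (φ.subst β σ).shiftB := by
  simp only [Fml.shiftB, Fml.subst_subst, Tm.subst_var]
  rfl

theorem Fml.subst_shiftQ (φ : Fml) (β : ℕ → ℕ) (σ : ℕ → Tm) :
    φ.shiftQ.subst β (upQ σ) = (φ.subst β σ).shiftQ := by
  simp only [Fml.shiftQ, Fml.subst_subst]
  rfl

theorem Fml.subst_upB_instB (φ : Fml) (β : ℕ → ℕ) (σ : ℕ → Tm) (b : ℕ) :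
    (φ.subst (upB β) σ).instB b = φ.subst (cons b β) σ := by
  simp only [Fml.instB_eq, Fml.subst_subst, Tm.subst_var]
  congr 1
  funext n
  cases n <;> rfl

theorem Fml.subst_upQ_instQ (φ : Fml) (β : ℕ → ℕ) (σ : ℕ → Tm) (t : Tm) :
    (φ.subst β (upQ σ)).instQ t = φ.subst β (cons t σ) := by
  simp only [Fml.instQ_eq, Fml.subst_subst]
  congr 1
  funext n
  cases n with
  | zero => rfl
  | succ n => simp only [upQ, Tm.lift, Tm.subst_subst, Tm.subst, cons_succ]; exact Tm.subst_var _

theorem Fml.subst_instB (φ : Fml) (β : ℕ → ℕ) (σ : ℕ → Tm) (b : ℕ) :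
    (φ.instB b).subst β σ = (φ.subst (upB β) σ).instB (β b) := by
  rw [Fml.subst_upB_instB, Fml.instB_eq, Fml.subst_subst]
  simp only [Tm.subst]
  congr 1
  funext n
  cases n <;> rfl

theorem Fml.subst_instQ (φ : Fml) (β : ℕ → ℕ) (σ : ℕ → Tm) (t : Tm) :
    (φ.instQ t).subst β σ = (φ.subst β (upQ σ)).instQ (t.subst σ) := by
  rw [Fml.subst_upQ_instQ, Fml.instQ_eq, Fml.subst_subst]
  congr 1
  funext n
  cases n <;> rfl

/-! ### Structural properties of derivability -/

theorem Provable.mono {Γ Δ : Set Fml} {φ : Fml} (h : Provable Γ φ) (hΓ : Γ ⊆ Δ) :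
    Provable Δ φ := by
  induction h generalizing Δ with
  | hyp h => exact .hyp (hΓ h)
  | impI _ ih => exact .impI (ih (Set.insert_subset_insert hΓ))
  | impE _ _ ih₁ ih₂ => exact .impE (ih₁ hΓ) (ih₂ hΓ)
  | raa _ ih => exact .raa (ih (Set.insert_subset_insert hΓ))
  | allBI _ ih => exact .allBI (ih (Set.image_mono hΓ))
  | allBE b _ ih => exact .allBE b (ih hΓ)
  | allQI _ ih => exact .allQI (ih (Set.image_mono hΓ))
  | allQE t _ ih => exact .allQE t (ih hΓ)
  | reflB b => exact .reflB b
  | reflQ t => exact .reflQ t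
  | replB φ _ _ ih₁ ih₂ => exact .replB φ (ih₁ hΓ) (ih₂ hΓ)
  | replQ φ _ _ ih₁ ih₂ => exact .replQ φ (ih₁ hΓ) (ih₂ hΓ)

/-- Stability under arbitrary, possibly non-injective, substitutions allows a fresh variable to be
renamed to a bound one. In the quantifier rules the substitution commutes with the shift of the
context. -/
theorem Provable.subst {Γ : Set Fml} {φ : Fml} (h : Provable Γ φ) (β : ℕ → ℕ) (σ : ℕ → Tm) :
    Provable (Fml.subst β σ '' Γ) (φ.subst β σ) := by
  induction h generalizing β σ with
  | hyp h => exact .hyp (Set.mem_image_of_mem _ h)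
  | impI _ ih =>
    have := ih β σ
    rw [Set.image_insert_eq] at this
    exact .impI this
  | impE _ _ ih₁ ih₂ => exact .impE (ih₁ β σ) (ih₂ β σ)
  | raa _ ih =>
    have := ih β σ
    rw [Set.image_insert_eq] at this
    exact .raa this
  | allBI _ ih =>
    have := ih (upB β) σ
    simp only [Set.image_image, Fml.subst_shiftB] at this
    refine .allBI ?_
    simpa only [Set.image_image] using this
  | allBE b _ ih => rw [Fml.subst_instB]; exact .allBE _ (ih β σ)
  | allQI _ ih =>
    have := ih β (upQ σ)
    simp only [Set.image_image, Fml.subst_shiftQ] at this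
    refine .allQI ?_
    simpa only [Set.image_image] using this
  | allQE t _ ih => rw [Fml.subst_instQ]; exact .allQE _ (ih β σ)
  | reflB b => exact .reflB _
  | reflQ t => exact .reflQ _
  | replB φ _ _ ih₁ ih₂ =>
    have h := ih₂ β σ
    rw [Fml.subst_instB] at h ⊢
    exact .replB _ (ih₁ β σ) h
  | replQ φ _ _ ih₁ ih₂ =>
    have h := ih₂ β σ
    rw [Fml.subst_instQ] at h ⊢
    exact .replQ _ (ih₁ β σ) h

/-- Serves to show that the union of an increasing chain of consistent sets is consistent. -/
theorem Provable.exists_finite {Γ : Set Fml} {φ : Fml} (h : Provable Γ φ) :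
    ∃ Δ ⊆ Γ, Δ.Finite ∧ Provable Δ φ := by
  have hinsert : ∀ {Γ Δ : Set Fml} {ψ : Fml}, Δ ⊆ insert ψ Γ → Δ.Finite →
      ∃ Δ' ⊆ Γ, Δ'.Finite ∧ Δ ⊆ insert ψ Δ' := by
    intro Γ Δ ψ hΔ hf
    refine ⟨Δ \ {ψ}, ?_, hf.sdiff, ?_⟩
    · rintro x ⟨hx, hxψ⟩
      exact (hΔ hx).resolve_left hxψ
    · intro x hx
      by_cases hxψ : x = ψ
      · exact Or.inl hxψ
      · exact Or.inr ⟨hx, hxψ⟩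
  have himage : ∀ {Γ Δ : Set Fml} {f : Fml → Fml}, Δ ⊆ f '' Γ → Δ.Finite →
      ∃ Δ' ⊆ Γ, Δ'.Finite ∧ f '' Δ' = Δ := by
    intro Γ Δ f hΔ hf
    obtain ⟨t, ht, rfl⟩ := Set.subset_image_iff.1 hΔ
    -- One preimage per element suffices, so the chosen preimages form a finite set whether or not
    -- `f` is injective.
    obtain ⟨u, hu, hbij⟩ := Set.exists_subset_bijOn t f
    refine ⟨u, hu.trans ht, ?_, hbij.image_eq⟩
    exact Set.Finite.of_finite_image (hbij.image_eq ▸ hf) hbij.injOn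
  induction h with
  | @hyp Γ φ h => exact ⟨{φ}, by simpa using h, Set.finite_singleton _, .hyp rfl⟩
  | impI _ ih =>
    obtain ⟨Δ, h₁, h₂, h₃⟩ := ih
    obtain ⟨Δ', h₄, h₅, h₆⟩ := hinsert h₁ h₂
    exact ⟨Δ', h₄, h₅, .impI (h₃.mono h₆)⟩
  | impE _ _ ih₁ ih₂ =>
    obtain ⟨Δ, h₁, h₂, h₃⟩ := ih₁
    obtain ⟨Δ', h₄, h₅, h₆⟩ := ih₂
    exact ⟨Δ ∪ Δ', Set.union_subset h₁ h₄, h₂.union h₅,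
      .impE (h₃.mono Set.subset_union_left) (h₆.mono Set.subset_union_right)⟩
  | raa _ ih =>
    obtain ⟨Δ, h₁, h₂, h₃⟩ := ih
    obtain ⟨Δ', h₄, h₅, h₆⟩ := hinsert h₁ h₂
    exact ⟨Δ', h₄, h₅, .raa (h₃.mono h₆)⟩
  | allBI _ ih =>
    obtain ⟨Δ, h₁, h₂, h₃⟩ := ih
    obtain ⟨Δ', h₄, h₅, rfl⟩ := himage h₁ h₂
    exact ⟨Δ', h₄, h₅, .allBI h₃⟩
  | allBE b _ ih =>
    obtain ⟨Δ, h₁, h₂, h₃⟩ := ih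
    exact ⟨Δ, h₁, h₂, .allBE b h₃⟩
  | allQI _ ih =>
    obtain ⟨Δ, h₁, h₂, h₃⟩ := ih
    obtain ⟨Δ', h₄, h₅, rfl⟩ := himage h₁ h₂
    exact ⟨Δ', h₄, h₅, .allQI h₃⟩
  | allQE t _ ih =>
    obtain ⟨Δ, h₁, h₂, h₃⟩ := ih
    exact ⟨Δ, h₁, h₂, .allQE t h₃⟩
  | reflB b => exact ⟨∅, Set.empty_subset _, Set.finite_empty, .reflB b⟩
  | reflQ t => exact ⟨∅, Set.empty_subset _, Set.finite_empty, .reflQ t⟩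
  | replB φ _ _ ih₁ ih₂ =>
    obtain ⟨Δ, h₁, h₂, h₃⟩ := ih₁
    obtain ⟨Δ', h₄, h₅, h₆⟩ := ih₂
    exact ⟨Δ ∪ Δ', Set.union_subset h₁ h₄, h₂.union h₅,
      .replB φ (h₃.mono Set.subset_union_left) (h₆.mono Set.subset_union_right)⟩
  | replQ φ _ _ ih₁ ih₂ =>
    obtain ⟨Δ, h₁, h₂, h₃⟩ := ih₁
    obtain ⟨Δ', h₄, h₅, h₆⟩ := ih₂
    exact ⟨Δ ∪ Δ', Set.union_subset h₁ h₄, h₂.union h₅,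
      .replQ φ (h₃.mono Set.subset_union_left) (h₆.mono Set.subset_union_right)⟩

/-! ### Bounds on free variables -/

theorem Tm.closedIn_mono {t : Tm} {n n' : ℕ} (hn : n ≤ n') (h : t.closedIn n = true) :
    t.closedIn n' = true := by
  induction t with
  | var i => simp only [Tm.closedIn, decide_eq_true_eq] at h ⊢; omega
  | add s t hs ht => simp only [Tm.closedIn, Bool.and_eq_true] at h ⊢; exact ⟨hs h.1, ht h.2⟩
  | mul s t hs ht => simp only [Tm.closedIn, Bool.and_eq_true] at h ⊢; exact ⟨hs h.1, ht h.2⟩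

theorem Fml.closedIn_mono {φ : Fml} {m m' n n' : ℕ} (hm : m ≤ m') (hn : n ≤ n')
    (h : φ.closedIn m n = true) : φ.closedIn m' n' = true := by
  induction φ generalizing m m' n n' with
  | eqB k b => simp only [Fml.closedIn, Bool.and_eq_true, decide_eq_true_eq] at h ⊢; omega
  | eqQ s t =>
    simp only [Fml.closedIn, Bool.and_eq_true] at h ⊢
    exact ⟨Tm.closedIn_mono hn h.1, Tm.closedIn_mono hn h.2⟩
  | le s t =>
    simp only [Fml.closedIn, Bool.and_eq_true] at h ⊢
    exact ⟨Tm.closedIn_mono hn h.1, Tm.closedIn_mono hn h.2⟩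
  | iob k => simp only [Fml.closedIn, decide_eq_true_eq] at h ⊢; omega
  | ph k => simp only [Fml.closedIn, decide_eq_true_eq] at h ⊢; omega
  | wv k b x =>
    simp only [Fml.closedIn, Bool.and_eq_true, decide_eq_true_eq] at h ⊢
    obtain ⟨⟨h₁, h₂⟩, ⟨⟨h₃, h₄⟩, h₅⟩, h₆⟩ := h
    exact ⟨⟨by omega, by omega⟩, ⟨⟨Tm.closedIn_mono hn h₃, Tm.closedIn_mono hn h₄⟩,
      Tm.closedIn_mono hn h₅⟩, Tm.closedIn_mono hn h₆⟩
  | fls => rfl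
  | imp φ ψ hφ hψ =>
    simp only [Fml.closedIn, Bool.and_eq_true] at h ⊢
    exact ⟨hφ hm hn h.1, hψ hm hn h.2⟩
  | allB φ ih => exact ih (m := m + 1) (m' := m' + 1) (by omega) hn h
  | allQ φ ih => exact ih (n := n + 1) (n' := n' + 1) hm (by omega) h

theorem Tm.exists_closedIn (t : Tm) : ∃ n, t.closedIn n = true := by
  induction t with
  | var i => exact ⟨i + 1, by simp [Tm.closedIn]⟩
  | add s t hs ht =>
    obtain ⟨n, hs⟩ := hs
    obtain ⟨n', ht⟩ := ht
    exact ⟨max n n', by simp only [Tm.closedIn, Bool.and_eq_true]; exact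
      ⟨Tm.closedIn_mono (le_max_left _ _) hs, Tm.closedIn_mono (le_max_right _ _) ht⟩⟩
  | mul s t hs ht =>
    obtain ⟨n, hs⟩ := hs
    obtain ⟨n', ht⟩ := ht
    exact ⟨max n n', by simp only [Tm.closedIn, Bool.and_eq_true]; exact
      ⟨Tm.closedIn_mono (le_max_left _ _) hs, Tm.closedIn_mono (le_max_right _ _) ht⟩⟩

theorem Fml.exists_closedIn (φ : Fml) : ∃ n, φ.closedIn n n = true := by
  induction φ with
  | eqB k b => exact ⟨k + b + 1, by simp only [Fml.closedIn, Bool.and_eq_true, decide_eq_true_eq]; omega⟩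
  | eqQ s t =>
    obtain ⟨n, hs⟩ := s.exists_closedIn
    obtain ⟨n', ht⟩ := t.exists_closedIn
    exact ⟨max n n', by simp only [Fml.closedIn, Bool.and_eq_true]; exact
      ⟨Tm.closedIn_mono (le_max_left _ _) hs, Tm.closedIn_mono (le_max_right _ _) ht⟩⟩
  | le s t =>
    obtain ⟨n, hs⟩ := s.exists_closedIn
    obtain ⟨n', ht⟩ := t.exists_closedIn
    exact ⟨max n n', by simp only [Fml.closedIn, Bool.and_eq_true]; exact
      ⟨Tm.closedIn_mono (le_max_left _ _) hs, Tm.closedIn_mono (le_max_right _ _) ht⟩⟩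
  | iob k => exact ⟨k + 1, by simp [Fml.closedIn]⟩
  | ph k => exact ⟨k + 1, by simp [Fml.closedIn]⟩
  | wv k b x =>
    choose n hn using fun i => (x i).exists_closedIn
    refine ⟨k + b + 1 + (n 0 + n 1 + n 2 + n 3), ?_⟩
    simp only [Fml.closedIn, Bool.and_eq_true, decide_eq_true_eq]
    exact ⟨⟨by omega, by omega⟩, ⟨⟨Tm.closedIn_mono (by omega) (hn 0),
      Tm.closedIn_mono (by omega) (hn 1)⟩, Tm.closedIn_mono (by omega) (hn 2)⟩,
      Tm.closedIn_mono (by omega) (hn 3)⟩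
  | fls => exact ⟨0, rfl⟩
  | imp φ ψ hφ hψ =>
    obtain ⟨n, hφ⟩ := hφ
    obtain ⟨n', hψ⟩ := hψ
    refine ⟨max n n', ?_⟩
    simp only [Fml.closedIn, Bool.and_eq_true]
    exact ⟨Fml.closedIn_mono (le_max_left _ _) (le_max_left _ _) hφ,
      Fml.closedIn_mono (le_max_right _ _) (le_max_right _ _) hψ⟩
  | allB φ ih =>
    obtain ⟨n, h⟩ := ih
    exact ⟨n, Fml.closedIn_mono (φ := φ) (Nat.le_succ n) le_rfl h⟩
  | allQ φ ih =>
    obtain ⟨n, h⟩ := ih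
    exact ⟨n, Fml.closedIn_mono (φ := φ) le_rfl (Nat.le_succ n) h⟩

/-- Supplies an index that is fresh for a whole finite context. The completeness proof needs
finiteness for this reason. -/
theorem exists_closedIn_of_finite {Γ : Set Fml} (h : Γ.Finite) :
    ∃ n, ∀ φ ∈ Γ, φ.closedIn n n = true := by
  induction Γ, h using Set.Finite.induction_on with
  | empty => exact ⟨0, by simp⟩
  | @insert φ Γ _ _ ih =>
    obtain ⟨n, hn⟩ := ih
    obtain ⟨n', hn'⟩ := φ.exists_closedIn
    refine ⟨max n n', ?_⟩
    rintro ψ (rfl | hψ)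
    · exact Fml.closedIn_mono (le_max_right _ _) (le_max_right _ _) hn'
    · exact Fml.closedIn_mono (le_max_left _ _) (le_max_left _ _) (hn ψ hψ)

theorem Tm.subst_congr {t : Tm} {n : ℕ} {σ σ' : ℕ → Tm} (h : t.closedIn n = true)
    (hσ : ∀ i < n, σ i = σ' i) : t.subst σ = t.subst σ' := by
  induction t with
  | var i => exact hσ i (by simpa [Tm.closedIn] using h)
  | add s t hs ht =>
    simp only [Tm.closedIn, Bool.and_eq_true] at h
    simp only [Tm.subst, hs h.1, ht h.2]
  | mul s t hs ht =>
    simp only [Tm.closedIn, Bool.and_eq_true] at h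
    simp only [Tm.subst, hs h.1, ht h.2]

theorem Fml.subst_congr {φ : Fml} {m n : ℕ} {β β' : ℕ → ℕ} {σ σ' : ℕ → Tm}
    (h : φ.closedIn m n = true) (hβ : ∀ i < m, β i = β' i) (hσ : ∀ i < n, σ i = σ' i) :
    φ.subst β σ = φ.subst β' σ' := by
  induction φ generalizing m n β β' σ σ' with
  | eqB k b =>
    simp only [Fml.closedIn, Bool.and_eq_true, decide_eq_true_eq] at h
    simp only [Fml.subst, hβ _ h.1, hβ _ h.2]
  | eqQ s t =>
    simp only [Fml.closedIn, Bool.and_eq_true] at h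
    simp only [Fml.subst, Tm.subst_congr h.1 hσ, Tm.subst_congr h.2 hσ]
  | le s t =>
    simp only [Fml.closedIn, Bool.and_eq_true] at h
    simp only [Fml.subst, Tm.subst_congr h.1 hσ, Tm.subst_congr h.2 hσ]
  | iob k =>
    simp only [Fml.closedIn, decide_eq_true_eq] at h
    simp only [Fml.subst, hβ _ h]
  | ph k =>
    simp only [Fml.closedIn, decide_eq_true_eq] at h
    simp only [Fml.subst, hβ _ h]
  | wv k b x =>
    simp only [Fml.closedIn, Bool.and_eq_true, decide_eq_true_eq] at h
    obtain ⟨⟨h₁, h₂⟩, ⟨⟨h₃, h₄⟩, h₅⟩, h₆⟩ := h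
    simp only [Fml.subst, hβ _ h₁, hβ _ h₂]
    congr 1
    funext i
    fin_cases i
    exacts [Tm.subst_congr h₃ hσ, Tm.subst_congr h₄ hσ, Tm.subst_congr h₅ hσ,
      Tm.subst_congr h₆ hσ]
  | fls => rfl
  | imp φ ψ hφ hψ =>
    simp only [Fml.closedIn, Bool.and_eq_true] at h
    simp only [Fml.subst, hφ h.1 hβ hσ, hψ h.2 hβ hσ]
  | allB φ ih =>
    simp only [Fml.subst]
    rw [ih (m := m + 1) h ?_ hσ]
    rintro (_ | i) hi
    · rfl
    · simp only [upB, hβ i (by omega)]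
  | allQ φ ih =>
    simp only [Fml.subst]
    rw [ih (n := n + 1) h hβ ?_]
    rintro (_ | i) hi
    · rfl
    · simp only [upQ, hσ i (by omega)]

/-! ### Generalization over fresh variables -/

theorem Provable.allB_of_fresh {Γ : Set Fml} {φ : Fml} {n : ℕ}
    (hΓ : ∀ ψ ∈ Γ, ψ.closedIn n n = true) (hφ : (allB φ).closedIn n n = true)
    (h : Provable Γ (φ.instB n)) : Provable Γ (allB φ) := by
  -- Sending the fresh `n` to `0` and raising all other indices agrees with the shift on the
  -- context, where `n` does not occur, and turns `φ.instB n` back into `φ`.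
  have h' := h.subst (fun i => if i = n then 0 else i + 1) .var
  refine .allBI ?_
  convert h' using 1
  · refine Set.image_congr fun ψ hψ => ?_
    refine Fml.subst_congr (hΓ ψ hψ) (fun i hi => ?_) fun i _ => rfl
    simp [hi.ne]
  · rw [Fml.instB_eq, Fml.subst_subst, ← Fml.subst_id φ, Fml.subst_subst]
    refine Fml.subst_congr (m := n + 1) hφ (fun i hi => ?_) fun i _ => rfl
    rcases i with _ | i
    · simp
    · simp [show i ≠ n by omega]

theorem Provable.allQ_of_fresh {Γ : Set Fml} {φ : Fml} {n : ℕ}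
    (hΓ : ∀ ψ ∈ Γ, ψ.closedIn n n = true) (hφ : (allQ φ).closedIn n n = true)
    (h : Provable Γ (φ.instQ (.var n))) : Provable Γ (allQ φ) := by
  have h' := h.subst id (fun i => if i = n then .var 0 else .var (i + 1))
  refine .allQI ?_
  convert h' using 1
  · refine Set.image_congr fun ψ hψ => ?_
    refine Fml.subst_congr (hΓ ψ hψ) (fun i hi => rfl) fun i hi => ?_
    simp [hi.ne]
  · rw [Fml.instQ_eq, Fml.subst_subst, ← Fml.subst_id φ, Fml.subst_subst]
    refine Fml.subst_congr (n := n + 1) hφ (fun i hi => rfl) fun i hi => ?_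
    rcases i with _ | i
    · simp [Tm.subst]
    · simp [Tm.subst, show i ≠ n by omega]

end CompKin

namespace CompKin

open Fml

/-! ### Semantics -/

/-- The relations on bodies of a structure for the language whose sorts are `B` and `Q`; the
operations and the order on `Q` are given by type classes. -/
structure Str (B Q : Type) where
  iob : B → Prop
  ph : B → Prop
  wv : B → B → (Fin 4 → Q) → Prop

section Semantics

variable {B Q : Type} [Add Q] [Mul Q]

def Tm.eval (s : ℕ → Q) : Tm → Q
  | var n => s n
  | add a b => a.eval s + b.eval s
  | mul a b => a.eval s * b.eval s

def Pt.eval (s : ℕ → Q) (x : Pt) : Fin 4 → Q := fun i => (x i).eval s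

theorem Tm.eval_subst (t : Tm) (σ : ℕ → Tm) (s : ℕ → Q) :
    (t.subst σ).eval s = t.eval fun n => (σ n).eval s := by
  induction t with
  | var n => rfl
  | add a b ha hb => simp only [Tm.subst, Tm.eval, ha, hb]
  | mul a b ha hb => simp only [Tm.subst, Tm.eval, ha, hb]

theorem Pt.eval_subst (x : Pt) (σ : ℕ → Tm) (s : ℕ → Q) :
    Pt.eval s (fun i => (x i).subst σ) = Pt.eval (fun n => (σ n).eval s) x :=
  funext fun i => Tm.eval_subst (x i) σ s

variable [LE Q] (S : Str B Q)

def Str.Realize : Fml → (ℕ → B) → (ℕ → Q) → Prop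
  | eqB k b, r, _ => r k = r b
  | eqQ a b, _, s => a.eval s = b.eval s
  | .le a b, _, s => a.eval s ≤ b.eval s
  | .iob k, r, _ => S.iob (r k)
  | .ph k, r, _ => S.ph (r k)
  | .wv k b x, r, s => S.wv (r k) (r b) (Pt.eval s x)
  | fls, _, _ => False
  | imp φ ψ, r, s => Realize φ r s → Realize ψ r s
  | allB φ, r, s => ∀ b, Realize φ (cons b r) s
  | allQ φ, r, s => ∀ q, Realize φ r (cons q s)

theorem Str.realize_subst (φ : Fml) : ∀ (β : ℕ → ℕ) (σ : ℕ → Tm) (r : ℕ → B) (s : ℕ → Q),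
    S.Realize (φ.subst β σ) r s ↔ S.Realize φ (r ∘ β) fun n => (σ n).eval s := by
  induction φ with
  | imp φ ψ hφ hψ => intros; simp only [Fml.subst, Str.Realize, hφ, hψ]
  | allB φ ih =>
    intro β σ r s
    simp only [Fml.subst, Str.Realize, ih]
    refine forall_congr' fun b => ?_
    rw [show cons b r ∘ upB β = cons b (r ∘ β) by funext n; cases n <;> rfl]
  | allQ φ ih =>
    intro β σ r s
    simp only [Fml.subst, Str.Realize, ih]
    refine forall_congr' fun q => ?_
    rw [show (fun n => (upQ σ n).eval (cons q s)) = cons q fun n => (σ n).eval s by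
      funext n
      cases n with
      | zero => rfl
      | succ n => simp only [upQ, Tm.lift, Tm.eval_subst, cons_succ]; rfl]
  | wv k b x =>
    intros
    simp only [Fml.subst, Str.Realize, Function.comp, Pt.eval_subst]
  | _ => intros; simp only [Fml.subst, Str.Realize, Tm.eval_subst, Function.comp]

theorem Str.realize_shiftB (φ : Fml) (b : B) (r : ℕ → B) (s : ℕ → Q) :
    S.Realize φ.shiftB (cons b r) s ↔ S.Realize φ r s :=
  S.realize_subst φ _ _ _ _

theorem Str.realize_shiftQ (φ : Fml) (q : Q) (r : ℕ → B) (s : ℕ → Q) :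
    S.Realize φ.shiftQ r (cons q s) ↔ S.Realize φ r s :=
  S.realize_subst φ _ _ _ _

theorem Str.realize_instB (φ : Fml) (b : ℕ) (r : ℕ → B) (s : ℕ → Q) :
    S.Realize (φ.instB b) r s ↔ S.Realize φ (cons (r b) r) s := by
  rw [Fml.instB_eq, Str.realize_subst,
    show r ∘ cons b id = cons (r b) r by funext n; cases n <;> rfl]
  rfl

theorem Str.realize_instQ (φ : Fml) (t : Tm) (r : ℕ → B) (s : ℕ → Q) :
    S.Realize (φ.instQ t) r s ↔ S.Realize φ r (cons (t.eval s) s) := by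
  rw [Fml.instQ_eq, Str.realize_subst,
    show (fun n => (cons t Tm.var n).eval s) = cons (t.eval s) s by funext n; cases n <;> rfl]
  rfl

theorem Provable.sound {Γ : Set Fml} {φ : Fml} (h : Provable Γ φ) (r : ℕ → B) (s : ℕ → Q)
    (hΓ : ∀ ψ ∈ Γ, S.Realize ψ r s) : S.Realize φ r s := by
  induction h generalizing r s with
  | hyp h => exact hΓ _ h
  | impI _ ih => exact fun hφ => ih r s (Set.forall_mem_insert.2 ⟨hφ, hΓ⟩)
  | impE _ _ ih₁ ih₂ => exact ih₁ r s hΓ (ih₂ r s hΓ)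
  | raa _ ih => exact by_contra fun hφ => ih r s (Set.forall_mem_insert.2 ⟨hφ, hΓ⟩)
  | allBI _ ih =>
    refine fun b => ih _ _ ?_
    rintro _ ⟨ψ, hψ, rfl⟩
    exact (S.realize_shiftB ψ b r s).2 (hΓ ψ hψ)
  | allBE b _ ih => exact (S.realize_instB _ b r s).2 (ih r s hΓ _)
  | allQI _ ih =>
    refine fun b => ih _ _ ?_
    rintro _ ⟨ψ, hψ, rfl⟩
    exact (S.realize_shiftQ ψ b r s).2 (hΓ ψ hψ)
  | allQE t _ ih => exact (S.realize_instQ _ t r s).2 (ih r s hΓ _)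
  | reflB b => rfl
  | reflQ t => rfl
  | replB φ _ _ ih₁ ih₂ =>
    have h₁ : r _ = r _ := ih₁ r s hΓ
    have h₂ := ih₂ r s hΓ
    rw [S.realize_instB] at h₂ ⊢
    rwa [← h₁]
  | replQ φ _ _ ih₁ ih₂ =>
    have h₁ : Tm.eval s _ = Tm.eval s _ := ih₁ r s hΓ
    have h₂ := ih₂ r s hΓ
    rw [S.realize_instQ] at h₂ ⊢
    rwa [← h₁]

end Semantics

/-! ### Countability of the set of formulas -/

def Tm.code : Tm → ℕ
  | var n => Nat.pair 0 n
  | add s t => Nat.pair 1 (Nat.pair s.code t.code)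
  | mul s t => Nat.pair 2 (Nat.pair s.code t.code)

theorem Tm.code_injective : Function.Injective Tm.code := by
  intro s t h
  induction s generalizing t with
  | var n => cases t <;> simp_all [Tm.code, Nat.pair_eq_pair]
  | add a b ha hb =>
    cases t <;> simp only [Tm.code, Nat.pair_eq_pair] at h
    · omega
    · rw [ha h.2.1, hb h.2.2]
    · omega
  | mul a b ha hb =>
    cases t <;> simp only [Tm.code, Nat.pair_eq_pair] at h
    · omega
    · omega
    · rw [ha h.2.1, hb h.2.2]

def Fml.code : Fml → ℕ
  | eqB k b => Nat.pair 0 (Nat.pair k b)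
  | eqQ s t => Nat.pair 1 (Nat.pair s.code t.code)
  | le s t => Nat.pair 2 (Nat.pair s.code t.code)
  | iob k => Nat.pair 3 k
  | ph k => Nat.pair 4 k
  | wv k b x => Nat.pair 5 (Nat.pair k (Nat.pair b (Nat.pair (x 0).code
      (Nat.pair (x 1).code (Nat.pair (x 2).code (x 3).code)))))
  | fls => Nat.pair 6 0
  | imp φ ψ => Nat.pair 7 (Nat.pair φ.code ψ.code)
  | allB φ => Nat.pair 8 φ.code
  | allQ φ => Nat.pair 9 φ.code

theorem Fml.code_injective : Function.Injective Fml.code := by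
  intro φ ψ h
  induction φ generalizing ψ with
  | eqB | iob | ph | fls =>
    cases ψ <;> simp only [Fml.code, Nat.pair_eq_pair] at h <;> first | omega | simp_all
  | eqQ | le =>
    cases ψ <;> simp only [Fml.code, Nat.pair_eq_pair] at h <;> try omega
    rw [Tm.code_injective h.2.1, Tm.code_injective h.2.2]
  | wv k b x =>
    cases ψ <;> simp only [Fml.code, Nat.pair_eq_pair] at h <;> try omega
    obtain ⟨-, rfl, rfl, h₀, h₁, h₂, h₃⟩ := h
    congr 1
    funext i
    fin_cases i
    exacts [Tm.code_injective h₀, Tm.code_injective h₁, Tm.code_injective h₂,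
      Tm.code_injective h₃]
  | imp φ φ' ih ih' =>
    cases ψ <;> simp only [Fml.code, Nat.pair_eq_pair] at h <;> try omega
    rw [ih h.2.1, ih' h.2.2]
  | allB φ ih | allQ φ ih =>
    cases ψ <;> simp only [Fml.code, Nat.pair_eq_pair] at h <;> try omega
    rw [ih h.2]

/-- The Henkin construction can thus run along a sequence of formulas, with only finitely many of
them in play at each stage. -/
instance : Countable Fml := Fml.code_injective.countable

/-! ### Henkin sets -/

def Consistent (Γ : Set Fml) : Prop := ¬ Provable Γ fls

theorem Consistent.insert_or {Γ : Set Fml} (h : Consistent Γ) (ψ : Fml) :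
    Consistent (insert ψ Γ) ∨ Consistent (insert (∼ψ) Γ) := by
  by_contra! H
  obtain ⟨h₁, h₂⟩ := H
  exact h (.impE (.impI (not_not.1 h₁)) (.raa (not_not.1 h₂)))

theorem Provable.of_insert_neg {Γ : Set Fml} {φ : Fml} (h : ¬ Consistent (insert (∼φ) Γ)) :
    Provable Γ φ :=
  .raa (not_not.1 h)

/-- A finite consistent set can be extended to a finite consistent set that decides `ψ`, with a
witness if `ψ` is a universal statement that is denied. -/
theorem Consistent.exists_decides {Γ : Set Fml} (hf : Γ.Finite) (h : Consistent Γ) (ψ : Fml) :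
    ∃ Δ : Set Fml, Γ ⊆ Δ ∧ Δ.Finite ∧ Consistent Δ ∧ (ψ ∈ Δ ∨ (∼ψ) ∈ Δ ∧
      (∀ χ, ψ = allB χ → ∃ b, (∼(χ.instB b)) ∈ Δ) ∧
      ∀ χ, ψ = allQ χ → ∃ t, (∼(χ.instQ t)) ∈ Δ) := by
  rcases h.insert_or ψ with h | h
  · exact ⟨_, Set.subset_insert _ _, hf.insert _, h, Or.inl (Set.mem_insert _ _)⟩
  obtain ⟨n, hn⟩ := exists_closedIn_of_finite (hf.insert (∼ψ))
  have hψ : ψ.closedIn n n = true := by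
    have := hn _ (Set.mem_insert _ _)
    simp only [Fml.neg, Fml.closedIn, Bool.and_eq_true] at this
    exact this.1
  have hneg : ∀ {Δ : Set Fml}, (∼ψ) ∈ Δ → Provable Δ ψ → Provable Δ fls :=
    fun h₁ h₂ => .impE (.hyp h₁) h₂
  by_cases hB : ∃ χ, ψ = allB χ
  · obtain ⟨χ, rfl⟩ := hB
    refine ⟨insert (∼(χ.instB n)) (insert (∼(allB χ)) Γ),
      (Set.subset_insert _ _).trans (Set.subset_insert _ _), (hf.insert _).insert _, ?_,
      Or.inr ⟨by simp, ?_, by simp⟩⟩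
    -- If the denied instance at the fresh `n` were inconsistent with the context, the instance
    -- would be provable, hence also its generalization, against the consistency of the denied
    -- universal formula.
    · by_contra hc
      exact h (hneg (Set.mem_insert _ _)
        (Provable.allB_of_fresh hn hψ (Provable.of_insert_neg hc)))
    · intro χ' hχ
      cases hχ
      exact ⟨n, by simp⟩
  by_cases hQ : ∃ χ, ψ = allQ χ
  · obtain ⟨χ, rfl⟩ := hQ
    refine ⟨insert (∼(χ.instQ (.var n))) (insert (∼(allQ χ)) Γ),
      (Set.subset_insert _ _).trans (Set.subset_insert _ _), (hf.insert _).insert _, ?_,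
      Or.inr ⟨by simp, by simp, ?_⟩⟩
    · by_contra hc
      exact h (hneg (Set.mem_insert _ _)
        (Provable.allQ_of_fresh hn hψ (Provable.of_insert_neg hc)))
    · intro χ' hχ
      cases hχ
      exact ⟨.var n, by simp⟩
  exact ⟨_, Set.subset_insert _ _, hf.insert _, h, Or.inr ⟨Set.mem_insert _ _,
    fun χ hχ => absurd ⟨χ, hχ⟩ hB, fun χ hχ => absurd ⟨χ, hχ⟩ hQ⟩⟩

/-- A maximal consistent set of formulas with witnesses. -/
structure Henkin (Ω : Set Fml) : Prop where
  consistent : Consistent Ω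
  mem_or : ∀ ψ, ψ ∈ Ω ∨ (∼ψ) ∈ Ω
  exB : ∀ χ, (∀ b, χ.instB b ∈ Ω) → allB χ ∈ Ω
  exQ : ∀ χ, (∀ t, χ.instQ t ∈ Ω) → allQ χ ∈ Ω

/-- All formulas are decided one after the other along an enumeration. The union of the stages is
consistent because a derivation of `fls` has finitely many premises, which lie in a common stage. -/
theorem Consistent.exists_henkin {Γ : Set Fml} (hf : Γ.Finite) (h : Consistent Γ) :
    ∃ Ω, Γ ⊆ Ω ∧ Henkin Ω := by
  have : Nonempty Fml := ⟨fls⟩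
  obtain ⟨e, he⟩ := exists_surjective_nat Fml
  choose step hsub hfin hcon hstep using
    fun (Δ : {Δ : Set Fml // Δ.Finite ∧ Consistent Δ}) ψ => Δ.2.2.exists_decides Δ.2.1 ψ
  let Δ : ℕ → {Δ : Set Fml // Δ.Finite ∧ Consistent Δ} := fun n =>
    Nat.rec ⟨Γ, hf, h⟩ (fun n Δ => ⟨step Δ (e n), hfin _ _, hcon _ _⟩) n
  have hmono : Monotone fun n => (Δ n).1 := monotone_nat_of_le_succ fun n => hsub (Δ n) (e n)
  have hcons : Consistent (⋃ n, (Δ n).1) := by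
    intro hp
    obtain ⟨Θ, hΘ, hΘf, hp⟩ := hp.exists_finite
    obtain ⟨n, hn⟩ := hmono.directed_le.exists_mem_subset_of_finset_subset_biUnion
      (s := hΘf.toFinset) (by simpa using hΘ)
    exact (Δ n).2.2 (hp.mono (by simpa using hn))
  have hno : ∀ ψ, ψ ∈ (⋃ n, (Δ n).1) → (∼ψ) ∉ ⋃ n, (Δ n).1 :=
    fun ψ h₁ h₂ => hcons (.impE (.hyp h₂) (.hyp h₁))
  have hdec : ∀ ψ, ψ ∈ (⋃ n, (Δ n).1) ∨ (∼ψ) ∈ (⋃ n, (Δ n).1) ∧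
      (∀ χ, ψ = allB χ → ∃ b, (∼(χ.instB b)) ∈ ⋃ n, (Δ n).1) ∧
      ∀ χ, ψ = allQ χ → ∃ t, (∼(χ.instQ t)) ∈ ⋃ n, (Δ n).1 := by
    intro ψ
    obtain ⟨n, rfl⟩ := he ψ
    have hn : step (Δ n) (e n) ⊆ ⋃ n, (Δ n).1 :=
      Set.subset_iUnion (fun n => (Δ n).1) (n + 1)
    rcases hstep (Δ n) (e n) with h | ⟨h₁, h₂, h₃⟩
    · exact Or.inl (hn h)
    · exact Or.inr ⟨hn h₁, fun χ hχ => (h₂ χ hχ).imp fun _ h => hn h,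
        fun χ hχ => (h₃ χ hχ).imp fun _ h => hn h⟩
  refine ⟨⋃ n, (Δ n).1, Set.subset_iUnion (fun n => (Δ n).1) 0, hcons,
    fun ψ => (hdec ψ).imp_right And.left, fun χ hχ => ?_, fun χ hχ => ?_⟩
  · refine (hdec (allB χ)).resolve_right fun H => ?_
    obtain ⟨b, hb⟩ := H.2.1 χ rfl
    exact hno _ (hχ b) hb
  · refine (hdec (allQ χ)).resolve_right fun H => ?_
    obtain ⟨b, hb⟩ := H.2.2 χ rfl
    exact hno _ (hχ b) hb

namespace Henkin

variable {Ω : Set Fml} (H : Henkin Ω)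

include H

theorem mem_of_provable {φ : Fml} (h : Provable Ω φ) : φ ∈ Ω :=
  (H.mem_or φ).resolve_right fun hn => H.consistent (.impE (.hyp hn) h)

theorem imp_mem {φ ψ : Fml} : (φ ⇒ ψ) ∈ Ω ↔ (φ ∈ Ω → ψ ∈ Ω) := by
  refine ⟨fun h hφ => H.mem_of_provable (.impE (.hyp h) (.hyp hφ)), fun h => ?_⟩
  refine H.mem_of_provable (.impI ?_)
  rcases H.mem_or φ with hφ | hφ
  · exact .hyp (Or.inr (h hφ))
  · exact .raa (.impE (.hyp (Or.inr (Or.inr hφ))) (.hyp (Or.inr (Or.inl rfl))))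

theorem allB_mem {φ : Fml} : allB φ ∈ Ω ↔ ∀ b, φ.instB b ∈ Ω :=
  ⟨fun h b => H.mem_of_provable (.allBE b (.hyp h)), H.exB φ⟩

theorem allQ_mem {φ : Fml} : allQ φ ∈ Ω ↔ ∀ t, φ.instQ t ∈ Ω :=
  ⟨fun h t => H.mem_of_provable (.allQE t (.hyp h)), H.exQ φ⟩

theorem replB {φ : Fml} {b c : ℕ} (h : eqB b c ∈ Ω) (hφ : φ.instB b ∈ Ω) : φ.instB c ∈ Ω :=
  H.mem_of_provable (.replB φ (.hyp h) (.hyp hφ))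

theorem replQ {φ : Fml} {s t : Tm} (h : eqQ s t ∈ Ω) (hφ : φ.instQ s ∈ Ω) : φ.instQ t ∈ Ω :=
  H.mem_of_provable (.replQ φ (.hyp h) (.hyp hφ))

/-- The replacement rule acts on one variable at a time, so the exchange proceeds variable by
variable: after `k` rounds those below `k` are replaced, and after `m` rounds nothing in `φ` is
left. -/
theorem subst_mem_of_eqB {φ : Fml} {m n : ℕ} (hc : φ.closedIn m n = true) {β β' : ℕ → ℕ}
    {σ : ℕ → Tm} (hβ : ∀ i, eqB (β i) (β' i) ∈ Ω) (h : φ.subst β σ ∈ Ω) :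
    φ.subst β' σ ∈ Ω := by
  have key : ∀ k, φ.subst (fun i => if i < k then β' i else β i) σ ∈ Ω := by
    intro k
    induction k with
    | zero => simpa using h
    | succ k ih =>
      -- A formula with a hole at variable `k`: the hole has index `0`, the other indices are raised
      -- by one, and instantiation lowers them again.
      have e : ∀ b, φ.subst (fun i => if i = k then b else if i < k then β' i else β i) σ =
          (φ.subst (fun i => if i = k then 0 else (if i < k then β' i else β i) + 1) σ).instB b := by
        intro b
        rw [Fml.instB_eq, Fml.subst_subst]
        simp only [Tm.subst_var]
        congr 1
        funext i
        by_cases hi : i = k <;> simp [hi]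
      have h₁ := H.replB (hβ k) (e _ ▸ (show φ.subst _ σ ∈ Ω by
        convert ih using 2
        funext i
        by_cases hi : i = k <;> simp [hi]))
      rw [← e] at h₁
      convert h₁ using 2
      funext i
      rcases lt_trichotomy i k with hi | rfl | hi
      · simp [hi, hi.ne, Nat.lt_succ_of_lt hi]
      · simp
      · simp [hi.ne', not_lt.2 hi.le, show ¬ i < k + 1 by omega]
  have := key m
  rwa [Fml.subst_congr hc (β' := β') (fun i hi => by simp [hi]) fun i _ => rfl] at this

theorem subst_mem_of_eqQ {φ : Fml} {m n : ℕ} (hc : φ.closedIn m n = true) {β : ℕ → ℕ}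
    {σ σ' : ℕ → Tm} (hσ : ∀ i, eqQ (σ i) (σ' i) ∈ Ω) (h : φ.subst β σ ∈ Ω) :
    φ.subst β σ' ∈ Ω := by
  have key : ∀ k, φ.subst β (fun i => if i < k then σ' i else σ i) ∈ Ω := by
    intro k
    induction k with
    | zero => simpa using h
    | succ k ih =>
      have e : ∀ b, φ.subst β (fun i => if i = k then b else if i < k then σ' i else σ i) =
          (φ.subst β (fun i => if i = k then .var 0 else
            (if i < k then σ' i else σ i).lift 1)).instQ b := by
        intro b
        rw [Fml.instQ_eq, Fml.subst_subst]
        congr 1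
        funext i
        by_cases hi : i = k
        · simp [hi, Tm.subst]
        · simp only [hi, if_false, Tm.lift, Tm.subst_subst, Tm.subst, cons_succ, Tm.subst_var]
      have h₁ := H.replQ (hσ k) (e _ ▸ (show φ.subst β _ ∈ Ω by
        convert ih using 2
        funext i
        by_cases hi : i = k <;> simp [hi]))
      rw [← e] at h₁
      convert h₁ using 2
      funext i
      rcases lt_trichotomy i k with hi | rfl | hi
      · simp [hi, hi.ne, Nat.lt_succ_of_lt hi]
      · simp
      · simp [hi.ne', not_lt.2 hi.le, show ¬ i < k + 1 by omega]
  have := key n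
  rwa [Fml.subst_congr hc (σ' := σ') (fun i _ => rfl) fun i hi => by simp [hi]] at this

theorem eqB_symm {b c : ℕ} (h : eqB b c ∈ Ω) : eqB c b ∈ Ω := by
  have : eqB b b ∈ Ω := H.mem_of_provable (.reflB b)
  -- The equation between the hole and `b` becomes `b = b` and `c = b` under the two instantiations;
  -- `b` is raised by one to pass under the hole.
  exact H.replB (φ := eqB 0 (b + 1)) h this

theorem eqB_trans {b c d : ℕ} (h : eqB b c ∈ Ω) (h' : eqB c d ∈ Ω) : eqB b d ∈ Ω :=
  H.replB (φ := eqB (b + 1) 0) h' h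

theorem eqQ_congr {s s' t t' : Tm} (hs : eqQ s s' ∈ Ω) (ht : eqQ t t' ∈ Ω) (h : eqQ s t ∈ Ω) :
    eqQ s' t' ∈ Ω := by
  refine H.subst_mem_of_eqQ (φ := eqQ (.var 0) (.var 1)) (m := 0) (n := 2) rfl
    (σ := cons s fun _ => t) (σ' := cons s' fun _ => t') ?_ h (β := id)
  rintro (_ | i) <;> assumption

theorem eqQ_refl (s : Tm) : eqQ s s ∈ Ω := H.mem_of_provable (.reflQ s)

theorem eqQ_symm {s t : Tm} (h : eqQ s t ∈ Ω) : eqQ t s ∈ Ω :=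
  H.eqQ_congr h (H.eqQ_refl s) (H.eqQ_refl s)

theorem eqQ_trans {s t u : Tm} (h : eqQ s t ∈ Ω) (h' : eqQ t u ∈ Ω) : eqQ s u ∈ Ω :=
  H.eqQ_congr (H.eqQ_refl s) h' h

/-- Equality of body variables in a Henkin set. -/
def setoidB : Setoid ℕ where
  r b c := eqB b c ∈ Ω
  iseqv := ⟨fun b => H.mem_of_provable (.reflB b), H.eqB_symm, H.eqB_trans⟩

/-- Equality of quantity terms in a Henkin set. -/
def setoidQ : Setoid Tm where
  r s t := eqQ s t ∈ Ω
  iseqv := ⟨H.eqQ_refl, H.eqQ_symm, H.eqQ_trans⟩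

/-- The term model: body variables and quantity terms modulo equality in `Ω`, with operations and
relations read off from chosen representatives. -/
theorem exists_model : ∃ (B Q : Type) (_ : Add Q) (_ : Mul Q) (_ : LE Q) (S : Str B Q)
    (r : ℕ → B) (s : ℕ → Q), ∀ φ, S.Realize φ r s ↔ φ ∈ Ω := by
  let eB : Setoid ℕ := H.setoidB
  let eQ : Setoid Tm := H.setoidQ
  let B : Type := Quotient eB
  let Q : Type := Quotient eQ
  have outB : ∀ b : ℕ, eqB (⟦b⟧ : B).out b ∈ Ω := fun b => Quotient.mk_out (s := eB) b
  have outQ : ∀ t : Tm, eqQ (⟦t⟧ : Q).out t ∈ Ω := fun t => Quotient.mk_out (s := eQ) t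
  let iA : Add Q := ⟨fun a b => ⟦.add a.out b.out⟧⟩
  let iM : Mul Q := ⟨fun a b => ⟦.mul a.out b.out⟧⟩
  let iL : LE Q := ⟨fun a b => Fml.le a.out b.out ∈ Ω⟩
  let S : Str B Q :=
    { iob := fun k => Fml.iob k.out ∈ Ω
      ph := fun k => Fml.ph k.out ∈ Ω
      wv := fun k b x => Fml.wv k.out b.out (fun i => (x i).out) ∈ Ω }
  have hev : ∀ (t : Tm) (σ : ℕ → Tm), t.eval (fun n => (⟦σ n⟧ : Q)) = ⟦t.subst σ⟧ := by
    intro t σ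
    induction t with
    | var n => rfl
    | add a b ha hb =>
      simp only [Tm.eval, Tm.subst, ha, hb]
      refine Quotient.sound (s := eQ) ?_
      exact H.subst_mem_of_eqQ (φ := eqQ (.add (.var 0) (.var 1)) (.add (.var 2) (.var 3)))
        (m := 0) (n := 4) rfl
        (σ := cons (⟦a.subst σ⟧ : Q).out (cons (⟦b.subst σ⟧ : Q).out
          (cons (⟦a.subst σ⟧ : Q).out fun _ => (⟦b.subst σ⟧ : Q).out)))
        (σ' := cons (⟦a.subst σ⟧ : Q).out (cons (⟦b.subst σ⟧ : Q).out
          (cons (a.subst σ) fun _ => b.subst σ))) (β := id)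
        (by rintro (_ | _ | _ | i) <;> first | exact H.eqQ_refl _ | exact outQ _) (H.eqQ_refl _)
    | mul a b ha hb =>
      simp only [Tm.eval, Tm.subst, ha, hb]
      refine Quotient.sound (s := eQ) ?_
      exact H.subst_mem_of_eqQ (φ := eqQ (.mul (.var 0) (.var 1)) (.mul (.var 2) (.var 3)))
        (m := 0) (n := 4) rfl
        (σ := cons (⟦a.subst σ⟧ : Q).out (cons (⟦b.subst σ⟧ : Q).out
          (cons (⟦a.subst σ⟧ : Q).out fun _ => (⟦b.subst σ⟧ : Q).out)))
        (σ' := cons (⟦a.subst σ⟧ : Q).out (cons (⟦b.subst σ⟧ : Q).out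
          (cons (a.subst σ) fun _ => b.subst σ))) (β := id)
        (by rintro (_ | _ | _ | i) <;> first | exact H.eqQ_refl _ | exact outQ _) (H.eqQ_refl _)
  -- By the replacement lemmas, membership in `Ω` does not depend on the choice of representatives.
  have hB : ∀ {φ : Fml} {m n : ℕ} {σ : ℕ → Tm} (β : ℕ → ℕ), φ.closedIn m n = true →
      (φ.subst (fun i => (⟦β i⟧ : B).out) σ ∈ Ω ↔ φ.subst β σ ∈ Ω) := fun β hc =>
    ⟨H.subst_mem_of_eqB hc fun i => outB _, H.subst_mem_of_eqB hc fun i => H.eqB_symm (outB _)⟩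
  have hQ : ∀ {φ : Fml} {m n : ℕ} {β : ℕ → ℕ} (σ : ℕ → Tm), φ.closedIn m n = true →
      (φ.subst β (fun i => (⟦σ i⟧ : Q).out) ∈ Ω ↔ φ.subst β σ ∈ Ω) := fun σ hc =>
    ⟨H.subst_mem_of_eqQ hc fun i => outQ _, H.subst_mem_of_eqQ hc fun i => H.eqQ_symm (outQ _)⟩
  -- The truth lemma. Quantifying over all substitutions carries the induction through quantifiers:
  -- an instance of the body is the body under an extended substitution, and every element of the
  -- model is named by a variable or a term.
  have main : ∀ (φ : Fml) (β : ℕ → ℕ) (σ : ℕ → Tm),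
      S.Realize φ (fun n => ⟦β n⟧) (fun n => ⟦σ n⟧) ↔ φ.subst β σ ∈ Ω := by
    intro φ
    induction φ with
    | eqB k b => exact fun β σ => Quotient.eq (r := eB)
    | eqQ a b =>
      intro β σ
      simp only [Str.Realize, hev]
      exact Quotient.eq (r := eQ)
    | le a b =>
      intro β σ
      simp only [Str.Realize, hev]
      exact hQ (φ := Fml.le (.var 0) (.var 1)) (m := 0) (n := 2) (β := id)
        (cons (a.subst σ) fun _ => b.subst σ) rfl
    | iob k =>
      intro β σ
      exact hB (φ := Fml.iob k) (m := k + 1) (n := 0) (σ := .var) β (by simp [Fml.closedIn])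
    | ph k =>
      intro β σ
      exact hB (φ := Fml.ph k) (m := k + 1) (n := 0) (σ := .var) β (by simp [Fml.closedIn])
    | wv k b x =>
      intro β σ
      have h₁ := hB (φ := Fml.wv 0 1 (pt 0)) (m := 2) (n := 4) (cons (β k) fun _ => β b)
        (σ := fun i => if h : i < 4 then (⟦(x ⟨i, h⟩).subst σ⟧ : Q).out else .var 0) rfl
      have h₂ := hQ (φ := Fml.wv 0 1 (pt 0)) (m := 2) (n := 4) (β := cons (β k) fun _ => β b)
        (fun i => if h : i < 4 then (x ⟨i, h⟩).subst σ else .var 0) rfl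
      simp only [Fml.subst, pt, Tm.subst, Nat.zero_add, Fin.is_lt, dite_true, Fin.eta] at h₁ h₂
      have e : Pt.eval (fun n => (⟦σ n⟧ : Q)) x = fun i => ⟦(x i).subst σ⟧ :=
        funext fun i => hev (x i) σ
      rw [Str.Realize, e]
      exact h₁.trans h₂
    | fls => exact fun β σ => iff_of_false id fun h => H.consistent (.hyp h)
    | imp φ ψ hφ hψ =>
      intro β σ
      simp only [Str.Realize, Fml.subst, hφ, hψ]
      exact H.imp_mem.symm
    | allB φ ih =>
      intro β σ
      simp only [Str.Realize, Fml.subst]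
      rw [H.allB_mem]
      constructor
      · intro h b
        rw [Fml.subst_upB_instB, ← ih]
        convert h ⟦b⟧ using 1
        funext n
        cases n <;> rfl
      · intro h b
        have := h b.out
        rw [Fml.subst_upB_instB, ← ih] at this
        convert this using 1
        funext n
        cases n
        · exact (Quotient.out_eq b).symm
        · rfl
    | allQ φ ih =>
      intro β σ
      simp only [Str.Realize, Fml.subst]
      rw [H.allQ_mem]
      constructor
      · intro h b
        rw [Fml.subst_upQ_instQ, ← ih]
        convert h ⟦b⟧ using 1
        funext n
        cases n <;> rfl
      · intro h b
        have := h b.out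
        rw [Fml.subst_upQ_instQ, ← ih] at this
        convert this using 1
        funext n
        cases n
        · exact (Quotient.out_eq b).symm
        · rfl
  refine ⟨B, Q, iA, iM, iL, S, fun n => ⟦n⟧, fun n => ⟦.var n⟧, fun φ => ?_⟩
  have := main φ id .var
  rwa [Fml.subst_id] at this

end Henkin

/-- Gödel's completeness theorem for finitely many assumptions. -/
theorem Provable.complete {Γ : Set Fml} (hf : Γ.Finite) {φ : Fml}
    (h : ∀ (B Q : Type) [Add Q] [Mul Q] [LE Q] (S : Str B Q) (r : ℕ → B) (s : ℕ → Q),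
      (∀ ψ ∈ Γ, S.Realize ψ r s) → S.Realize φ r s) : Provable Γ φ := by
  refine Provable.of_insert_neg fun hc => ?_
  obtain ⟨Ω, hΩ, H⟩ := Consistent.exists_henkin (hf.insert _) hc
  obtain ⟨B, Q, _, _, _, S, r, s, hS⟩ := H.exists_model
  have h₁ := h B Q S r s fun ψ hψ => (hS ψ).2 (hΩ (Or.inr hψ))
  have h₂ := (hS (∼φ)).2 (hΩ (Or.inl rfl))
  exact h₂ h₁

end CompKin

namespace CompKin

open Fml

/-! ### Truth of the derived connectives, and the ordered field of a model. -/

namespace Str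

section

variable {B Q : Type} [Add Q] [Mul Q] [LE Q] (S : Str B Q) (r : ℕ → B) (s : ℕ → Q)

@[simp] theorem realize_neg (φ : Fml) : S.Realize (∼φ) r s ↔ ¬ S.Realize φ r s := Iff.rfl

@[simp] theorem realize_imp (φ ψ : Fml) :
    S.Realize (φ ⇒ ψ) r s ↔ (S.Realize φ r s → S.Realize ψ r s) := Iff.rfl

@[simp] theorem realize_and (φ ψ : Fml) :
    S.Realize (φ ⋏ ψ) r s ↔ S.Realize φ r s ∧ S.Realize ψ r s := by
  simp only [Fml.and, realize_neg, realize_imp]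
  tauto

@[simp] theorem realize_or (φ ψ : Fml) :
    S.Realize (φ ⋎ ψ) r s ↔ S.Realize φ r s ∨ S.Realize ψ r s := by
  simp only [Fml.or, realize_neg, realize_imp]
  tauto

@[simp] theorem realize_iff (φ ψ : Fml) :
    S.Realize (φ ⇔ ψ) r s ↔ (S.Realize φ r s ↔ S.Realize ψ r s) := by
  simp only [Fml.iff, realize_and, realize_imp]
  tauto

@[simp] theorem realize_allB (φ : Fml) :
    S.Realize (allB φ) r s ↔ ∀ b, S.Realize φ (cons b r) s := Iff.rfl

@[simp] theorem realize_allQ (φ : Fml) :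
    S.Realize (allQ φ) r s ↔ ∀ q, S.Realize φ r (cons q s) := Iff.rfl

@[simp] theorem realize_exB (φ : Fml) :
    S.Realize (exB φ) r s ↔ ∃ b, S.Realize φ (cons b r) s := by
  simp only [Fml.exB, realize_neg, realize_allB, not_forall, not_not]

@[simp] theorem realize_exQ (φ : Fml) :
    S.Realize (exQ φ) r s ↔ ∃ q, S.Realize φ r (cons q s) := by
  simp only [Fml.exQ, realize_neg, realize_allQ, not_forall, not_not]

@[simp] theorem realize_eqQ (a b : Tm) : S.Realize (eqQ a b) r s ↔ a.eval s = b.eval s := Iff.rfl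

@[simp] theorem realize_le (a b : Tm) : S.Realize (.le a b) r s ↔ a.eval s ≤ b.eval s := Iff.rfl

end

end Str

variable {B Q : Type}

/-- A structure that satisfies `AxEField` has a linearly ordered field of quantities. -/
theorem exists_field [a : Add Q] [m : Mul Q] [l : LE Q] (S : Str B Q) (r : ℕ → B) (s : ℕ → Q)
    (h : S.Realize AxEField r s) :
    ∃ (F : Field Q) (L : LinearOrder Q) (_ : IsStrictOrderedRing Q),
      a = F.toAdd ∧ m = F.toMul ∧ l = L.toLE := by
  simp only [AxEField, allsQ, exsQ, leE, ltE, Ex.graph, Tm.lift, Tm.subst, isZero,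
    Str.realize_and, Str.realize_allQ, Str.realize_exQ, Str.realize_eqQ, Str.realize_le,
    Str.realize_or, Str.realize_imp, Str.realize_neg, Tm.eval,
    cons, Nat.zero_add] at h
  obtain ⟨hring, ⟨o, z, hzo, hfield⟩, hord, hcomp, -⟩ := h
  -- `isZero` is expressed as `q + q = q`; adding an opposite of `q` shows that only `z` satisfies
  -- it.
  have hz : ∀ q : Q, q + q = q ↔ q = z := by
    intro q
    refine ⟨fun hq => ?_, fun hq => hq ▸ (hfield z).1⟩
    obtain ⟨q', hq'⟩ := (hfield q).2.2.1
    have h₁ := (hring q' q q).2.2.1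
    rw [hq, hq', (hfield q).1] at h₁
    exact h₁.symm
  choose neg hneg using fun q => (hfield q).2.2.1
  choose inv hinv using fun q => (hfield q).2.2.2
  let R : CommRing Q := by
    letI : Zero Q := ⟨z⟩
    letI : One Q := ⟨o⟩
    letI : Neg Q := ⟨neg⟩
    exact CommRing.ofMinimalAxioms
      (fun p q r => (hring r q p).2.2.1)
      (fun q => ((hring q q z).1).trans (hfield q).1)
      (fun q => ((hring q q (neg q)).1).trans (hneg q))
      (fun p q r => (hring r q p).2.2.2.1)
      (fun p q => (hring q q p).2.1)
      (fun q => ((hring q q o).2.1).trans (hfield q).2.1)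
      (fun p q r => (hring r q p).2.2.2.2)
  classical
  let F : Field Q :=
    { R with
      inv := fun q => if hq : q = z then z else inv q hq
      exists_pair_ne := ⟨z, o, hzo⟩
      mul_inv_cancel := by
        intro q hq
        exact (congrArg (fun t => m.mul q t) (dif_neg hq)).trans (hinv q hq)
      inv_zero := dif_pos rfl
      nnqsmul := _
      nnqsmul_def := fun _ _ => rfl
      qsmul := _
      qsmul_def := fun _ _ => rfl }
  let L : LinearOrder Q :=
    { l with
      le_refl := fun q => (hord q q q).1
      le_trans := fun p q r h₁ h₂ => (hord r q p).2.2.2 ⟨h₁, h₂⟩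
      le_antisymm := fun p q h₁ h₂ => (hord q q p).2.2.1 ⟨h₁, h₂⟩
      le_total := fun p q => (hord q q p).2.1
      toDecidableLE := fun _ _ => Classical.propDecidable _ }
  refine ⟨F, L, ?_, rfl, rfl, rfl⟩
  have hadd : ∀ p q : Q, p ≤ q → ∀ t, p + t ≤ q + t := fun p q h t => (hcomp t q p).1 h
  have hmul : ∀ p q : Q, z ≤ p → z ≤ q → z ≤ p * q := by
    intro p q hp hq
    obtain ⟨_, y, hy, hy', hle⟩ := (hcomp z q p).2
      ⟨⟨p, z, (hz z).2 rfl, rfl, hp⟩, ⟨q, z, (hz z).2 rfl, rfl, hq⟩⟩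
    rw [(hz y).1 hy, ← hy'] at hle
    exact hle
  have hM : IsOrderedAddMonoid Q :=
    { add_le_add_left := fun p q h t => hadd p q h t }
  -- This is not an axiom. If `1 ≤ 0`, then `0 ≤ -1`, hence `0 ≤ (-1)(-1) = 1`, and antisymmetry
  -- contradicts `0 ≠ 1`.
  have h01 : z ≤ o := by
    refine (hord z o z).2.1.resolve_right fun h => hzo ?_
    have h₁ : z ≤ neg o := by
      have := hadd o z h (neg o)
      rwa [hneg, (hring z (neg o) z).1, (hfield _).1] at this
    have h₂ : z ≤ neg o * neg o := hmul _ _ h₁ h₁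
    have h₃ : neg o * neg o = o := by
      have : (-1 : Q) * -1 = 1 := by ring
      exact this
    exact (hord z o z).2.2.1 ⟨h₃ ▸ h₂, h⟩
  have hZ : ZeroLEOneClass Q := ⟨h01⟩
  have hR : IsOrderedRing Q := IsOrderedRing.of_mul_nonneg fun p q hp hq => hmul p q hp hq
  exact IsOrderedRing.toIsStrictOrderedRing Q

/-! ### Values of expressions -/

/-- Positive elements have square roots. -/
class Euclidean (Q : Type) [Field Q] [LinearOrder Q] : Prop where
  exists_sq : ∀ q : Q, 0 < q → ∃ w, w * w = q

section

variable {Q : Type} [Field Q] [LinearOrder Q] [IsStrictOrderedRing Q]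

open Classical in
/-- The nonnegative square root. -/
noncomputable def qsqrt (q : Q) : Q := if h : ∃ w : Q, 0 ≤ w ∧ w * w = q then h.choose else 0

theorem qsqrt_nonneg (q : Q) : 0 ≤ qsqrt q := by
  unfold qsqrt
  split_ifs with h
  · exact h.choose_spec.1
  · exact le_rfl

theorem qsqrt_mul_self [Euclidean Q] {q : Q} (hq : 0 ≤ q) : qsqrt q * qsqrt q = q := by
  have h : ∃ w : Q, 0 ≤ w ∧ w * w = q := by
    rcases hq.eq_or_lt with rfl | hq
    · exact ⟨0, le_rfl, mul_zero 0⟩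
    · obtain ⟨w, hw⟩ := Euclidean.exists_sq q hq
      exact ⟨|w|, abs_nonneg w, by rw [abs_mul_abs_self, hw]⟩
  unfold qsqrt
  rw [dif_pos h]
  exact h.choose_spec.2

theorem qsqrt_eq_iff [Euclidean Q] {q w : Q} (hq : 0 ≤ q) :
    qsqrt q = w ↔ 0 ≤ w ∧ w * w = q := by
  constructor
  · rintro rfl
    exact ⟨qsqrt_nonneg q, qsqrt_mul_self hq⟩
  · rintro ⟨h₁, h₂⟩
    exact (mul_self_inj (qsqrt_nonneg q) h₁).1 ((qsqrt_mul_self hq).trans h₂.symm)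

/-- The value of an expression, if it is defined. -/
noncomputable def Ex.val (s : ℕ → Q) : Ex → Q
  | tm t => t.eval s
  | zero => 0
  | one => 1
  | add a b => a.val s + b.val s
  | sub a b => a.val s - b.val s
  | mul a b => a.val s * b.val s
  | div a b => a.val s / b.val s
  | sqrt a => qsqrt (a.val s)
  | abs a => |a.val s|

/-- The expression is defined. -/
def Ex.Def (s : ℕ → Q) : Ex → Prop
  | tm _ => True
  | zero => True
  | one => True
  | add a b => a.Def s ∧ b.Def s
  | sub a b => a.Def s ∧ b.Def s
  | mul a b => a.Def s ∧ b.Def s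
  | div a b => a.Def s ∧ b.Def s ∧ b.val s ≠ 0
  | sqrt a => a.Def s ∧ 0 ≤ a.val s
  | abs a => a.Def s

/-- The variables from `k` on. -/
def drop {α : Type} (k : ℕ) (s : ℕ → α) : ℕ → α := fun n => s (n + k)

@[simp] theorem drop_zero {α : Type} (s : ℕ → α) : drop 0 s = s := rfl

@[simp] theorem drop_succ_cons {α : Type} (k : ℕ) (a : α) (s : ℕ → α) :
    drop (k + 1) (cons a s) = drop k s := rfl

@[simp] theorem Tm.eval_var (n : ℕ) (s : ℕ → Q) : (Tm.var n).eval s = s n := rfl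

@[simp] theorem Tm.eval_lift (t : Tm) (k : ℕ) (s : ℕ → Q) :
    (t.lift k).eval s = t.eval (drop k s) :=
  t.eval_subst _ _

@[simp] theorem Pt.eval_lift (x : Pt) (k : ℕ) (s : ℕ → Q) :
    Pt.eval s (x.lift k) = Pt.eval (drop k s) x :=
  x.eval_subst _ _

variable {B : Type} (S : Str B Q) (r : ℕ → B) (s : ℕ → Q)

@[simp] theorem Str.realize_isZero (t : Tm) : S.Realize (isZero t) r s ↔ t.eval s = 0 :=
  add_eq_left

@[simp] theorem Str.realize_nonneg (t : Tm) : S.Realize (nonneg t) r s ↔ 0 ≤ t.eval s := by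
  simp [nonneg]

theorem Str.realize_exsQ_two (φ : Fml) :
    S.Realize (exsQ 2 φ) r s ↔ ∃ q₁ q₀, S.Realize φ r (cons q₀ (cons q₁ s)) := by
  simp [exsQ]

/-- Replaces partial functions by total ones: `Ex.val` has default values where an expression is
undefined, and the conjunct `Ex.Def` discards them. -/
theorem Str.realize_graph [Euclidean Q] (e : Ex) (k : ℕ) (t : Tm) :
    S.Realize (e.graph k t) r s ↔ e.Def (drop k s) ∧ e.val (drop k s) = t.eval s := by
  induction e generalizing k t s with
  | tm a => simp [Ex.graph, Ex.Def, Ex.val]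
  | zero => simp [Ex.graph, Ex.Def, Ex.val, eq_comm]
  | one =>
    simp only [Ex.graph, Ex.Def, Ex.val, realize_and, realize_neg, realize_isZero, realize_eqQ,
      true_and, Tm.eval]
    constructor
    · rintro ⟨h₁, h₂⟩
      exact (mul_left_cancel₀ h₂ (h₁.trans (mul_one _).symm)).symm
    · intro h
      rw [← h]
      simp
  | add a b ha hb =>
    simp only [Ex.graph, realize_exsQ_two, realize_and, ha, hb, realize_eqQ, Ex.Def, Ex.val,
      drop_succ_cons, Tm.eval_lift, drop_zero, Tm.eval, cons]
    grind
  | sub a b ha hb =>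
    simp only [Ex.graph, realize_exsQ_two, realize_and, ha, hb, realize_eqQ, Ex.Def, Ex.val,
      drop_succ_cons, Tm.eval_lift, drop_zero, Tm.eval, cons]
    grind
  | mul a b ha hb =>
    simp only [Ex.graph, realize_exsQ_two, realize_and, ha, hb, realize_eqQ, Ex.Def, Ex.val,
      drop_succ_cons, Tm.eval_lift, drop_zero, Tm.eval, cons]
    grind
  | div a b ha hb =>
    simp only [Ex.graph, realize_exsQ_two, realize_and, ha, hb, realize_eqQ, Ex.Def, Ex.val,
      drop_succ_cons, Tm.eval_lift, drop_zero, Tm.eval, cons, realize_neg,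
      realize_isZero]
    constructor
    · rintro ⟨_, _, ⟨h₁, rfl⟩, ⟨h₂, rfl⟩, h₃, h₄⟩
      exact ⟨⟨h₁, h₂, h₃⟩, by rw [div_eq_iff h₃, h₄]⟩
    · rintro ⟨⟨h₁, h₂, h₃⟩, h₄⟩
      exact ⟨_, _, ⟨h₁, rfl⟩, ⟨h₂, rfl⟩, h₃, by rw [← h₄, div_mul_cancel₀ _ h₃]⟩
  | sqrt a ha =>
    simp only [Ex.graph, realize_exQ, realize_and, ha, realize_eqQ, Ex.Def, Ex.val,
      drop_succ_cons, Tm.eval_lift, drop_zero, Tm.eval, cons, realize_nonneg]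
    constructor
    · rintro ⟨_, ⟨h₁, rfl⟩, h₂, h₃⟩
      have h₄ := h₃ ▸ mul_self_nonneg (t.eval s)
      exact ⟨⟨h₁, h₄⟩, (qsqrt_eq_iff h₄).2 ⟨h₂, h₃⟩⟩
    · rintro ⟨⟨h₁, h₂⟩, h₃⟩
      exact ⟨_, ⟨h₁, rfl⟩, (qsqrt_eq_iff h₂).1 h₃⟩
  | abs a ha =>
    simp only [Ex.graph, realize_exQ, realize_and, ha, realize_eqQ, Ex.Def, Ex.val,
      drop_succ_cons, Tm.eval_lift, drop_zero, Tm.eval, cons, realize_nonneg,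
      realize_or, realize_isZero]
    constructor
    · rintro ⟨_, ⟨h₁, rfl⟩, h₂, h₃⟩
      refine ⟨h₁, ?_⟩
      rcases h₃ with h₃ | h₃
      · rw [h₃] at h₂ ⊢
        exact abs_of_nonneg h₂
      · rw [abs_of_nonpos (by linarith)]
        linarith
    · rintro ⟨h₁, h₂⟩
      refine ⟨_, ⟨h₁, rfl⟩, h₂ ▸ abs_nonneg _, ?_⟩
      rcases abs_choice (a.val (drop k s)) with h | h <;> rw [h] at h₂
      · exact Or.inl h₂.symm
      · right
        linarith

section

variable (a b : Ex)

@[simp] theorem Ex.val_tm (t : Tm) : (Ex.tm t).val s = t.eval s := rfl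
@[simp] theorem Ex.val_zero : (0 : Ex).val s = 0 := rfl
@[simp] theorem Ex.val_one : (1 : Ex).val s = 1 := rfl
@[simp] theorem Ex.val_add : (a + b).val s = a.val s + b.val s := rfl
@[simp] theorem Ex.val_sub : (a - b).val s = a.val s - b.val s := rfl
@[simp] theorem Ex.val_mul : (a * b).val s = a.val s * b.val s := rfl
@[simp] theorem Ex.val_div : (a / b).val s = a.val s / b.val s := rfl
@[simp] theorem Ex.val_neg : (-a).val s = -a.val s := zero_sub _
@[simp] theorem Ex.val_sq : a.sq.val s = a.val s ^ 2 := (pow_two _).symm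
@[simp] theorem Ex.val_sqrt : (Ex.sqrt a).val s = qsqrt (a.val s) := rfl
@[simp] theorem Ex.def_tm (t : Tm) : (Ex.tm t).Def s := trivial
@[simp] theorem Ex.def_zero : (0 : Ex).Def s := trivial
@[simp] theorem Ex.def_one : (1 : Ex).Def s := trivial
@[simp] theorem Ex.def_add : (a + b).Def s ↔ a.Def s ∧ b.Def s := Iff.rfl
@[simp] theorem Ex.def_sub : (a - b).Def s ↔ a.Def s ∧ b.Def s := Iff.rfl
@[simp] theorem Ex.def_mul : (a * b).Def s ↔ a.Def s ∧ b.Def s := Iff.rfl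
@[simp] theorem Ex.def_div : (a / b).Def s ↔ a.Def s ∧ b.Def s ∧ b.val s ≠ 0 := Iff.rfl
@[simp] theorem Ex.def_neg : (-a).Def s ↔ a.Def s := and_iff_right trivial
@[simp] theorem Ex.def_sq : a.sq.Def s ↔ a.Def s := and_self_iff
@[simp] theorem Ex.def_sqrt : (Ex.sqrt a).Def s ↔ a.Def s ∧ 0 ≤ a.val s := Iff.rfl

end

variable [Euclidean Q]

@[simp] theorem Str.realize_eqE (a b : Ex) :
    S.Realize (eqE a b) r s ↔ (a.Def s ∧ b.Def s) ∧ a.val s = b.val s := by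
  simp only [eqE, realize_exsQ_two, realize_and, realize_graph, realize_eqQ, drop_succ_cons,
    Tm.eval_var, drop_zero, cons]
  grind

@[simp] theorem Str.realize_leE (a b : Ex) :
    S.Realize (leE a b) r s ↔ (a.Def s ∧ b.Def s) ∧ a.val s ≤ b.val s := by
  simp only [leE, realize_exsQ_two, realize_and, realize_graph, realize_le, drop_succ_cons,
    Tm.eval_var, drop_zero, cons]
  grind

@[simp] theorem Str.realize_ltE (a b : Ex) :
    S.Realize (ltE a b) r s ↔ (a.Def s ∧ b.Def s) ∧ a.val s < b.val s := by
  simp only [ltE, realize_exsQ_two, realize_and, realize_graph, realize_le, drop_succ_cons,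
    Tm.eval_var, drop_zero, cons, realize_neg, realize_eqQ, lt_iff_le_and_ne]
  grind

end

end CompKin

namespace CompKin

open Fml

variable {B Q : Type} [Field Q] [LinearOrder Q] [IsStrictOrderedRing Q]

/-! ### Points -/

/-- The spatial part of a point. -/
def sp (x : Fin 4 → Q) : Fin 3 → Q := fun i => x i.succ

/-- The point with given time and spatial part. -/
def mkPt (t : Q) (p : Fin 3 → Q) : Fin 4 → Q := Fin.cons t p

@[simp] theorem mkPt_zero (t : Q) (p : Fin 3 → Q) : mkPt t p 0 = t := rfl

@[simp] theorem sp_mkPt (t : Q) (p : Fin 3 → Q) : sp (mkPt t p) = p := rfl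

@[simp] theorem mkPt_eta (x : Fin 4 → Q) : mkPt (x 0) (sp x) = x := Fin.cons_self_tail x

theorem pt_ext {x y : Fin 4 → Q} (h₀ : x 0 = y 0) (h : sp x = sp y) : x = y := by
  rw [← mkPt_eta x, ← mkPt_eta y, h₀, h]

@[simp] theorem sp_add (x y : Fin 4 → Q) : sp (x + y) = sp x + sp y := rfl

@[simp] theorem sp_sub (x y : Fin 4 → Q) : sp (x - y) = sp x - sp y := rfl

@[simp] theorem sp_smul (a : Q) (x : Fin 4 → Q) : sp (a • x) = a • sp x := rfl

/-- The square of the spatial distance. -/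
def dist2 (x y : Fin 4 → Q) : Q := (sp x - sp y) ⬝ᵥ (sp x - sp y)

theorem dist2_eq (x y : Fin 4 → Q) :
    dist2 x y = (x 1 - y 1) ^ 2 + (x 2 - y 2) ^ 2 + (x 3 - y 3) ^ 2 := by
  simp only [dist2, dotProduct, Fin.sum_univ_three, sp, Pi.sub_apply, Fin.succ_zero_eq_one,
    Fin.succ_one_eq_two, pow_two]
  rfl

theorem dotProduct_self_nonneg' (v : Fin 3 → Q) : 0 ≤ v ⬝ᵥ v :=
  Finset.sum_nonneg fun i _ => mul_self_nonneg (v i)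

theorem dist2_nonneg (x y : Fin 4 → Q) : 0 ≤ dist2 x y := dotProduct_self_nonneg' _

/-- The value of the spatial distance. -/
noncomputable def spaceV (x y : Fin 4 → Q) : Q := qsqrt (dist2 x y)

/-- The value of the time difference. -/
def timeV (x y : Fin 4 → Q) : Q := |x 0 - y 0|

theorem timeV_eq_zero {x y : Fin 4 → Q} : timeV x y = 0 ↔ x 0 = y 0 := by
  rw [timeV, abs_eq_zero, sub_eq_zero]

@[simp] theorem val_space (x y : Pt) (s : ℕ → Q) :
    (space x y).val s = spaceV (Pt.eval s x) (Pt.eval s y) := by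
  simp only [space, Ex.val_sqrt, Ex.val_add, Ex.val_sq, Ex.val_sub, Ex.val_tm, spaceV, dist2_eq]
  rfl

@[simp] theorem def_space (x y : Pt) (s : ℕ → Q) : (space x y).Def s := by
  simp only [space, Ex.def_sqrt, Ex.def_add, Ex.def_sq, Ex.def_sub, Ex.def_tm, Ex.val_add,
    Ex.val_sq, true_and]
  positivity

@[simp] theorem val_time (x y : Pt) (s : ℕ → Q) :
    (time x y).val s = timeV (Pt.eval s x) (Pt.eval s y) := rfl

@[simp] theorem def_time (x y : Pt) (s : ℕ → Q) : (time x y).Def s := ⟨trivial, trivial⟩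

/-- Prepend a point to an assignment of variables. -/
def app (x : Fin 4 → Q) (s : ℕ → Q) : ℕ → Q :=
  cons (x 0) (cons (x 1) (cons (x 2) (cons (x 3) s)))

@[simp] theorem eval_pt_zero (x : Fin 4 → Q) (s : ℕ → Q) : Pt.eval (app x s) (pt 0) = x := by
  funext i
  fin_cases i <;> rfl

@[simp] theorem eval_pt_one (q : Q) (s : ℕ → Q) :
    Pt.eval (cons q s) (pt 1) = Pt.eval s (pt 0) := by
  funext i
  fin_cases i <;> rfl

@[simp] theorem eval_pt_five (q : Q) (s : ℕ → Q) :
    Pt.eval (cons q s) (pt 5) = Pt.eval s (pt 4) := by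
  funext i
  fin_cases i <;> rfl

@[simp] theorem eval_pt_nine (q : Q) (s : ℕ → Q) :
    Pt.eval (cons q s) (pt 9) = Pt.eval s (pt 8) := by
  funext i
  fin_cases i <;> rfl

@[simp] theorem eval_pt_four (x : Fin 4 → Q) (s : ℕ → Q) :
    Pt.eval (app x s) (pt 4) = Pt.eval s (pt 0) := by
  funext i
  fin_cases i <;> rfl

@[simp] theorem eval_pt_eight (x : Fin 4 → Q) (s : ℕ → Q) :
    Pt.eval (app x s) (pt 8) = Pt.eval s (pt 4) := by
  funext i
  fin_cases i <;> rfl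

@[simp] theorem eval_pt_twelve (x : Fin 4 → Q) (s : ℕ → Q) :
    Pt.eval (app x s) (pt 12) = Pt.eval s (pt 8) := by
  funext i
  fin_cases i <;> rfl

@[simp] theorem drop_app_eight (x y : Fin 4 → Q) (s : ℕ → Q) :
    drop 8 (app x (app y s)) = s := rfl

namespace Str

variable (S : Str B Q) (r : ℕ → B) (s : ℕ → Q)

@[simp] theorem realize_wv (k b : ℕ) (x : Pt) :
    S.Realize (.wv k b x) r s ↔ S.wv (r k) (r b) (Pt.eval s x) := Iff.rfl

@[simp] theorem realize_iob (k : ℕ) : S.Realize (.iob k) r s ↔ S.iob (r k) := Iff.rfl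

@[simp] theorem realize_ph (k : ℕ) : S.Realize (.ph k) r s ↔ S.ph (r k) := Iff.rfl

@[simp] theorem realize_allsQ_four (φ : Fml) :
    S.Realize (allsQ 4 φ) r s ↔ ∀ x, S.Realize φ r (app x s) :=
  ⟨fun h x => h (x 3) (x 2) (x 1) (x 0), fun h q₃ q₂ q₁ q₀ => h ![q₀, q₁, q₂, q₃]⟩

@[simp] theorem realize_exsQ_four (φ : Fml) :
    S.Realize (exsQ 4 φ) r s ↔ ∃ x, S.Realize φ r (app x s) := by
  simp only [exsQ, realize_exQ]
  exact ⟨fun ⟨q₃, q₂, q₁, q₀, h⟩ => ⟨![q₀, q₁, q₂, q₃], h⟩, fun ⟨x, h⟩ => ⟨_, _, _, _, h⟩⟩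

-- The block bound first carries the higher indices, so the outer point `y` is `pt 4` and the inner
-- point `x` is `pt 0`.
@[simp] theorem realize_allsQ_eight (φ : Fml) :
    S.Realize (allsQ 8 φ) r s ↔ ∀ y x, S.Realize φ r (app x (app y s)) := by
  simp only [← realize_allsQ_four]
  rfl

@[simp] theorem realize_exsQ_eight (φ : Fml) :
    S.Realize (exsQ 8 φ) r s ↔ ∃ y x, S.Realize φ r (app x (app y s)) := by
  simp only [← realize_exsQ_four]
  rfl

@[simp] theorem realize_allsQ_twelve (φ : Fml) :
    S.Realize (allsQ 12 φ) r s ↔ ∀ z y x, S.Realize φ r (app x (app y (app z s))) := by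
  simp only [← realize_allsQ_four]
  rfl

@[simp] theorem realize_allsQ_sixteen (φ : Fml) :
    S.Realize (allsQ 16 φ) r s ↔
      ∀ y' x' y x, S.Realize φ r (app x (app y (app x' (app y' s)))) := by
  simp only [← realize_allsQ_four]
  rfl

/-! ### The meaning of the defined notions -/

def SameEv (k : B) (x : Fin 4 → Q) (h : B) (y : Fin 4 → Q) : Prop :=
  ∀ b, S.wv k b x ↔ S.wv h b y

def LightSpeedAt (k : B) (c : Q) : Prop :=
  ∀ y x, (∃ p, S.ph p ∧ S.wv k p x ∧ S.wv k p y) ↔ spaceV x y = c * timeV x y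

def Ether (e : B) : Prop := S.iob e ∧ ∃ c, 0 < c ∧ S.LightSpeedAt e c

def IsEtherLightSpeed (c : Q) : Prop := 0 < c ∧ ∀ e, S.Ether e → S.LightSpeedAt e c

def IsLightSpeed (c : Q) : Prop := 0 < c ∧ ∀ k, S.iob k → S.LightSpeedAt k c

def TwoPoints (k b : B) : Prop := ∃ y x, (S.wv k b x ∧ S.wv k b y) ∧ x ≠ y

def IsSpeed (k b : B) (v : Q) : Prop :=
  S.TwoPoints k b ∧ ∀ y x, S.wv k b x → S.wv k b y → spaceV x y = v * timeV x y

def IsVelocity (k b : B) (v : Fin 3 → Q) : Prop :=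
  S.TwoPoints k b ∧ ∀ y x, S.wv k b x → S.wv k b y → sp y - sp x = (y 0 - x 0) • v

@[simp] theorem realize_sameEv (k h : ℕ) (x y : Pt) : S.Realize (sameEv k x h y) r s ↔
    S.SameEv (r k) (Pt.eval s x) (r h) (Pt.eval s y) := by
  simp only [sameEv, realize_allB, realize_iff, realize_wv, cons_succ, cons_zero]
  rfl

@[simp] theorem realize_onWl (k b : ℕ) (x y : Pt) : S.Realize (onWl k b x y) r s ↔
    S.wv (r k) (r b) (Pt.eval s x) ∧ S.wv (r k) (r b) (Pt.eval s y) := by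
  simp only [onWl, realize_and, realize_wv]

@[simp] theorem realize_eqPt (x y : Pt) :
    S.Realize (eqPt x y) r s ↔ Pt.eval s x = Pt.eval s y := by
  simp only [eqPt, realize_and, realize_eqQ, funext_iff, Fin.forall_fin_succ, Pt.eval]
  simp

@[simp] theorem realize_twoPoints (k b : ℕ) :
    S.Realize (twoPoints k b) r s ↔ S.TwoPoints (r k) (r b) := by
  simp [twoPoints, TwoPoints]

variable [Euclidean Q]

@[simp] theorem realize_lightSpeedAt (k : ℕ) (c : Tm) :
    S.Realize (lightSpeedAt k c) r s ↔ S.LightSpeedAt (r k) (c.eval s) := by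
  simp [lightSpeedAt, LightSpeedAt]

@[simp] theorem realize_ether (e : ℕ) : S.Realize (ether e) r s ↔ S.Ether (r e) := by
  simp [ether, Ether]

@[simp] theorem realize_isEtherLightSpeed (c : Tm) :
    S.Realize (isEtherLightSpeed c) r s ↔ S.IsEtherLightSpeed (c.eval s) := by
  simp [isEtherLightSpeed, IsEtherLightSpeed]

@[simp] theorem realize_isLightSpeed (c : Tm) :
    S.Realize (isLightSpeed c) r s ↔ S.IsLightSpeed (c.eval s) := by
  simp [isLightSpeed, IsLightSpeed]

@[simp] theorem realize_isSpeed (k b : ℕ) (v : Tm) :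
    S.Realize (isSpeed k b v) r s ↔ S.IsSpeed (r k) (r b) (v.eval s) := by
  simp [isSpeed, IsSpeed]

@[simp] theorem realize_isVelocity (k b : ℕ) (v : Fin 3 → Tm) :
    S.Realize (isVelocity k b v) r s ↔ S.IsVelocity (r k) (r b) fun i => (v i).eval s := by
  simp only [isVelocity, IsVelocity, realize_and, realize_twoPoints, realize_allsQ_eight,
    realize_imp, realize_onWl, eval_pt_zero, eval_pt_four, realize_eqE, Ex.def_sub, Ex.def_mul,
    Ex.def_tm, Ex.val_sub, Ex.val_mul, Ex.val_tm, true_and, Tm.eval_lift, drop_app_eight, and_imp]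
  refine and_congr_right fun _ => forall₂_congr fun y x => forall₂_congr fun _ _ => ?_
  simp only [funext_iff, Fin.forall_fin_succ, Pi.sub_apply, Pi.smul_apply, smul_eq_mul,
    mul_comm (y 0 - x 0)]
  simp [sp, pt, app, cons]

/-- The speed of `k` according to `e` is less than the speed of light of the ether observers. -/
def SlowerThanLight (e k : B) : Prop :=
  ∃ c v, S.IsSpeed e k v ∧ S.IsEtherLightSpeed c ∧ v < c

@[simp] theorem realize_slowerThanLight (e k : ℕ) :
    S.Realize (slowerThanLight e k) r s ↔ S.SlowerThanLight (r e) (r k) := by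
  simp [slowerThanLight, realize_exsQ_two, SlowerThanLight]

/-! ### The meaning of the axioms -/

/-- The trivial transformation with the given parameters. -/
def _root_.CompKin.trivMap (t : Q) (d : Fin 3 → Q) (A : Matrix (Fin 3) (Fin 3) Q)
    (x : Fin 4 → Q) : Fin 4 → Q :=
  mkPt (x 0 + t) (A.mulVec (sp x) + d)

/-- Prepend the parameters of a trivial transformation to an assignment of variables. -/
def _root_.CompKin.params (t : Q) (d : Fin 3 → Q) (A : Matrix (Fin 3) (Fin 3) Q) (s : ℕ → Q) :
    ℕ → Q :=
  cons t (cons (d 0) (cons (d 1) (cons (d 2) (cons (A 0 0) (cons (A 0 1) (cons (A 0 2)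
    (cons (A 1 0) (cons (A 1 1) (cons (A 1 2) (cons (A 2 0) (cons (A 2 1) (cons (A 2 2)
      s))))))))))))

theorem realize_allsQ_thirteen (φ : Fml) :
    S.Realize (allsQ 13 φ) r s ↔ ∀ (A : Matrix (Fin 3) (Fin 3) Q) (d : Fin 3 → Q) (t : Q),
      S.Realize φ r (params t d A s) :=
  ⟨fun h A d t => h (A 2 2) (A 2 1) (A 2 0) (A 1 2) (A 1 1) (A 1 0) (A 0 2) (A 0 1) (A 0 0)
    (d 2) (d 1) (d 0) t,
   fun h a b c d e f g i j k l m n => h !![j, i, g; f, e, d; c, b, a] ![m, l, k] n⟩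

theorem realize_trivMaps (t : Tm) (d : Fin 3 → Tm) (A : Fin 3 → Fin 3 → Tm) (x y : Pt) :
    S.Realize (trivMaps t d A x y) r s ↔ Pt.eval s y = trivMap (t.eval s)
      (fun i => (d i).eval s) (Matrix.of fun i j => (A i j).eval s) (Pt.eval s x) := by
  simp only [trivMaps, realize_and, realize_eqE, Ex.def_add, Ex.def_mul, Ex.def_tm, Ex.val_add,
    Ex.val_mul, Ex.val_tm, and_self, true_and]
  have hrow : ∀ i : Fin 3, trivMap (t.eval s) (fun i => (d i).eval s)
      (Matrix.of fun i j => (A i j).eval s) (Pt.eval s x) i.succ =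
      (A i 0).eval s * (x 1).eval s + (A i 1).eval s * (x 2).eval s +
        (A i 2).eval s * (x 3).eval s + (d i).eval s :=
    fun i => congrArg (· + (d i).eval s)
      (Fin.sum_univ_three fun j => (A i j).eval s * sp (Pt.eval s x) j)
  constructor
  · rintro ⟨h₀, h₁, h₂, h₃⟩
    refine funext (Fin.cases h₀ fun i => ?_)
    rw [hrow]
    fin_cases i
    exacts [h₁, h₂, h₃]
  · intro h
    exact ⟨congrFun h 0, (congrFun h 1).trans (hrow 0), (congrFun h 2).trans (hrow 1),
      (congrFun h 3).trans (hrow 2)⟩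

theorem realize_trivMapsAt {t : Q} {d : Fin 3 → Q} {A : Matrix (Fin 3) (Fin 3) Q} {i : ℕ}
    {s : ℕ → Q} (ht : s i = t) (hd : ∀ j : Fin 3, s (i + 1 + j) = d j)
    (hA : ∀ j l : Fin 3, s (i + 4 + (3 * j + l)) = A j l) (x y : Pt) :
    S.Realize (trivMapsAt i x y) r s ↔ Pt.eval s y = trivMap t d A (Pt.eval s x) := by
  rw [trivMapsAt, realize_trivMaps]
  simp only [Tm.eval, ht, hd, hA]
  rfl

end Str

/-- The consequences of the common axioms. -/
structure Kin (S : Str B Q) : Prop where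
  ev : ∀ k h, S.iob k → S.iob h → ∀ x, ∃ y, S.SameEv k x h y
  self : ∀ k, S.iob k → ∀ x, S.wv k k x ↔ sp x = 0
  symD : ∀ k h, S.iob k → S.iob h → ∀ x y x' y', x 0 = y 0 → x' 0 = y' 0 →
    S.SameEv k x h x' → S.SameEv k y h y' → dist2 x y = dist2 x' y'
  line : ∀ k h, S.iob k → S.iob h → ∀ x y z, S.wv k h x → S.wv k h y → S.wv k h z →
    ∃ a : Q, z - x = a • (y - x) ∨ y - z = a • (z - x)
  triv : ∀ t d A, (∀ x y : Fin 4 → Q, dist2 (trivMap t d A x) (trivMap t d A y) = dist2 x y) →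
    ∀ k, S.iob k → ∃ h, S.iob h ∧ ∀ x y, S.SameEv k x h y ↔ y = trivMap t d A x
  noAcc : ∀ k b x, S.wv k b x → S.iob k

/-- As in `Kin`, the axiom `AxEField` is not listed; the type classes on `Q` carry it, together with
`Euclidean`. -/
structure ClassicalKin (S : Str B Q) : Prop extends Kin S where
  absTime : ∀ k h, S.iob k → S.iob h → ∀ x y x' y', S.SameEv k x h x' → S.SameEv k y h y' →
    |x 0 - y 0| = |x' 0 - y' 0|
  exIob : ∃ k, S.iob k
  thExp : ∀ k, S.iob k → ∀ x y, x 0 ≠ y 0 → ∃ h, S.iob h ∧ S.wv k h x ∧ S.wv k h y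
  exEther : ∃ e, S.Ether e

structure SpecRel (S : Str B Q) : Prop extends Kin S where
  light : ∃ c, S.IsLightSpeed c
  exIob : ∃ k, S.iob k
  thExp : ∀ k c, S.iob k → S.IsLightSpeed c → ∀ x y, spaceV x y < c * timeV x y →
    ∃ h, S.iob h ∧ S.wv k h x ∧ S.wv k h y

section

variable (S : Str B Q) (r : ℕ → B) (s : ℕ → Q) [Euclidean Q]

/-- Lets the axioms about distances be used with squared distances, free of square roots. -/
theorem spaceV_eq_spaceV {x y x' y' : Fin 4 → Q} :
    spaceV x y = spaceV x' y' ↔ dist2 x y = dist2 x' y' := by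
  refine ⟨fun h => ?_, fun h => by rw [spaceV, spaceV, h]⟩
  rw [← qsqrt_mul_self (dist2_nonneg x y), ← qsqrt_mul_self (dist2_nonneg x' y')]
  exact congrArg₂ (· * ·) h h

theorem realize_axSymD : S.Realize AxSymD r s ↔ ∀ k h, S.iob k → S.iob h → ∀ x y x' y',
    x 0 = y 0 → x' 0 = y' 0 → S.SameEv k x h x' → S.SameEv k y h y' →
    dist2 x y = dist2 x' y' := by
  simp only [AxSymD, Str.realize_allB, Str.realize_imp, Str.realize_and, Str.realize_iob,
    Str.realize_allsQ_sixteen, Str.realize_eqE, Str.realize_sameEv, def_time, def_space,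
    Ex.def_zero, val_time, val_space, Ex.val_zero, eval_pt_zero, eval_pt_four, eval_pt_eight,
    eval_pt_twelve, cons, spaceV_eq_spaceV, true_and, timeV_eq_zero, and_imp]
  constructor
  · intro H k h hk hh x y x' y' h₁ h₂
    exact H k h hk hh y' x' y x (by rw [timeV_eq_zero.2 h₁, timeV_eq_zero.2 h₂]) h₂
  · intro H k h hk hh y' x' y x h₁ h₂
    exact H k h hk hh x y x' y' (timeV_eq_zero.1 (h₁.trans (timeV_eq_zero.2 h₂))) h₂

theorem realize_axLine : S.Realize AxLine r s ↔ ∀ k h, S.iob k → S.iob h → ∀ x y z,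
    S.wv k h x → S.wv k h y → S.wv k h z →
    ∃ a : Q, z - x = a • (y - x) ∨ y - z = a • (z - x) := by
  have hd : ∀ (a : Tm) (p q u v : Pt) (r : ℕ → B) (s : ℕ → Q),
      S.Realize (diffEqMul a p q u v) r s ↔
      Pt.eval s p - Pt.eval s q = a.eval s • (Pt.eval s u - Pt.eval s v) := by
    intro a p q u v r s
    simp only [diffEqMul, Str.realize_and, Str.realize_eqE, Ex.def_sub, Ex.def_mul, Ex.def_tm,
      Ex.val_sub, Ex.val_mul, Ex.val_tm, funext_iff, Fin.forall_fin_succ, Pi.sub_apply,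
      Pi.smul_apply, smul_eq_mul, true_and, Pt.eval]
    simp
  simp only [AxLine, Str.realize_allB, Str.realize_imp, Str.realize_and, Str.realize_iob,
    Str.realize_allsQ_twelve, Str.realize_wv, Str.realize_exQ, Str.realize_or, hd, eval_pt_zero, eval_pt_four, eval_pt_eight, eval_pt_one, eval_pt_five, eval_pt_nine,
    cons, and_imp, Tm.eval]
  constructor
  · intro H k h hk hh x y z
    exact H k h hk hh z y x
  · intro H k h hk hh z y x
    exact H k h hk hh x y z

theorem realize_axTriv : S.Realize AxTriv r s ↔ ∀ (t : Q) d A,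
    (∀ x y : Fin 4 → Q, dist2 (trivMap t d A x) (trivMap t d A y) = dist2 x y) →
    ∀ k, S.iob k → ∃ h, S.iob h ∧ ∀ x y, S.SameEv k x h y ↔ y = trivMap t d A x := by
  have h₁₆ : ∀ (A : Matrix (Fin 3) (Fin 3) Q) (d : Fin 3 → Q) (t : Q) (x y : Pt)
      (a b a' b' : Fin 4 → Q), S.Realize (trivMapsAt 16 x y) r (app a (app b (app a' (app b'
        (params t d A s))))) ↔ Pt.eval (app a (app b (app a' (app b' (params t d A s))))) y =
        trivMap t d A (Pt.eval (app a (app b (app a' (app b' (params t d A s))))) x) :=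
    fun A d t x y a b a' b' => S.realize_trivMapsAt r rfl (by intro j; fin_cases j <;> rfl)
      (by intro j l; fin_cases j <;> fin_cases l <;> rfl) x y
  have h₈ : ∀ (A : Matrix (Fin 3) (Fin 3) Q) (d : Fin 3 → Q) (t : Q) (x y : Pt)
      (a b : Fin 4 → Q) (r : ℕ → B), S.Realize (trivMapsAt 8 x y) r (app a (app b
        (params t d A s))) ↔ Pt.eval (app a (app b (params t d A s))) y =
        trivMap t d A (Pt.eval (app a (app b (params t d A s))) x) :=
    fun A d t x y a b r => S.realize_trivMapsAt r rfl (by intro j; fin_cases j <;> rfl)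
      (by intro j l; fin_cases j <;> fin_cases l <;> rfl) x y
  simp only [AxTriv, Str.realize_allsQ_thirteen, Str.realize_imp, Str.realize_allsQ_sixteen,
    Str.realize_and, h₁₆, h₈, Str.realize_eqE, def_space, val_space, spaceV_eq_spaceV, true_and,
    Str.realize_allB, Str.realize_exB, Str.realize_iob, Str.realize_allsQ_eight,
    Str.realize_iff, Str.realize_sameEv, eval_pt_zero, eval_pt_four, eval_pt_eight,
    eval_pt_twelve, cons]
  constructor
  · intro H t d A hA k hk
    obtain ⟨h, hh, H⟩ := H A d t (by rintro _ _ y x ⟨rfl, rfl⟩; exact (hA x y).symm) k hk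
    exact ⟨h, hh, fun x y => H y x⟩
  · intro H A d t hA k hk
    obtain ⟨h, hh, H⟩ := H t d A (fun x y => (hA _ _ y x ⟨rfl, rfl⟩).symm) k hk
    exact ⟨h, hh, fun y x => H x y⟩

theorem realize_axEv : S.Realize AxEv r s ↔
    ∀ k h, S.iob k → S.iob h → ∀ x, ∃ y, S.SameEv k x h y := by
  simp [AxEv, cons]

theorem realize_axSelf : S.Realize AxSelf r s ↔
    ∀ k, S.iob k → ∀ x, S.wv k k x ↔ sp x = 0 := by
  simp only [AxSelf, Str.realize_allB, Str.realize_imp, Str.realize_iob, Str.realize_iff,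
    Str.realize_allsQ_four, Str.realize_wv, Str.realize_and, Str.realize_isZero, eval_pt_zero,
    cons, funext_iff, Fin.forall_fin_succ, Tm.eval]
  simp [sp, app, cons]

theorem realize_axNoAcc : S.Realize AxNoAcc r s ↔ ∀ k b x, S.wv k b x → S.iob k := by
  simp [AxNoAcc, cons]

theorem realize_axAbsTime : S.Realize AxAbsTime r s ↔ ∀ k h, S.iob k → S.iob h →
    ∀ x y x' y', S.SameEv k x h x' → S.SameEv k y h y' → |x 0 - y 0| = |x' 0 - y' 0| := by
  simp only [AxAbsTime, Str.realize_allB, Str.realize_imp, Str.realize_and, Str.realize_iob,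
    Str.realize_allsQ_sixteen, Str.realize_eqE, Str.realize_sameEv, def_time, val_time,
    eval_pt_zero, eval_pt_four, eval_pt_eight, eval_pt_twelve, cons, true_and, and_imp]
  constructor
  · intro H k h hk hh x y x' y'
    exact H k h hk hh y' x' y x
  · intro H k h hk hh y' x' y x
    exact H k h hk hh x y x' y'

theorem realize_axThExpPlus : S.Realize AxThExpPlus r s ↔ (∃ k, S.iob k) ∧
    ∀ k, S.iob k → ∀ x y, x 0 ≠ y 0 → ∃ h, S.iob h ∧ S.wv k h x ∧ S.wv k h y := by
  simp only [AxThExpPlus, Str.realize_and, Str.realize_exB, Str.realize_iob, Str.realize_allB,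
    Str.realize_imp, Str.realize_allsQ_eight, Str.realize_neg, Str.realize_eqQ,
    Str.realize_onWl, eval_pt_zero, eval_pt_four, cons]
  refine and_congr_right fun _ => forall₂_congr fun k _ => ?_
  rw [forall_comm]
  rfl

theorem realize_axEther : S.Realize AxEther r s ↔ ∃ e, S.Ether e := by
  simp [AxEther]

theorem realize_axPhc : S.Realize AxPhc r s ↔ ∃ c, S.IsLightSpeed c := by
  simp [AxPhc]

theorem realize_axThExp : S.Realize AxThExp r s ↔ (∃ k, S.iob k) ∧
    ∀ k, S.iob k → ∀ y x, (∃ c, S.IsLightSpeed c ∧ spaceV x y < c * timeV x y) →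
      ∃ h, S.iob h ∧ S.wv k h x ∧ S.wv k h y := by
  simp [AxThExp, cons]

theorem Euclidean.of_axEField {Q : Type} [Field Q] [LinearOrder Q] [IsStrictOrderedRing Q]
    {S : Str B Q} {r : ℕ → B} {s : ℕ → Q} (h : S.Realize AxEField r s) : Euclidean Q := by
  simp only [AxEField, ltE, Ex.graph, Str.realize_and, Str.realize_exsQ_two, Str.realize_allQ,
    Str.realize_imp, Str.realize_exQ, Str.realize_isZero, Str.realize_eqQ, Str.realize_le,
    Str.realize_neg, Tm.eval, Tm.lift, Tm.subst, cons] at h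
  exact ⟨fun q hq => h.2.2.2.2 q ⟨q, 0, rfl, rfl, hq.le, hq.ne⟩⟩

theorem ClassicalKin.of_realize (h : ∀ φ ∈ ClassicalKinFull, S.Realize φ r s) :
    ClassicalKin S where
  ev := (realize_axEv S r s).1 (h _ (by simp [ClassicalKinFull, KinFull]))
  self := (realize_axSelf S r s).1 (h _ (by simp [ClassicalKinFull, KinFull]))
  symD := (realize_axSymD S r s).1 (h _ (by simp [ClassicalKinFull, KinFull]))
  line := (realize_axLine S r s).1 (h _ (by simp [ClassicalKinFull, KinFull]))
  triv := (realize_axTriv S r s).1 (h _ (by simp [ClassicalKinFull, KinFull]))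
  noAcc := (realize_axNoAcc S r s).1 (h _ (by simp [ClassicalKinFull, KinFull]))
  absTime := (realize_axAbsTime S r s).1 (h _ (by simp [ClassicalKinFull]))
  exIob := ((realize_axThExpPlus S r s).1 (h _ (by simp [ClassicalKinFull]))).1
  thExp := ((realize_axThExpPlus S r s).1 (h _ (by simp [ClassicalKinFull]))).2
  exEther := (realize_axEther S r s).1 (h _ (by simp [ClassicalKinFull]))

theorem SpecRel.realize {S : Str B Q} (h : SpecRel S) (hF : S.Realize AxEField r s) :
    ∀ φ ∈ SpecRelFull, S.Realize φ r s := by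
  simp only [SpecRelFull, KinFull, Set.mem_union, Set.mem_insert_iff, Set.mem_singleton_iff]
  rintro _ ((rfl | rfl | rfl | rfl | rfl | rfl | rfl) | rfl | rfl)
  · exact hF
  · exact (realize_axEv S r s).2 h.ev
  · exact (realize_axSelf S r s).2 h.self
  · exact (realize_axSymD S r s).2 h.symD
  · exact (realize_axLine S r s).2 h.line
  · exact (realize_axTriv S r s).2 h.triv
  · exact (realize_axNoAcc S r s).2 h.noAcc
  · exact (realize_axPhc S r s).2 h.light
  · exact (realize_axThExp S r s).2 ⟨h.exIob, fun k hk y x ⟨c, hc, hlt⟩ => h.thExp k c hk hc x y hlt⟩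

end

end CompKin

namespace CompKin

open Fml

variable {B Q : Type} [Field Q] [LinearOrder Q] [IsStrictOrderedRing Q]

/-! ### The radarization map -/

/-- The map `R_w`. -/
noncomputable def rotFun (w : Fin 3 → Q) (x : Fin 4 → Q) : Fin 4 → Q :=
  let n := qsqrt (w ⬝ᵥ w)
  let a := (n - w 0) / (w 1 ^ 2 + w 2 ^ 2)
  if w 1 ≠ 0 ∨ w 2 ≠ 0 then
    ![x 0, -(w 0 * x 1 + w 1 * x 2 + w 2 * x 3) / n,
      (w 1 * x 1 + (-w 0 - w 2 ^ 2 * a) * x 2 + w 1 * w 2 * a * x 3) / n,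
      (w 2 * x 1 + w 1 * w 2 * a * x 2 + (-w 0 - w 1 ^ 2 * a) * x 3) / n]
  else if w 0 ≤ 0 then x else ![x 0, -x 1, -x 2, -x 3]

/-- The scale factor. -/
noncomputable def scaleV (c : Q) (w : Fin 3 → Q) : Q := qsqrt (1 - (w ⬝ᵥ w) / c ^ 2)

/-- The map `S ∘ E ∘ G` for the speed `n` and the scale factor `g`. -/
def stdRad (c n g : Q) (p : Fin 4 → Q) : Fin 4 → Q :=
  ![g * p 0 - n * p 1 / (c ^ 2 * g), p 1 / g, p 2, p 3]

/-- The radarization map `Rad_w`. -/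
noncomputable def rad (c : Q) (w : Fin 3 → Q) (x : Fin 4 → Q) : Fin 4 → Q :=
  mkPt (scaleV c w * x 0 + (sp x ⬝ᵥ w) / (c ^ 2 * scaleV c w))
    (sp x + ((sp x ⬝ᵥ w) / (c ^ 2 * scaleV c w * (1 + scaleV c w))) • w)

theorem dot_three (v w : Fin 3 → Q) : v ⬝ᵥ w = v 0 * w 0 + v 1 * w 1 + v 2 * w 2 :=
  Fin.sum_univ_three _

theorem pt_ext_iff {x y : Fin 4 → Q} :
    x = y ↔ x 0 = y 0 ∧ x 1 = y 1 ∧ x 2 = y 2 ∧ x 3 = y 3 := by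
  simp only [funext_iff, Fin.forall_fin_succ]
  simp

section

variable [Euclidean Q]

theorem scaleV_mul_self {c : Q} {w : Fin 3 → Q} (hw : w ⬝ᵥ w < c ^ 2) :
    scaleV c w * scaleV c w = 1 - (w ⬝ᵥ w) / c ^ 2 := by
  refine qsqrt_mul_self (sub_nonneg.2 ?_)
  exact div_le_one_of_le₀ hw.le (sq_nonneg c)

theorem scaleV_pos {c : Q} {w : Fin 3 → Q} (hw : w ⬝ᵥ w < c ^ 2) : 0 < scaleV c w := by
  have hc : 0 < c ^ 2 := (dotProduct_self_nonneg' w).trans_lt hw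
  refine (qsqrt_nonneg _).lt_of_ne fun h => ?_
  have h₁ := scaleV_mul_self hw
  rw [scaleV, ← h, mul_zero, eq_comm, sub_eq_zero, eq_comm, div_eq_one_iff_eq hc.ne'] at h₁
  exact hw.ne h₁

theorem norm_mul_self (w : Fin 3 → Q) : qsqrt (w ⬝ᵥ w) * qsqrt (w ⬝ᵥ w) = w ⬝ᵥ w :=
  qsqrt_mul_self (dotProduct_self_nonneg' w)

theorem norm_pos {w : Fin 3 → Q} (hw : w ≠ 0) : 0 < qsqrt (w ⬝ᵥ w) := by
  refine (qsqrt_nonneg _).lt_of_ne fun h => hw ?_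
  have := norm_mul_self w
  rw [← h, mul_zero, eq_comm] at this
  exact dotProduct_self_eq_zero.1 this

theorem norm_lt_iff {w : Fin 3 → Q} {c : Q} (hc : 0 < c) :
    qsqrt (w ⬝ᵥ w) < c ↔ w ⬝ᵥ w < c ^ 2 := by
  conv_rhs => rw [← norm_mul_self w, ← pow_two]
  exact (pow_lt_pow_iff_left₀ (qsqrt_nonneg _) hc.le two_ne_zero).symm

/-- The map `R_w` turns `w` into the opposite of the first axis, and it is injective. -/
theorem rotFun_spec (w : Fin 3 → Q) :
    (∀ x, rotFun w x 0 = x 0) ∧ (∀ x, qsqrt (w ⬝ᵥ w) * rotFun w x 1 = -(sp x ⬝ᵥ w)) ∧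
    (∀ x t a, rotFun w (x + mkPt t (a • w)) =
      rotFun w x + ![t, -(a * qsqrt (w ⬝ᵥ w)), 0, 0]) ∧
    Function.Injective (rotFun w) := by
  set n := qsqrt (w ⬝ᵥ w) with hn
  have hnn : n * n = w 0 * w 0 + w 1 * w 1 + w 2 * w 2 := by
    rw [hn, norm_mul_self, dot_three]
  have hn0 : 0 ≤ n := qsqrt_nonneg _
  by_cases h : w 1 ≠ 0 ∨ w 2 ≠ 0
  · have hw : w ≠ 0 := by
      rintro rfl
      simp at h
    have hnp : 0 < n := norm_pos hw
    have hs : w 1 ^ 2 + w 2 ^ 2 ≠ 0 := by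
      intro h0
      have h1 : w 1 ^ 2 = 0 := by nlinarith [sq_nonneg (w 1), sq_nonneg (w 2)]
      have h2 : w 2 ^ 2 = 0 := by nlinarith [sq_nonneg (w 1), sq_nonneg (w 2)]
      simp_all
    set a := (n - w 0) / (w 1 ^ 2 + w 2 ^ 2) with ha
    have ha1 : a * (w 1 ^ 2 + w 2 ^ 2) = n - w 0 := div_mul_cancel₀ _ hs
    -- `a` is the inverse of `n + w₀` because `n² - w₀² = w₁² + w₂²`; with `ha1` and `ha2` the
    -- remaining identities are polynomial in `a`.
    have ha2 : a * (n + w 0) = 1 := by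
      rw [ha, div_mul_eq_mul_div, div_eq_one_iff_eq hs]
      linear_combination hnn
    have e : ∀ x, rotFun w x = ![x 0, -(w 0 * x 1 + w 1 * x 2 + w 2 * x 3) / n,
        (w 1 * x 1 + (-w 0 - w 2 ^ 2 * a) * x 2 + w 1 * w 2 * a * x 3) / n,
        (w 2 * x 1 + w 1 * w 2 * a * x 2 + (-w 0 - w 1 ^ 2 * a) * x 3) / n] :=
      fun x => if_pos h
    refine ⟨fun x => ?_, fun x => ?_, fun x t b => ?_, fun x y hxy => ?_⟩
    · rw [e]; rfl
    · rw [e, dot_three]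
      simp only [Matrix.cons_val_one, Matrix.cons_val_zero, sp]
      rw [mul_div_cancel₀ _ hnp.ne']
      simp only [Fin.succ_zero_eq_one, Fin.succ_one_eq_two]
      change _ = -(x 1 * w 0 + x 2 * w 1 + x 3 * w 2)
      ring
    · rw [e, e, pt_ext_iff]
      have m0 : mkPt t (b • w) 0 = t := rfl
      have m1 : mkPt t (b • w) 1 = b * w 0 := rfl
      have m2 : mkPt t (b • w) 2 = b * w 1 := rfl
      have m3 : mkPt t (b • w) 3 = b * w 2 := rfl
      simp only [Pi.add_apply, m0, m1, m2, m3, Matrix.cons_val]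
      refine ⟨trivial, ?_, ?_, ?_⟩
      · field_simp
        linear_combination b * hnn
      · field_simp
        ring
      · field_simp
        ring
    · rw [e, e, pt_ext_iff] at hxy
      simp only [Matrix.cons_val, div_left_inj' hnp.ne'] at hxy
      obtain ⟨h0, h1, h2, h3⟩ := hxy
      have hn2 : n * n ≠ 0 := mul_ne_zero hnp.ne' hnp.ne'
      -- On space, `(n R_w)ᵀ (n R_w) = n²`. The columns of `n R_w` are the coefficients that combine
      -- the three equations into `n² (x - y) = 0`.
      refine pt_ext_iff.2 ⟨h0, ?_, ?_, ?_⟩ <;> refine sub_eq_zero.1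
        ((mul_eq_zero.1 (?_ : n * n * _ = 0)).resolve_left hn2)
      · linear_combination (x 1 - y 1) * hnn - w 0 * h1 + w 1 * h2 + w 2 * h3
      · linear_combination (x 2 - y 2) * hnn - w 1 * h1 + (-w 0 - w 2 ^ 2 * a) * h2 +
          w 1 * w 2 * a * h3 + ((x 3 - y 3) * w 1 * w 2 - (x 2 - y 2) * w 2 ^ 2) * ha2 +
          ((x 3 - y 3) * w 1 * w 2 - (x 2 - y 2) * w 2 ^ 2) * a * ha1
      · linear_combination (x 3 - y 3) * hnn - w 2 * h1 + w 1 * w 2 * a * h2 +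
          (-w 0 - w 1 ^ 2 * a) * h3 + ((x 2 - y 2) * w 1 * w 2 - (x 3 - y 3) * w 1 ^ 2) * ha2 +
          ((x 2 - y 2) * w 1 * w 2 - (x 3 - y 3) * w 1 ^ 2) * a * ha1
  · have h' := h
    push Not at h'
    obtain ⟨h1, h2⟩ := h'
    have hnw : n * n = w 0 * w 0 := by rw [hnn, h1, h2]; ring
    have hd : ∀ x : Fin 4 → Q, sp x ⬝ᵥ w = x 1 * w 0 := by
      intro x
      rw [dot_three, h1, h2, mul_zero, mul_zero, add_zero, add_zero]
      rfl
    have m : ∀ t b, mkPt t (b • w) = ![t, b * w 0, 0, 0] := by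
      intro t b
      refine pt_ext_iff.2 ⟨rfl, rfl, ?_, ?_⟩
      · exact (congrArg (b * ·) h1).trans (mul_zero b)
      · exact (congrArg (b * ·) h2).trans (mul_zero b)
    by_cases h0 : w 0 ≤ 0
    · have hn' : n = -w 0 := by
        rw [← mul_self_inj hn0 (neg_nonneg.2 h0), hnw]
        ring
      have e : ∀ x, rotFun w x = x := fun x => (if_neg h).trans (if_pos h0)
      refine ⟨fun x => by rw [e], fun x => ?_, fun x t b => ?_, fun x y hxy => ?_⟩
      · rw [e, hd, hn']
        ring
      · rw [e, e, m, hn', mul_neg, neg_neg]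
      · rwa [e, e] at hxy
    · have hn' : n = w 0 := (mul_self_inj hn0 (not_le.1 h0).le).1 hnw
      have e : ∀ x, rotFun w x = ![x 0, -x 1, -x 2, -x 3] :=
        fun x => (if_neg h).trans (if_neg h0)
      refine ⟨fun x => by rw [e]; rfl, fun x => ?_, fun x t b => ?_, fun x y hxy => ?_⟩
      · rw [e, hd, hn']
        simp
        ring
      · rw [e, e, m, hn', pt_ext_iff]
        simp
        ring
      · rw [e, e, pt_ext_iff] at hxy
        simpa [pt_ext_iff] using hxy

/-- The definition of the radarization map by means of `R_w`. -/
theorem rotFun_eq_stdRad_iff {c : Q} {w : Fin 3 → Q} (hw : w ⬝ᵥ w < c ^ 2) (x y : Fin 4 → Q) :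
    stdRad c (qsqrt (w ⬝ᵥ w)) (scaleV c w) (rotFun w x) = rotFun w y ↔ rad c w x = y := by
  obtain ⟨h₀, h₁, h₂, hinj⟩ := rotFun_spec w
  have hg := scaleV_pos hw
  have hgg := scaleV_mul_self hw
  have hc : c ≠ 0 := by
    rintro rfl
    exact absurd hw (by simpa using dotProduct_self_nonneg' w)
  have hnn := norm_mul_self w
  -- In the rotated coordinates only the time and the first coordinate change, so the conjugated map
  -- moves `x` in the direction of time and of `w` alone. The stretching factor `1 / g` along `w`
  -- yields the coefficient in `rad` because `n² / c² = (1 - g)(1 + g)`; this form also makes sense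
  -- for `w = 0`.
  have key : stdRad c (qsqrt (w ⬝ᵥ w)) (scaleV c w) (rotFun w x) = rotFun w (rad c w x) := by
    have e : rad c w x = x + mkPt (scaleV c w * x 0 + (sp x ⬝ᵥ w) / (c ^ 2 * scaleV c w) - x 0)
        (((sp x ⬝ᵥ w) / (c ^ 2 * scaleV c w * (1 + scaleV c w))) • w) :=
      pt_ext (by simp [rad]) (by simp [rad])
    rw [e, h₂, stdRad, pt_ext_iff]
    have h₃ := h₁ x
    have h₄ := h₀ x
    set g := scaleV c w
    set n := qsqrt (w ⬝ᵥ w)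
    set p := rotFun w x
    have h₅ : sp x ⬝ᵥ w = -(n * p 1) := by rw [h₃, neg_neg]
    have hg1 : 1 + g ≠ 0 := by positivity
    have hg0 := hg.ne'
    rw [← hnn] at hgg
    have hgg' : g * g * c ^ 2 = c ^ 2 - n * n := by
      rw [hgg]
      field_simp
    simp only [Pi.add_apply, Matrix.cons_val, h₅, h₄]
    refine ⟨?_, ?_, ?_, ?_⟩
    · ring
    · field_simp
      linear_combination -p 1 * hgg'
    · ring
    · ring
  -- Injectivity of `R_w` takes the place of its inverse.
  rw [key, hinj.eq_iff]

end

namespace Str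

variable (S : Str B Q) (r : ℕ → B) (s : ℕ → Q) [Euclidean Q]

/-- Radarization for the speed of light of the ether observers. -/
def RadMaps (w : Fin 3 → Q) (x y : Fin 4 → Q) : Prop :=
  ∃ c, S.IsEtherLightSpeed c ∧ w ⬝ᵥ w < c ^ 2 ∧ rad c w x = y

theorem realize_matMaps (M : Matrix (Fin 4) (Fin 4) Ex) (x y : Pt) :
    S.Realize (matMaps M x y) r s ↔ (∀ i j, (M i j).Def s) ∧
      ∀ i, (M i 0).val s * Pt.eval s x 0 + (M i 1).val s * Pt.eval s x 1 +
        (M i 2).val s * Pt.eval s x 2 + (M i 3).val s * Pt.eval s x 3 = Pt.eval s y i := by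
  simp only [matMaps, realize_and, realize_eqE, Ex.def_add, Ex.def_mul, Ex.def_tm, Ex.val_add,
    Ex.val_mul, Ex.val_tm, and_true, Fin.forall_fin_succ, Pt.eval]
  simp
  tauto

theorem val_norm3 (v : Fin 3 → Tm) : (norm3 v).val s =
    qsqrt ((fun i => (v i).eval s) ⬝ᵥ fun i => (v i).eval s) := by
  simp [norm3, dot_three, pow_two]

theorem def_norm3 (v : Fin 3 → Tm) : (norm3 v).Def s := by
  simp [norm3]
  positivity

/-- The three cases exclude each other and match the branches of `rotFun`. In the first, all matrix
entries are defined, since `n` and `w₁² + w₂²` are nonzero. -/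
theorem realize_rotMaps (v : Fin 3 → Tm) (x y : Pt) : S.Realize (rotMaps v x y) r s ↔
    rotFun (fun i => (v i).eval s) (Pt.eval s x) = Pt.eval s y := by
  simp only [rotMaps, realize_or, realize_and, realize_neg, realize_eqE, realize_leE, realize_ltE,
    Ex.def_tm, Ex.def_zero, Ex.val_tm, Ex.val_zero, true_and, realize_matMaps, realize_eqPt,
    rotMat]
  set w := fun i => (v i).eval s with hwdef
  have hw : ∀ i, (v i).eval s = w i := fun i => rfl
  simp only [hw]
  by_cases h : w 1 ≠ 0 ∨ w 2 ≠ 0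
  · have hne : ¬ (w 1 = 0 ∧ w 2 = 0) := by tauto
    have hw0 : w ≠ 0 := by
      intro h'
      simp [h'] at h
    have hn : qsqrt (w ⬝ᵥ w) ≠ 0 := (norm_pos hw0).ne'
    have hs : w 1 ^ 2 + w 2 ^ 2 ≠ 0 := by
      intro h0
      have h1 : w 1 ^ 2 = 0 := by nlinarith [sq_nonneg (w 1), sq_nonneg (w 2)]
      have h2 : w 2 ^ 2 = 0 := by nlinarith [sq_nonneg (w 1), sq_nonneg (w 2)]
      simp_all
    simp only [rotFun, if_pos h, pt_ext_iff]
    simp [Fin.forall_fin_succ, val_norm3, def_norm3, hw, hn, hs]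
    rw [show (fun i => w i) = w from rfl, or_iff_left (by tauto),
      and_iff_right (by tauto)]
    refine Iff.and Iff.rfl (Iff.and ?_ (Iff.and ?_ ?_)) <;>
      refine iff_of_eq (congrArg (· = _) ?_) <;> ring
  · have h' := h
    push Not at h'
    obtain ⟨h1, h2⟩ := h'
    by_cases h0 : w 0 ≤ 0
    · simp [rotFun, h0, h1, h2, not_lt.2 h0]
    · simp [rotFun, h0, h1, h2, not_le.1 h0, Fin.forall_fin_succ, pt_ext_iff]

theorem realize_exsQ_seventeen (φ : Fml) : S.Realize (exsQ 17 φ) r s ↔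
    ∃ c x₄ x₃ x₂ x₁, S.Realize φ r (app x₁ (app x₂ (app x₃ (app x₄ (cons c s))))) := by
  simp only [← realize_exsQ_four, ← realize_exQ]
  rfl

theorem realize_galMat {n : Ex} (hn : n.Def s) (x y : Pt) :
    S.Realize (matMaps (galMat n) x y) r s ↔ Pt.eval s y =
      ![Pt.eval s x 0, n.val s * Pt.eval s x 0 + Pt.eval s x 1, Pt.eval s x 2, Pt.eval s x 3] := by
  rw [realize_matMaps, eq_comm, pt_ext_iff]
  simp [Fin.forall_fin_succ, galMat, hn]

theorem realize_synMat {n : Ex} (hn : n.Def s) (c : Tm) (hc : c.eval s ≠ 0)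
    (hd : 0 < 1 - n.val s ^ 2 / c.eval s ^ 2) (x y : Pt) :
    S.Realize (matMaps (synMat c n) x y) r s ↔ Pt.eval s y =
      ![(Pt.eval s x 0 - n.val s / c.eval s ^ 2 * Pt.eval s x 1) /
          (1 - n.val s ^ 2 / c.eval s ^ 2),
        (Pt.eval s x 1 - n.val s * Pt.eval s x 0) / (1 - n.val s ^ 2 / c.eval s ^ 2),
        Pt.eval s x 2 / qsqrt (1 - n.val s ^ 2 / c.eval s ^ 2),
        Pt.eval s x 3 / qsqrt (1 - n.val s ^ 2 / c.eval s ^ 2)] := by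
  have hg : qsqrt (1 - n.val s ^ 2 / c.eval s ^ 2) ≠ 0 := by
    intro h
    have := qsqrt_mul_self hd.le
    rw [h, mul_zero] at this
    exact hd.ne this
  rw [realize_matMaps, @eq_comm _ (Pt.eval s y), pt_ext_iff]
  simp only [synMat, scale, Fin.forall_fin_succ, Matrix.of_apply, Matrix.cons_val, Ex.def_div,
    Ex.def_sqrt, Ex.def_neg, Ex.def_sub, Ex.def_one, Ex.def_zero, Ex.def_sq, Ex.def_tm, hn,
    Ex.val_sq, Ex.val_tm, Ex.val_sub, Ex.val_one, Ex.val_zero, Ex.val_div, Ex.val_neg,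
    Ex.val_sqrt, pow_ne_zero 2 hc, hd.le, hd.ne', hg, Fin.succ_zero_eq_one, Fin.succ_one_eq_two,
    Matrix.cons_val_zero, Matrix.cons_val_succ, ne_eq, not_false_eq_true, and_self, true_and,
    IsEmpty.forall_iff, and_true]
  refine Iff.and ?_ (Iff.and ?_ (Iff.and ?_ ?_)) <;>
    refine iff_of_eq (congrArg (· = _) ?_) <;> ring

theorem realize_scaleMat {n : Ex} (hn : n.Def s) (c : Tm) (hc : c.eval s ≠ 0)
    (hd : 0 < 1 - n.val s ^ 2 / c.eval s ^ 2) (x y : Pt) :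
    S.Realize (matMaps (scaleMat c n) x y) r s ↔ Pt.eval s y =
      qsqrt (1 - n.val s ^ 2 / c.eval s ^ 2) • Pt.eval s x := by
  rw [realize_matMaps, eq_comm, pt_ext_iff]
  simp [Fin.forall_fin_succ, scaleMat, scale, hn, hc, sub_nonneg.1 hd.le]

theorem realize_radMaps (v : Fin 3 → Tm) (x y : Pt) : S.Realize (radMaps v x y) r s ↔
    S.RadMaps (fun i => (v i).eval s) (Pt.eval s x) (Pt.eval s y) := by
  have hd : ∀ (x₁ x₂ x₃ x₄ : Fin 4 → Q) (c : Q),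
    drop 17 (app x₁ (app x₂ (app x₃ (app x₄ (cons c s))))) = s := fun _ _ _ _ _ => rfl
  have hc : ∀ (x₁ x₂ x₃ x₄ : Fin 4 → Q) (c : Q),
    app x₁ (app x₂ (app x₃ (app x₄ (cons c s)))) 16 = c := fun _ _ _ _ _ => rfl
  simp only [radMaps, realize_exsQ_seventeen, realize_and, realize_isEtherLightSpeed,
    realize_ltE, val_norm3, def_norm3, Ex.def_tm, Ex.val_tm, Tm.eval_lift, hd, realize_rotMaps,
    Pt.eval_lift, eval_pt_zero, eval_pt_four, eval_pt_eight, eval_pt_twelve, Tm.eval_var, hc,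
    true_and, RadMaps]
  set w := fun i => (v i).eval s with hwdef
  refine exists_congr fun c => ?_
  set n := qsqrt (w ⬝ᵥ w) with hn
  have hn2 : n ^ 2 = w ⬝ᵥ w := by rw [pow_two, hn, norm_mul_self]
  set d := 1 - (w ⬝ᵥ w) / c ^ 2
  set g := scaleV c w
  have key : ∀ p₁ p₂ p₃ p₄ : Fin 4 → Q, 0 < c → w ⬝ᵥ w < c ^ 2 →
      ((S.Realize (matMaps (galMat (norm3 fun i => Tm.lift 17 (v i))) (pt 0) (pt 4)) r
          (app p₁ (app p₂ (app p₃ (app p₄ (cons c s))))) ∧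
        S.Realize (matMaps (synMat (.var 16) (norm3 fun i => Tm.lift 17 (v i))) (pt 4) (pt 8)) r
          (app p₁ (app p₂ (app p₃ (app p₄ (cons c s))))) ∧
        S.Realize (matMaps (scaleMat (.var 16) (norm3 fun i => Tm.lift 17 (v i))) (pt 8) (pt 12)) r
          (app p₁ (app p₂ (app p₃ (app p₄ (cons c s)))))) ↔
      p₂ = ![p₁ 0, n * p₁ 0 + p₁ 1, p₁ 2, p₁ 3] ∧
      p₃ = ![(p₂ 0 - n / c ^ 2 * p₂ 1) / d, (p₂ 1 - n * p₂ 0) / d, p₂ 2 / g, p₂ 3 / g] ∧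
      p₄ = g • p₃) := by
    intro p₁ p₂ p₃ p₄ hc0 hlt
    have hdpos : 0 < d := sub_pos.2 ((div_lt_one (by positivity)).2 hlt)
    have hval : (norm3 fun i => Tm.lift 17 (v i)).val
        (app p₁ (app p₂ (app p₃ (app p₄ (cons c s))))) = n := by
      simp only [val_norm3, Tm.eval_lift, hd]
      rfl
    have hcv : (Tm.var 16).eval (app p₁ (app p₂ (app p₃ (app p₄ (cons c s))))) = c := rfl
    rw [realize_galMat _ _ _ (def_norm3 _ _), realize_synMat _ _ _ (def_norm3 _ _),
      realize_scaleMat _ _ _ (def_norm3 _ _)]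
    · simp only [eval_pt_zero, eval_pt_four, eval_pt_eight, eval_pt_twelve, hval, hcv, hn2]
      rfl
    · exact hc0.ne'
    · rwa [hval, hcv, hn2]
    · exact hc0.ne'
    · rwa [hval, hcv, hn2]
  -- The product of the three matrices simplifies because `d = g²`.
  have hstd : 0 < c → w ⬝ᵥ w < c ^ 2 → ∀ p₁ : Fin 4 → Q,
      g • ![(p₁ 0 - n / c ^ 2 * (n * p₁ 0 + p₁ 1)) / d, (n * p₁ 0 + p₁ 1 - n * p₁ 0) / d,
        p₁ 2 / g, p₁ 3 / g] = stdRad c n g p₁ := by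
    intro hc0 hlt p₁
    have hdpos : 0 < d := sub_pos.2 ((div_lt_one (by positivity)).2 hlt)
    have hg : 0 < g := scaleV_pos hlt
    have hgd : d = g * g := (scaleV_mul_self hlt).symm
    have hgd' : c ^ 2 - n ^ 2 = g * g * c ^ 2 := by
      rw [← hgd, hn2]
      simp only [d]
      field_simp
    rw [hgd, stdRad, pt_ext_iff]
    simp only [Pi.smul_apply, smul_eq_mul, Matrix.cons_val]
    refine ⟨?_, ?_, ?_, ?_⟩
    · field_simp
      linear_combination p₁ 0 * hgd'
    · field_simp
      ring
    · field_simp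
    · field_simp
  constructor
  · rintro ⟨p₄, p₃, p₂, p₁, hc, hlt, h₁, h₂, h₃, h₄, h₅⟩
    rw [norm_lt_iff hc.1] at hlt
    refine ⟨hc, hlt, (rotFun_eq_stdRad_iff hlt _ _).1 ?_⟩
    obtain ⟨h₂, h₃, h₄⟩ := (key p₁ p₂ p₃ p₄ hc.1 hlt).1 ⟨h₂, h₃, h₄⟩
    rw [h₁, h₅, h₄, h₃, h₂]
    exact (hstd hc.1 hlt p₁).symm
  · rintro ⟨hc, hlt, h⟩
    rw [← rotFun_eq_stdRad_iff hlt] at h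
    obtain ⟨h₂, h₃, h₄⟩ := (key (rotFun w (Pt.eval s x)) _ _
      (rotFun w (Pt.eval s y)) hc.1 hlt).2 ⟨rfl, rfl, h.symm.trans (hstd hc.1 hlt _).symm⟩
    exact ⟨_, _, _, _, hc, (norm_lt_iff hc.1).2 hlt, rfl, h₂, h₃, h₄, rfl⟩

end Str

end CompKin

namespace CompKin

open Fml

variable {B Q : Type} [Field Q] [LinearOrder Q] [IsStrictOrderedRing Q]

/-! ### Isometries and Galilean transformations -/

theorem eq_zero_of_dot_self {v : Fin 3 → Q} (h : v ⬝ᵥ v = 0) : v = 0 :=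
  dotProduct_self_eq_zero.1 h

/-- An isometry of space is affine. -/
theorem exists_matrix_of_isometry (L : (Fin 3 → Q) → Fin 3 → Q)
    (hL : ∀ p q, (L p - L q) ⬝ᵥ (L p - L q) = (p - q) ⬝ᵥ (p - q)) :
    ∃ A : Matrix (Fin 3) (Fin 3) Q, ∀ p, L p = A.mulVec p + L 0 := by
  have hself : ∀ p, (L p - L 0) ⬝ᵥ (L p - L 0) = p ⬝ᵥ p := fun p => by simpa using hL p 0
  have hdot : ∀ p q, (L p - L 0) ⬝ᵥ (L q - L 0) = p ⬝ᵥ q := by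
    intro p q
    have h := hL p q
    rw [show L p - L q = (L p - L 0) - (L q - L 0) by abel] at h
    simp only [sub_dotProduct (L p - L 0), dotProduct_sub _ (L p - L 0), sub_dotProduct p,
      dotProduct_sub _ p, hself] at h
    rw [dotProduct_comm (L q - L 0) (L p - L 0), dotProduct_comm q p] at h
    linarith
  -- Inner products are preserved by polarization, so the squared norm of the defect of linearity
  -- expands to zero. Surjectivity plays no role.
  have hlin : ∀ (a b : Q) (p q : Fin 3 → Q),
      L (a • p + b • q) - L 0 = a • (L p - L 0) + b • (L q - L 0) := by
    intro a b p q
    refine sub_eq_zero.1 (eq_zero_of_dot_self ?_)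
    obtain ⟨M, hM⟩ : ∃ M : (Fin 3 → Q) → Fin 3 → Q, ∀ p, M p = L p - L 0 := ⟨_, fun _ => rfl⟩
    simp only [← hM] at hdot ⊢
    simp only [sub_dotProduct, dotProduct_sub, add_dotProduct, dotProduct_add, smul_dotProduct,
      dotProduct_smul, hdot, smul_eq_mul]
    ring
  let M : (Fin 3 → Q) →ₗ[Q] Fin 3 → Q :=
    { toFun := fun p => L p - L 0
      map_add' := fun p q => by simpa using hlin 1 1 p q
      map_smul' := fun a p => by simpa using hlin a 0 p 0 }
  refine ⟨LinearMap.toMatrix' M, fun p => ?_⟩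
  rw [LinearMap.toMatrix'_mulVec]
  exact (sub_add_cancel _ _).symm

/-- A map that preserves time differences acts on time as an isometry of the line. -/
theorem time_affine (φ : (Fin 4 → Q) → Q) (hφ : ∀ x y, |φ x - φ y| = |x 0 - y 0|) :
    ∃ ε t₀ : Q, ε * ε = 1 ∧ ∀ x, φ x = ε * x 0 + t₀ := by
  have hsq : ∀ x y, (φ x - φ y) ^ 2 = (x 0 - y 0) ^ 2 := fun x y => sq_eq_sq_iff_abs_eq_abs _ _ |>.2 (hφ x y)
  refine ⟨φ (mkPt 1 0) - φ 0, φ 0, ?_, fun x => ?_⟩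
  · have := hsq (mkPt 1 0) 0
    simp at this
    rcases this with h | h <;> rw [h] <;> norm_num
  · have h₁ := hsq (mkPt 1 0) 0
    have h₂ := hsq x 0
    have h₃ := hsq x (mkPt 1 0)
    simp only [mkPt_zero, Pi.zero_apply, sub_zero, one_pow] at h₁ h₂ h₃
    -- Polarization again, on the line: `h₁ + h₂ - h₃` is twice this product.
    have h₄ : (φ x - φ 0) * (φ (mkPt 1 0) - φ 0) = x 0 := by linarith
    linear_combination (φ (mkPt 1 0) - φ 0) * h₄ - (φ x - φ 0) * h₁

/-- A point on a nonhorizontal line is determined by its time. -/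
theorem eq_of_collinear {p q r : Fin 4 → Q} {a b : Q} (hpq : p 0 ≠ q 0)
    (hr : r 0 - p 0 = a * (q 0 - p 0)) (h : r - p = b • (q - p) ∨ q - r = b • (r - p)) :
    r = p + a • (q - p) := by
  have hqp : q 0 - p 0 ≠ 0 := sub_ne_zero.2 hpq.symm
  rcases h with h | h
  · have h₀ : r 0 - p 0 = b * (q 0 - p 0) := congrFun h 0
    rw [mul_right_cancel₀ hqp (hr.symm.trans h₀), ← h]
    abel
  · have h₀ : q 0 - r 0 = b * (r 0 - p 0) := congrFun h 0
    have h₁ : a * (1 + b) = 1 := by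
      refine mul_right_cancel₀ hqp ?_
      linear_combination (-1 - b) * hr - h₀
    have h₂ : q - p = (1 + b) • (r - p) := by
      rw [add_smul, one_smul, ← h]
      abel
    rw [h₂, smul_smul, h₁, one_smul]
    abel

/-- The Galilean transformation with the given parameters. -/
def galMap (ε t₀ : Q) (A : Matrix (Fin 3) (Fin 3) Q) (u d : Fin 3 → Q) (x : Fin 4 → Q) :
    Fin 4 → Q :=
  mkPt (ε * x 0 + t₀) (A.mulVec (sp x) + x 0 • u + d)

theorem orthogonal_of_dot {A : Matrix (Fin 3) (Fin 3) Q}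
    (h : ∀ p, A.mulVec p ⬝ᵥ A.mulVec p = p ⬝ᵥ p) : A.transpose * A = 1 := by
  have hdot : ∀ p q, A.mulVec p ⬝ᵥ A.mulVec q = p ⬝ᵥ q := by
    intro p q
    have h₁ := h (p + q)
    simp only [Matrix.mulVec_add, add_dotProduct, dotProduct_add, h] at h₁
    rw [dotProduct_comm (A.mulVec q) (A.mulVec p), dotProduct_comm q p] at h₁
    linarith
  refine Matrix.ext_iff_mulVec.2 fun v => dotProduct_eq _ _ fun w => ?_
  rw [← Matrix.mulVec_mulVec, Matrix.mulVec_transpose, ← Matrix.dotProduct_mulVec, hdot,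
    Matrix.one_mulVec]

theorem dot_mulVec {A : Matrix (Fin 3) (Fin 3) Q} (h : A.transpose * A = 1)
    (p q : Fin 3 → Q) : A.mulVec p ⬝ᵥ A.mulVec q = p ⬝ᵥ q := by
  rw [Matrix.dotProduct_mulVec, Matrix.vecMul_mulVec, h, Matrix.vecMul_one]

/-- A map that preserves time differences, distances of simultaneous points and nonhorizontal
lines is a Galilean transformation. -/
theorem exists_galMap (f : (Fin 4 → Q) → Fin 4 → Q)
    (hT : ∀ x y, |f x 0 - f y 0| = |x 0 - y 0|)
    (hD : ∀ x y, x 0 = y 0 → dist2 (f x) (f y) = dist2 x y)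
    (hLine : ∀ (x y : Fin 4 → Q) (a : Q), x 0 ≠ y 0 → ∃ b : Q, f (x + a • (y - x)) - f x = b • (f y - f x) ∨
      f y - f (x + a • (y - x)) = b • (f (x + a • (y - x)) - f x)) :
    ∃ ε t₀ A u d, ε * ε = 1 ∧ A.transpose * A = 1 ∧ ∀ x, f x = galMap ε t₀ A u d x := by
  obtain ⟨ε, t₀, hε, hf0⟩ := time_affine (fun x => f x 0) hT
  have hε0 : ε ≠ 0 := by
    rintro rfl
    simp at hε
  -- The hypothesis gives collinearity with an unknown ratio; since time is mapped affinely,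
  -- comparing times forces the ratio to be `a`.
  have hline : ∀ (x y : Fin 4 → Q) (a : Q), x 0 ≠ y 0 → f (x + a • (y - x)) = f x + a • (f y - f x) := by
    intro x y a hxy
    obtain ⟨b, hb⟩ := hLine x y a hxy
    refine eq_of_collinear (b := b) ?_ ?_ hb
    · simp only [hf0]
      intro h
      exact hxy (mul_left_cancel₀ hε0 (add_right_cancel h))
    · simp only [hf0, Pi.add_apply, Pi.smul_apply, Pi.sub_apply, smul_eq_mul]
      ring
  have hiso : ∀ t p q, (sp (f (mkPt t p)) - sp (f (mkPt t q))) ⬝ᵥ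
      (sp (f (mkPt t p)) - sp (f (mkPt t q))) = (p - q) ⬝ᵥ (p - q) :=
    fun t p q => hD (mkPt t p) (mkPt t q) rfl
  -- On each vertical line `f` is affine, so the slices at times `0` and `1` determine it.
  have hstep : ∀ t p, sp (f (mkPt t p)) =
      sp (f (mkPt 0 p)) + t • (sp (f (mkPt 1 p)) - sp (f (mkPt 0 p))) := by
    intro t p
    have := congrArg sp (hline (mkPt 0 p) (mkPt 1 p) t (by simp))
    rw [show mkPt 0 p + t • (mkPt 1 p - mkPt 0 p) = mkPt t p from
      pt_ext (by simp) (by simp)] at this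
    exact this
  obtain ⟨A, hA⟩ := exists_matrix_of_isometry _ (hiso 0)
  obtain ⟨A', hA'⟩ := exists_matrix_of_isometry _ (hiso 1)
  have hAn : ∀ p, A.mulVec p ⬝ᵥ A.mulVec p = p ⬝ᵥ p := by
    intro p
    have := hiso 0 p 0
    rwa [hA p, add_sub_cancel_right, sub_zero] at this
  have hAn' : ∀ p, A'.mulVec p ⬝ᵥ A'.mulVec p = p ⬝ᵥ p := by
    intro p
    have := hiso 1 p 0
    rwa [hA' p, add_sub_cancel_right, sub_zero] at this
  -- The slice at time `1/2` is an isometry as well, and its linear part is the mean of `A` and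
  -- `A'`. By the parallelogram law, `A p`, `A' p` and their mean can have equal length only if `A p
  -- = A' p`.
  have hAA : ∀ p, A'.mulVec p = A.mulVec p := by
    intro p
    have h := hiso (1 / 2) p 0
    rw [hstep _ p, hstep _ 0, hA p, hA' p, sub_zero] at h
    rw [show ∀ a b m n : Fin 3 → Q, a + m + (1 / 2 : Q) • (b + n - (a + m)) -
      (m + (1 / 2 : Q) • (n - m)) = (1 / 2 : Q) • (a + b) from fun a b m n => by
        funext i
        simp only [Pi.sub_apply, Pi.add_apply, Pi.smul_apply, smul_eq_mul]
        ring] at h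
    refine sub_eq_zero.1 (eq_zero_of_dot_self ?_)
    simp only [smul_dotProduct, dotProduct_smul, add_dotProduct, dotProduct_add, smul_eq_mul,
      sub_dotProduct, dotProduct_sub, hAn, hAn', dotProduct_comm (A'.mulVec p) (A.mulVec p)] at h ⊢
    linear_combination (-4) * h
  refine ⟨ε, t₀, A, sp (f (mkPt 1 0)) - sp (f (mkPt 0 0)), sp (f (mkPt 0 0)), hε,
    orthogonal_of_dot hAn, fun x => pt_ext (hf0 x) ?_⟩
  rw [← mkPt_eta x, hstep, hA, hA', hAA]
  simp only [galMap, mkPt_zero, sp_mkPt]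
  funext i
  simp only [Pi.sub_apply, Pi.add_apply, Pi.smul_apply, smul_eq_mul]
  ring

/-! ### Worldview transformations of classical kinematics -/

namespace Str

variable (S : Str B Q)

variable {S} in
theorem SameEv.symm {k h : B} {x y : Fin 4 → Q} (H : S.SameEv k x h y) : S.SameEv h y k x :=
  fun b => (H b).symm

variable {S} in
theorem SameEv.trans {k h l : B} {x y z : Fin 4 → Q} (H : S.SameEv k x h y)
    (H' : S.SameEv h y l z) : S.SameEv k x l z :=
  fun b => (H b).trans (H' b)

theorem SameEv.refl (k : B) (x : Fin 4 → Q) : S.SameEv k x k x := fun _ => Iff.rfl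

/-- The worldview transformation between `k` and `h` is the given Galilean transformation. -/
structure Gal (k h : B) (ε t₀ : Q) (A : Matrix (Fin 3) (Fin 3) Q) (u d : Fin 3 → Q) : Prop where
  sq : ε * ε = 1
  orth : A.transpose * A = 1
  ev : ∀ x y, S.SameEv k x h y ↔ y = galMap ε t₀ A u d x

end Str

namespace ClassicalKin

variable {S : Str B Q} (H : ClassicalKin S)

include H

/-- Absolute time forces `x` and `y` to be simultaneous. An inertial body sent through `x` and a
point above it would also pass through `y`, and its straight worldline meets that time only at `x`.
-/
theorem ev_injective {k : B} (hk : S.iob k) {x y : Fin 4 → Q} (h : S.SameEv k x k y) :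
    x = y := by
  have h₀ : x 0 = y 0 := by
    have := H.absTime k k hk hk x x x y (Str.SameEv.refl S k x) h
    rw [sub_self, abs_zero, eq_comm, abs_eq_zero, sub_eq_zero] at this
    exact this
  obtain ⟨l, hl, hx, hz⟩ := H.thExp k hk x (x + mkPt 1 0) (by simp)
  have hy : S.wv k l y := (h l).1 hx
  obtain ⟨a, ha⟩ := H.line k l hk hl x (x + mkPt 1 0) y hx hz hy
  have := eq_of_collinear (a := 0) (by simp) (by simp [h₀]) ha
  simpa using this.symm

theorem exists_time {k h : B} (hk : S.iob k) (hh : S.iob h) (t : Q) :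
    ∃ y, S.wv k h y ∧ y 0 = t := by
  choose g hg using fun x => H.ev h k hh hk x
  obtain ⟨ε, t₀, hε, hg0⟩ := time_affine (fun x => g x 0) fun x y =>
    (H.absTime h k hh hk x y _ _ (hg x) (hg y)).symm
  -- The own time of `h` that is mapped to `t`, since `ε² = 1`.
  refine ⟨g (mkPt (ε * (t - t₀)) 0), (hg _ h).1 ((H.self h hh _).2 rfl), ?_⟩
  rw [hg0, mkPt_zero, ← mul_assoc, hε]
  ring

/-- `AxLine` only places the worldline inside a line; `exists_time` shows that it fills the line. -/
theorem wv_line {k h : B} (hk : S.iob k) (hh : S.iob h) {x y : Fin 4 → Q} (hxy : x 0 ≠ y 0)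
    (hx : S.wv k h x) (hy : S.wv k h y) (a : Q) : S.wv k h (x + a • (y - x)) := by
  obtain ⟨z, hz, hz0⟩ := H.exists_time hk hh (x 0 + a * (y 0 - x 0))
  obtain ⟨b, hb⟩ := H.line k h hk hh x y z hx hy hz
  rwa [← eq_of_collinear hxy (by rw [hz0]; ring) hb]

/-- By `AxThExpPlus` every non-horizontal line of `k` carries the worldline of an inertial observer,
which is straight for `h` too. So the coordinate change respects such lines and `exists_galMap`
applies. -/
theorem exists_gal {k h : B} (hk : S.iob k) (hh : S.iob h) :
    ∃ ε t₀ A u d, S.Gal k h ε t₀ A u d := by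
  choose f hf using fun x => H.ev k h hk hh x
  obtain ⟨ε, t₀, A, u, d, hε, hA, hfx⟩ := exists_galMap f
    (fun x y => (H.absTime k h hk hh x y _ _ (hf x) (hf y)).symm) (fun x y hxy => by
      refine (H.symD k h hk hh x y _ _ hxy ?_ (hf x) (hf y)).symm
      have := H.absTime k h hk hh x y _ _ (hf x) (hf y)
      rw [hxy, sub_self, abs_zero, eq_comm, abs_eq_zero, sub_eq_zero] at this
      exact this) fun x y a hxy => by
      obtain ⟨l, hl, hx, hy⟩ := H.thExp k hk x y hxy
      have hz := H.wv_line hk hl hxy hx hy a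
      exact H.line h l hh hl _ _ _ ((hf _ l).1 hx) ((hf _ l).1 hy) ((hf _ l).1 hz)
  refine ⟨ε, t₀, A, u, d, hε, hA, fun x y => ⟨fun h => ?_, fun h => ?_⟩⟩
  · rw [← hfx]
    exact H.ev_injective hh (h.symm.trans (hf x))
  · rw [h, ← hfx]
    exact hf x

end ClassicalKin

end CompKin

namespace CompKin

open Fml

variable {B Q : Type} [Field Q] [LinearOrder Q] [IsStrictOrderedRing Q]

/-! ### The Minkowski form -/

/-- The square of the Minkowski distance. -/
def mink (c : Q) (x y : Fin 4 → Q) : Q := c ^ 2 * (x 0 - y 0) ^ 2 - dist2 x y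

theorem timeV_sq (x y : Fin 4 → Q) : timeV x y ^ 2 = (x 0 - y 0) ^ 2 := sq_abs _

theorem galMap_add_smul (ε t₀ : Q) (A : Matrix (Fin 3) (Fin 3) Q) (u d : Fin 3 → Q)
    (x y : Fin 4 → Q) (a : Q) : galMap ε t₀ A u d (x + a • (y - x)) =
      galMap ε t₀ A u d x + a • (galMap ε t₀ A u d y - galMap ε t₀ A u d x) := by
  refine pt_ext ?_ ?_
  · simp only [galMap, mkPt_zero, Pi.add_apply, Pi.smul_apply, Pi.sub_apply, smul_eq_mul]
    ring
  · simp only [galMap, sp_mkPt, sp_add, sp_smul, sp_sub, Matrix.mulVec_add, Matrix.mulVec_smul,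
      Matrix.mulVec_sub, Pi.add_apply, Pi.smul_apply, Pi.sub_apply, smul_eq_mul]
    module

theorem galMap_sub (ε t₀ : Q) (A : Matrix (Fin 3) (Fin 3) Q) (u d : Fin 3 → Q)
    (x y : Fin 4 → Q) : galMap ε t₀ A u d x - galMap ε t₀ A u d y =
      mkPt (ε * (x 0 - y 0)) (A.mulVec (sp x - sp y) + (x 0 - y 0) • u) := by
  refine pt_ext ?_ ?_
  · simp only [galMap, mkPt_zero, Pi.sub_apply]
    ring
  · simp only [galMap, sp_mkPt, sp_sub, Matrix.mulVec_sub]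
    module

/-- The radarization map as a linear map. -/
noncomputable def radL (c : Q) (w : Fin 3 → Q) : (Fin 4 → Q) →ₗ[Q] (Fin 4 → Q) where
  toFun := rad c w
  map_add' x y := by
    refine pt_ext ?_ ?_
    · simp only [rad, mkPt_zero, Pi.add_apply, sp_add, add_dotProduct]
      ring
    · simp only [rad, sp_mkPt, sp_add, add_dotProduct, add_div]
      module
  map_smul' a x := by
    refine pt_ext ?_ ?_
    · simp only [rad, mkPt_zero, Pi.smul_apply, sp_smul, smul_dotProduct, smul_eq_mul,
        RingHom.id_apply]
      ring
    · simp only [rad, sp_mkPt, sp_smul, smul_dotProduct, smul_eq_mul, RingHom.id_apply,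
        mul_div_assoc]
      module

@[simp] theorem radL_apply (c : Q) (w : Fin 3 → Q) (x : Fin 4 → Q) : radL c w x = rad c w x :=
  rfl

section

variable [Euclidean Q]

theorem spaceV_sq (x y : Fin 4 → Q) : spaceV x y ^ 2 = dist2 x y := by
  rw [pow_two, spaceV, qsqrt_mul_self (dist2_nonneg x y)]

theorem spaceV_nonneg (x y : Fin 4 → Q) : 0 ≤ spaceV x y := qsqrt_nonneg _

theorem timeV_nonneg (x y : Fin 4 → Q) : 0 ≤ timeV x y := abs_nonneg _

/-- Light cones become the zero set of the Minkowski form, which is easier to transport. -/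
theorem spaceV_eq_iff {c : Q} (hc : 0 < c) (x y : Fin 4 → Q) :
    spaceV x y = c * timeV x y ↔ mink c x y = 0 := by
  rw [← pow_left_inj₀ (spaceV_nonneg x y) (mul_nonneg hc.le (timeV_nonneg x y))
    two_ne_zero, mul_pow, timeV_sq, spaceV_sq, mink, sub_eq_zero, eq_comm]

theorem spaceV_lt_iff {c : Q} (hc : 0 < c) (x y : Fin 4 → Q) :
    spaceV x y < c * timeV x y ↔ 0 < mink c x y := by
  rw [← pow_lt_pow_iff_left₀ (spaceV_nonneg x y) (mul_nonneg hc.le (timeV_nonneg x y))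
    two_ne_zero, mul_pow, timeV_sq, spaceV_sq, mink, sub_pos]

/-- Radarization keeps the time axis, as `AxSelf` demands. The inner product of `sp x` with the
spatial part of the image is `|sp x|²` plus a nonnegative term, so it vanishes only with `sp x`. -/
theorem sp_rad_eq_zero_iff {c : Q} {w : Fin 3 → Q} (hw : w ⬝ᵥ w < c ^ 2) (x : Fin 4 → Q) :
    sp (rad c w x) = 0 ↔ sp x = 0 := by
  constructor
  · intro h
    have hg := scaleV_pos hw
    have hc : 0 < c ^ 2 := (dotProduct_self_nonneg' w).trans_lt hw
    have h₁ := congrArg (sp x ⬝ᵥ ·) h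
    simp only [rad, sp_mkPt, dotProduct_add, dotProduct_smul, dotProduct_zero, smul_eq_mul] at h₁
    have h₂ : 0 ≤ sp x ⬝ᵥ w / (c ^ 2 * scaleV c w * (1 + scaleV c w)) * (sp x ⬝ᵥ w) := by
      rw [div_mul_eq_mul_div]
      exact div_nonneg (mul_self_nonneg _) (by positivity)
    exact eq_zero_of_dot_self (le_antisymm (by linarith) (dotProduct_self_nonneg' _))
  · intro h
    simp [rad, h]

/-- The kernel lies in the time axis, where the map multiplies by the nonzero scale factor; an
injective endomorphism of a finite-dimensional space is surjective. -/
theorem rad_bijective {c : Q} {w : Fin 3 → Q} (hw : w ⬝ᵥ w < c ^ 2) :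
    Function.Bijective (rad c w) := by
  have hinj : Function.Injective (radL c w) := by
    rw [injective_iff_map_eq_zero]
    intro x hx
    rw [radL_apply] at hx
    have h₁ : sp x = 0 := (sp_rad_eq_zero_iff hw x).1 (by rw [hx]; rfl)
    have h₂ := congrFun hx 0
    simp only [rad, h₁, mkPt_zero, zero_dotProduct, zero_div, add_zero, Pi.zero_apply] at h₂
    exact pt_ext ((mul_eq_zero.1 h₂).resolve_left (scaleV_pos hw).ne') h₁
  exact ⟨hinj, (LinearMap.injective_iff_surjective (f := radL c w)).1 hinj⟩

theorem dot_smul_self {ε : Q} (hε : ε * ε = 1) (u : Fin 3 → Q) : (ε • u) ⬝ᵥ (ε • u) = u ⬝ᵥ u := by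
  rw [smul_dotProduct, dotProduct_smul, smul_smul, hε, one_smul]

/-- Radarization turns Galilean transformations into Poincaré transformations. -/
theorem mink_rad_galMap {c ε : Q} (hε : ε * ε = 1) {A : Matrix (Fin 3) (Fin 3) Q}
    (hA : A.transpose * A = 1) {u : Fin 3 → Q} (hu : u ⬝ᵥ u < c ^ 2) (t₀ : Q) (d : Fin 3 → Q)
    (x y : Fin 4 → Q) :
    mink c (rad c (ε • u) (galMap ε t₀ A u d x)) (rad c (ε • u) (galMap ε t₀ A u d y)) =
      mink c x y := by
  have hw : (ε • u) ⬝ᵥ (ε • u) < c ^ 2 := by rwa [dot_smul_self hε]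
  have hsub : ∀ x y : Fin 4 → Q, mink c x y =
      c ^ 2 * (x - y) 0 ^ 2 - sp (x - y) ⬝ᵥ sp (x - y) := fun x y => rfl
  have hg := scaleV_pos hw
  have hgg := scaleV_mul_self hw
  have hc : c ≠ 0 := by
    rintro rfl
    exact absurd hw (by simpa using dotProduct_self_nonneg' (ε • u))
  rw [hsub, hsub, ← radL_apply, ← radL_apply, ← map_sub, galMap_sub, radL_apply]
  set g := scaleV c (ε • u)
  set q := A.mulVec (sp x - sp y) with hq
  have hqq : q ⬝ᵥ q = sp (x - y) ⬝ᵥ sp (x - y) := dot_mulVec hA _ _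
  rw [← hqq, Pi.sub_apply]
  set a := x 0 - y 0
  -- Eliminates `u ⬝ᵥ u`, so that the final identity is rational in `c`, `g`, `a`, `q ⬝ᵥ q` and `q
  -- ⬝ᵥ u`; the factors `ε` cancel in pairs.
  have hU : u ⬝ᵥ u = c ^ 2 * (1 - g * g) := by
    rw [hgg, dot_smul_self hε]
    field_simp
    ring
  have hdot : (q + a • u) ⬝ᵥ (ε • u) = ε * (q ⬝ᵥ u + a * (u ⬝ᵥ u)) := by
    simp only [dotProduct_smul, add_dotProduct, smul_dotProduct, smul_eq_mul]
  have h₁ : rad c (ε • u) (mkPt (ε * a) (q + a • u)) 0 =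
      ε * (g * a + (q ⬝ᵥ u + a * (u ⬝ᵥ u)) / (c ^ 2 * g)) := by
    simp only [rad, mkPt_zero, sp_mkPt, hdot]
    ring
  have h₂ : sp (rad c (ε • u) (mkPt (ε * a) (q + a • u))) =
      q + (a + (q ⬝ᵥ u + a * (u ⬝ᵥ u)) / (c ^ 2 * g * (1 + g))) • u := by
    simp only [rad, sp_mkPt, hdot, smul_smul]
    rw [mul_div_assoc, mul_right_comm, hε, one_mul, add_assoc, ← add_smul]
  rw [h₁, h₂, mul_pow, pow_two ε, hε, hU]
  simp only [dotProduct_smul, smul_dotProduct, add_dotProduct, dotProduct_add, smul_eq_mul, hU,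
    dotProduct_comm u q]
  have hg0 := hg.ne'
  have hg1 : 1 + g ≠ 0 := by positivity
  field_simp
  ring

end

end CompKin

namespace CompKin

open Fml

variable {B Q : Type} [Field Q] [LinearOrder Q] [IsStrictOrderedRing Q] [Euclidean Q]

/-! ### Ether observers and velocities -/

namespace Str

variable {S : Str B Q}

/-- The points `0` and `(1, c, 0, 0)` lie on a common light signal and determine its speed. -/
theorem LightSpeedAt.unique {k : B} {c c' : Q} (hc : 0 < c) (hc' : 0 < c')
    (h : S.LightSpeedAt k c) (h' : S.LightSpeedAt k c') : c = c' := by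
  have h₁ : mink c 0 (mkPt 1 ![c, 0, 0]) = 0 := by
    simp [mink, dist2_eq, mkPt]
  have h₂ := (spaceV_eq_iff hc' _ _).1 ((h' _ _).1 ((h _ _).2 ((spaceV_eq_iff hc _ _).2 h₁)))
  rw [mink] at h₁ h₂
  simp only [mkPt_zero, Pi.zero_apply, zero_sub, even_two, Even.neg_pow, one_pow, mul_one] at h₁ h₂
  exact (pow_left_inj₀ hc.le hc'.le two_ne_zero).1 (by linarith)

namespace Gal

variable {k h : B} {ε t₀ : Q} {A : Matrix (Fin 3) (Fin 3) Q} {u d : Fin 3 → Q}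
  (G : S.Gal k h ε t₀ A u d)

include G

theorem wv_iff (b : B) (x : Fin 4 → Q) : S.wv h b (galMap ε t₀ A u d x) ↔ S.wv k b x :=
  (((G.ev x _).2 rfl) b).symm

theorem eps_ne_zero : ε ≠ 0 := by
  rintro rfl
  simpa using G.sq

/-- Observers for which light moves with the same speed in all directions are at relative rest. -/
theorem eq_zero_of_lightSpeedAt {c c' : Q} (hc : 0 < c)
    (hc' : 0 < c') (hl : S.LightSpeedAt k c)
    (hl' : S.LightSpeedAt h c') : u = 0 ∧ c = c' := by
  have hcone : ∀ x y, mink c x y = 0 →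
      mink c' (galMap ε t₀ A u d x) (galMap ε t₀ A u d y) = 0 := by
    intro x y hxy
    rw [← spaceV_eq_iff hc, ← hl y x] at hxy
    obtain ⟨p, hp, hx, hy⟩ := hxy
    exact (spaceV_eq_iff hc' _ _).1
      ((hl' _ _).1 ⟨p, hp, (G.wv_iff p x).2 hx, (G.wv_iff p y).2 hy⟩)
  have hmink : ∀ (c : Q) (x y : Fin 4 → Q), mink c x y =
      c ^ 2 * (x - y) 0 ^ 2 - sp (x - y) ⬝ᵥ sp (x - y) := fun c x y => rfl
  -- A signal of velocity `p` with `|p| = c` for `k` has velocity `± (A p + u)` for `h`, whose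
  -- length must be `c'`.
  have hsq : ∀ p : Fin 3 → Q, p ⬝ᵥ p = c ^ 2 →
      (A.mulVec p + u) ⬝ᵥ (A.mulVec p + u) = c' ^ 2 := by
    intro p hp
    have := hcone (mkPt 1 p) 0 (by rw [hmink]; simp [hp])
    rw [hmink, galMap_sub] at this
    simp only [mkPt_zero, sp_mkPt, Pi.zero_apply, sub_zero, mul_one, one_smul, pow_two ε, G.sq,
      show sp (0 : Fin 4 → Q) = 0 from rfl] at this
    exact (sub_eq_zero.1 this).symm
  -- Opposite signals `p` and `-p` are compared: the difference of the two equations gives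
  -- orthogonality, the sum gives the speeds.
  have horth : ∀ p : Fin 3 → Q, p ⬝ᵥ p = c ^ 2 → A.mulVec p ⬝ᵥ u = 0 ∧ c ^ 2 + u ⬝ᵥ u = c' ^ 2 := by
    intro p hp
    have h₁ := hsq p hp
    have h₂ := hsq (-p) (by simpa using hp)
    simp only [Matrix.mulVec_neg, add_dotProduct, dotProduct_add, neg_dotProduct, dotProduct_neg,
      dot_mulVec G.orth, hp, dotProduct_comm u] at h₁ h₂
    constructor <;> linarith
  -- Signals along the three axes suffice to make `u` orthogonal to the range of `A`, which is all
  -- of space.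
  have hAu : ∀ p, A.mulVec p ⬝ᵥ u = 0 := by
    have h₀ : Matrix.vecMul u A = 0 := by
      funext i
      have := (horth (Pi.single i c) (by simp [pow_two])).1
      rw [dotProduct_comm, Matrix.dotProduct_mulVec, dotProduct_single] at this
      exact (mul_eq_zero.1 this).resolve_right hc.ne'
    intro p
    rw [dotProduct_comm, Matrix.dotProduct_mulVec, h₀, zero_dotProduct]
  have hu : u = 0 := by
    have hAA : A * A.transpose = 1 := mul_eq_one_comm.1 G.orth
    have := hAu (A.transpose.mulVec u)
    rw [Matrix.mulVec_mulVec, hAA, Matrix.one_mulVec] at this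
    exact eq_zero_of_dot_self this
  refine ⟨hu, ?_⟩
  have := (horth (Pi.single 0 c) (by simp [pow_two])).2
  rw [hu, zero_dotProduct, add_zero] at this
  exact (pow_left_inj₀ hc.le hc'.le two_ne_zero).1 this

end Gal

end Str

namespace ClassicalKin

variable {S : Str B Q} (H : ClassicalKin S) {k e h : B} {ε t₀ : Q}
  {A : Matrix (Fin 3) (Fin 3) Q} {u d : Fin 3 → Q}

include H

theorem gal_surjective (he : S.iob e) (hk : S.iob k) (G : S.Gal e k ε t₀ A u d) (y : Fin 4 → Q) :
    ∃ x, galMap ε t₀ A u d x = y := by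
  obtain ⟨x, hx⟩ := H.ev k e hk he y
  exact ⟨x, ((G.ev x y).1 hx.symm).symm⟩

/-- `e` rests at its own spatial origin, which `k` sees as the points `(ε t + t₀, t u + d)`; the
velocity is `u / ε = ε u`. -/
theorem isVelocity_iff (he : S.iob e) (hk : S.iob k) (G : S.Gal e k ε t₀ A u d) (v : Fin 3 → Q) :
    S.IsVelocity k e v ↔ v = ε • u := by
  have hwl : ∀ t, S.wv k e (galMap ε t₀ A u d (mkPt t 0)) := fun t =>
    (G.wv_iff e _).2 ((H.self e he _).2 rfl)
  constructor
  · intro hv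
    have := hv.2 _ _ (hwl 0) (hwl 1)
    rw [← sp_sub, ← Pi.sub_apply, galMap_sub] at this
    simp at this
    rw [this, smul_smul, G.sq, one_smul]
  · rintro rfl
    refine ⟨⟨_, _, ⟨hwl 0, hwl 1⟩, fun h => ?_⟩, fun y x hx hy => ?_⟩
    · have := congrFun h 0
      simp [galMap, G.eps_ne_zero] at this
    · obtain ⟨x, rfl⟩ := H.gal_surjective he hk G x
      obtain ⟨y, rfl⟩ := H.gal_surjective he hk G y
      rw [G.wv_iff, H.self e he] at hx hy
      rw [← sp_sub, ← Pi.sub_apply, galMap_sub, hx, hy]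
      simp [smul_smul, mul_right_comm, G.sq]

/-- On the worldline of `k` the `k`-coordinates have constant spatial part zero, so `A Δp = -Δt u`
and `|Δp| = |u| |Δt|`. Hence the speed of `k` for `e` is the length of the velocity of `e` for `k`.
-/
theorem isSpeed_iff (he : S.iob e) (hk : S.iob k) (G : S.Gal e k ε t₀ A u d) (v : Q) :
    S.IsSpeed e k v ↔ v = qsqrt (u ⬝ᵥ u) := by
  have hwl : ∀ x y, S.wv e k x → S.wv e k y → spaceV x y = qsqrt (u ⬝ᵥ u) * timeV x y := by
    intro x y hx hy
    rw [← G.wv_iff, H.self k hk] at hx hy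
    have h₁ := congrArg sp (galMap_sub ε t₀ A u d x y)
    rw [sp_sub, hx, hy, sub_zero, sp_mkPt, eq_comm, add_eq_zero_iff_eq_neg] at h₁
    refine (pow_left_inj₀ (spaceV_nonneg x y) (mul_nonneg (qsqrt_nonneg _) (timeV_nonneg x y))
      two_ne_zero).1 ?_
    rw [mul_pow, spaceV_sq, timeV_sq, pow_two (qsqrt _), norm_mul_self, dist2,
      ← dot_mulVec G.orth, h₁]
    simp only [neg_dotProduct, dotProduct_neg, smul_dotProduct, dotProduct_smul, smul_eq_mul]
    ring
  obtain ⟨x, hx, hx0⟩ := H.exists_time he hk 0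
  obtain ⟨y, hy, hy0⟩ := H.exists_time he hk 1
  constructor
  · intro hv
    have h₁ := hv.2 _ _ hx hy
    rw [hwl x y hx hy] at h₁
    simpa [timeV, hx0, hy0] using h₁.symm
  · rintro rfl
    refine ⟨⟨_, _, ⟨hx, hy⟩, ?_⟩, fun y x hx hy => hwl x y hx hy⟩
    rintro rfl
    exact zero_ne_one (hx0.symm.trans hy0)

/-- All ether observers ascribe the same speed to light. -/
theorem exists_etherLightSpeed : ∃ e c, S.Ether e ∧ S.IsEtherLightSpeed c := by
  obtain ⟨e, he, c, hc, hl⟩ := H.exEther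
  refine ⟨e, c, ⟨he, c, hc, hl⟩, hc, ?_⟩
  rintro e' ⟨he', c', hc', hl'⟩
  obtain ⟨ε, t₀, A, u, d, G⟩ := H.exists_gal he he'
  rwa [(G.eq_zero_of_lightSpeedAt hc hc' hl hl').2]

/-- All ether observers have the same velocity. -/
theorem ether_velocity {e e' : B} (he : S.Ether e) (he' : S.Ether e')
    (G : S.Gal e k ε t₀ A u d) {ε' t₀' : Q} {A' : Matrix (Fin 3) (Fin 3) Q} {u' d' : Fin 3 → Q}
    (G' : S.Gal e' k ε' t₀' A' u' d') : ε' • u' = ε • u := by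
  obtain ⟨he, c, hc, hl⟩ := he
  obtain ⟨he', c', hc', hl'⟩ := he'
  obtain ⟨ε₁, t₁, A₁, u₁, d₁, G₁⟩ := H.exists_gal he he'
  -- There is no boost between the ether observers. Factoring the map from `e` to `k` through `e'`
  -- and following a unit step of time gives `ε = ε' ε₁` and `u = ε₁ u'`.
  have hu₁ := (G₁.eq_zero_of_lightSpeedAt hc hc' hl hl').1
  have hcomp : ∀ x, galMap ε t₀ A u d x = galMap ε' t₀' A' u' d' (galMap ε₁ t₁ A₁ u₁ d₁ x) :=
    fun x => (G'.ev _ _).1 (((G₁.ev x _).2 rfl).symm.trans ((G.ev x _).2 rfl))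
  have h₁ := galMap_sub ε t₀ A u d (mkPt 1 0) (mkPt 0 0)
  rw [hcomp, hcomp, galMap_sub, ← Pi.sub_apply, ← sp_sub, galMap_sub, hu₁] at h₁
  have h₂ := congrFun h₁ 0
  have h₃ := congrArg sp h₁
  simp at h₂ h₃
  rw [← h₂, ← h₃, smul_smul, mul_assoc, G₁.sq, mul_one]

end ClassicalKin

/-! ### The translated structure -/

/-- The structure that interprets the language in the way of the translation. -/
def Str.radarized (S : Str B Q) : Str B Q where
  iob k := S.iob k ∧ ∀ e, S.Ether e → S.SlowerThanLight e k
  ph := S.ph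
  wv k b x := ∀ e, S.Ether e → ∃ y v, S.IsVelocity k e v ∧ S.RadMaps v y x ∧ S.wv k b y

theorem Str.realize_exsQ_seven (S : Str B Q) (φ : Fml) (r : ℕ → B) (s : ℕ → Q) :
    S.Realize (exsQ 7 φ) r s ↔ ∃ (y : Fin 4 → Q) (v : Fin 3 → Q),
      S.Realize φ r (app y (cons (v 0) (cons (v 1) (cons (v 2) s)))) := by
  have h : S.Realize (exsQ 7 φ) r s ↔ S.Realize (exQ (exQ (exQ (exsQ 4 φ)))) r s := Iff.rfl
  simp only [h, Str.realize_exQ, Str.realize_exsQ_four]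
  exact ⟨fun ⟨a, b, c, y, h⟩ => ⟨y, ![c, b, a], h⟩, fun ⟨y, v, h⟩ => ⟨_, _, _, y, h⟩⟩

theorem Str.realize_wvRadInv (S : Str B Q) (e k b : ℕ) (x : Pt) (r : ℕ → B) (s : ℕ → Q) :
    S.Realize (wvRadInv e k b x) r s ↔ ∃ y v, S.IsVelocity (r k) (r e) v ∧
      S.RadMaps v y (Pt.eval s x) ∧ S.wv (r k) (r b) y := by
  simp only [wvRadInv, Str.realize_exsQ_seven, Str.realize_and, Str.realize_isVelocity,
    Str.realize_radMaps, Str.realize_wv, eval_pt_zero, Pt.eval_lift]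
  refine exists₂_congr fun y v => ?_
  have hv : (fun i : Fin 3 => (Tm.var (4 + i)).eval
      (app y (cons (v 0) (cons (v 1) (cons (v 2) s))))) = v := by
    funext i
    fin_cases i <;> rfl
  rw [hv]
  rfl

/-- The relations of `radarized` are those defined by the formulas of `Tr`, and the sorts,
operations and order are unchanged, so the induction is immediate beyond the atomic cases. -/
theorem Str.realize_apply_Tr (S : Str B Q) (φ : Fml) (r : ℕ → B) (s : ℕ → Q) :
    S.Realize (Tr.apply φ) r s ↔ S.radarized.Realize φ r s := by
  induction φ generalizing r s with
  | eqB | eqQ | fls => exact Iff.rfl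
  | le a b =>
    simp only [Translation.apply, Str.realize_subst]
    exact Iff.rfl
  | iob k =>
    simp only [Translation.apply, Str.realize_subst]
    simp [Tr, Str.radarized]
  | ph p =>
    simp only [Translation.apply, Str.realize_subst]
    exact Iff.rfl
  | wv k b x =>
    simp only [Translation.apply, Str.realize_subst]
    simp only [Tr, Str.realize_allB, Str.realize_imp, Str.realize_ether, Str.realize_wvRadInv,
      Str.realize_wv, Str.radarized]
    refine forall₂_congr fun e _ => exists₂_congr fun y v =>
      and_congr Iff.rfl (and_congr (iff_of_eq (congrArg (S.RadMaps v y) ?_)) Iff.rfl)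
    funext i
    fin_cases i <;> rfl
  | imp φ ψ hφ hψ => exact imp_congr (hφ r s) (hψ r s)
  | allB φ ih => exact forall_congr' fun b => ih _ _
  | allQ φ ih => exact forall_congr' fun b => ih _ _

end CompKin

namespace CompKin

open Fml

variable {B Q : Type} [Field Q] [LinearOrder Q] [IsStrictOrderedRing Q] [Euclidean Q]

/-! ### The axioms of special relativity in the translated structure. -/

theorem Str.IsEtherLightSpeed.unique {S : Str B Q} {e : B} {c c' : Q} (he : S.Ether e)
    (hc : S.IsEtherLightSpeed c) (hc' : S.IsEtherLightSpeed c') : c = c' :=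
  (hc.2 e he).unique hc.1 hc'.1 (hc'.2 e he)

/-- The worldview transformation of the translated structure from the ether observer `e` to `k` is
the affine bijection `f`, which preserves the Minkowski form. -/
structure Str.Frame (S : Str B Q) (c : Q) (e k : B) (f : (Fin 4 → Q) → Fin 4 → Q) : Prop where
  bij : Function.Bijective f
  affine : ∀ (x y : Fin 4 → Q) (a : Q), f (x + a • (y - x)) = f x + a • (f y - f x)
  mink : ∀ x y, mink c (f x) (f y) = CompKin.mink c x y
  wv : ∀ b x, S.radarized.wv k b (f x) ↔ S.wv e b x

namespace ClassicalKin

variable {S : Str B Q} (H : ClassicalKin S) {k e h : B} {c : Q} (he : S.Ether e)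
  (hc : S.IsEtherLightSpeed c) {ε t₀ : Q} {A : Matrix (Fin 3) (Fin 3) Q} {u d : Fin 3 → Q}

include H he hc

/-- Since all ether observers have the same velocity for `k`, the quantifier over them in the
translation reduces to the fixed observer `e`. -/
theorem radarized_iob_iff (hk : S.iob k) (G : S.Gal e k ε t₀ A u d) :
    S.radarized.iob k ↔ u ⬝ᵥ u < c ^ 2 := by
  constructor
  · rintro ⟨-, h⟩
    obtain ⟨c', v, hv, hc', hlt⟩ := h e he
    rw [H.isSpeed_iff he.1 hk G] at hv
    rwa [hv, ← hc.unique he hc', norm_lt_iff hc.1] at hlt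
  · intro hu
    refine ⟨hk, fun e' he' => ?_⟩
    obtain ⟨ε', t₀', A', u', d', G'⟩ := H.exists_gal he'.1 hk
    refine ⟨c, _, (H.isSpeed_iff he'.1 hk G' _).2 rfl, hc, ?_⟩
    rwa [norm_lt_iff hc.1, ← dot_smul_self G'.sq, H.ether_velocity he he' G G',
      dot_smul_self G.sq]

theorem radarized_wv_iff (hk : S.iob k) (G : S.Gal e k ε t₀ A u d) (b : B) (x : Fin 4 → Q) :
    S.radarized.wv k b x ↔ u ⬝ᵥ u < c ^ 2 ∧ ∃ y, rad c (ε • u) y = x ∧ S.wv k b y := by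
  constructor
  · intro h
    obtain ⟨y, v, hv, ⟨c', hc', hlt, hy⟩, hb⟩ := h e he
    obtain rfl := hc.unique he hc'
    rw [H.isVelocity_iff he.1 hk G] at hv
    subst hv
    exact ⟨by rwa [dot_smul_self G.sq] at hlt, y, hy, hb⟩
  · rintro ⟨hu, y, hy, hb⟩ e' he'
    obtain ⟨ε', t₀', A', u', d', G'⟩ := H.exists_gal he'.1 hk
    exact ⟨y, ε • u, (H.isVelocity_iff he'.1 hk G' _).2 (H.ether_velocity he he' G G').symm,
      ⟨c, hc, by rwa [dot_smul_self G.sq], hy⟩, hb⟩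

/-- `Rad_v` exists only for `|v| < c`, so a translated worldview relation already forces the speed
restriction in the translated `IOb`. -/
theorem radarized_noAcc {b : B} {x : Fin 4 → Q} (h : S.radarized.wv k b x) :
    S.radarized.iob k := by
  obtain ⟨y, v, -, -, hb⟩ := h e he
  have hk := H.noAcc k b y hb
  obtain ⟨ε, t₀, A, u, d, G⟩ := H.exists_gal he.1 hk
  exact (H.radarized_iob_iff he hc hk G).2 ((H.radarized_wv_iff he hc hk G b x).1 h).1

theorem radarized_wv_rad (hk : S.iob k) (G : S.Gal e k ε t₀ A u d) (hu : u ⬝ᵥ u < c ^ 2) (b : B)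
    (y : Fin 4 → Q) : S.radarized.wv k b (rad c (ε • u) y) ↔ S.wv k b y := by
  have hw : (ε • u) ⬝ᵥ (ε • u) < c ^ 2 := by rwa [dot_smul_self G.sq]
  rw [H.radarized_wv_iff he hc hk G]
  constructor
  · rintro ⟨-, y', hy, hb⟩
    rwa [← (rad_bijective hw).1 hy]
  · exact fun hb => ⟨hu, y, rfl, hb⟩

/-- The frame is radarization after the Galilean map from `e` to `k`. Axioms relating two observers
reduce to statements about `e` by passing through the two frames. -/
theorem exists_frame (hk : S.radarized.iob k) : ∃ f, S.Frame c e k f := by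
  obtain ⟨ε, t₀, A, u, d, G⟩ := H.exists_gal he.1 hk.1
  have hu := (H.radarized_iob_iff he hc hk.1 G).1 hk
  have hw : (ε • u) ⬝ᵥ (ε • u) < c ^ 2 := by rwa [dot_smul_self G.sq]
  refine ⟨rad c (ε • u) ∘ galMap ε t₀ A u d, (rad_bijective hw).comp ⟨fun x y hxy => ?_,
    fun y => H.gal_surjective he.1 hk.1 G y⟩, fun x y a => ?_, fun x y => ?_, fun b x => ?_⟩
  · have hx := (G.ev x _).2 rfl
    rw [hxy] at hx
    exact H.ev_injective he.1 (hx.trans ((G.ev y _).2 rfl).symm)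
  · simp only [Function.comp, galMap_add_smul, ← radL_apply, map_add, map_smul, map_sub]
  · exact mink_rad_galMap G.sq G.orth hu t₀ d x y
  · exact (H.radarized_wv_rad he hc hk.1 G hu b _).trans (G.wv_iff b x)

-- Different points of `e` carry different events, so both observers coordinatize the same event
-- exactly when the points come from the same point of `e`.
omit hc in
theorem frame_sameEv {f g : (Fin 4 → Q) → Fin 4 → Q} (F : S.Frame c e k f)
    (F' : S.Frame c e h g) (x y : Fin 4 → Q) :
    S.radarized.SameEv k (f x) h (g y) ↔ x = y := by
  have h₁ : S.radarized.SameEv k (f x) h (g y) ↔ S.SameEv e x e y :=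
    forall_congr' fun b => by rw [F.wv, F'.wv]
  rw [h₁]
  exact ⟨H.ev_injective he.1, fun h => h ▸ Str.SameEv.refl S e x⟩

theorem radarized_ev (hk : S.radarized.iob k) (hh : S.radarized.iob h) (x : Fin 4 → Q) :
    ∃ y, S.radarized.SameEv k x h y := by
  obtain ⟨f, F⟩ := H.exists_frame he hc hk
  obtain ⟨g, F'⟩ := H.exists_frame he hc hh
  obtain ⟨x, rfl⟩ := F.bij.2 x
  exact ⟨g x, (H.frame_sameEv he F F' x x).2 rfl⟩

theorem radarized_self (hk : S.radarized.iob k) (x : Fin 4 → Q) :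
    S.radarized.wv k k x ↔ sp x = 0 := by
  obtain ⟨ε, t₀, A, u, d, G⟩ := H.exists_gal he.1 hk.1
  have hu := (H.radarized_iob_iff he hc hk.1 G).1 hk
  have hw : (ε • u) ⬝ᵥ (ε • u) < c ^ 2 := by rwa [dot_smul_self G.sq]
  obtain ⟨x, rfl⟩ := (rad_bijective hw).2 x
  rw [H.radarized_wv_rad he hc hk.1 G hu, H.self k hk.1, sp_rad_eq_zero_iff hw]

theorem radarized_symD (hk : S.radarized.iob k) (hh : S.radarized.iob h)
    {x y x' y' : Fin 4 → Q} (h₁ : x 0 = y 0) (h₂ : x' 0 = y' 0)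
    (hx : S.radarized.SameEv k x h x') (hy : S.radarized.SameEv k y h y') :
    dist2 x y = dist2 x' y' := by
  obtain ⟨f, F⟩ := H.exists_frame he hc hk
  obtain ⟨g, F'⟩ := H.exists_frame he hc hh
  obtain ⟨x, rfl⟩ := F.bij.2 x
  obtain ⟨y, rfl⟩ := F.bij.2 y
  obtain ⟨x', rfl⟩ := F'.bij.2 x'
  obtain ⟨y', rfl⟩ := F'.bij.2 y'
  obtain rfl := (H.frame_sameEv he F F' _ _).1 hx
  obtain rfl := (H.frame_sameEv he F F' _ _).1 hy
  -- For pairs that are simultaneous on both sides, the invariant form is minus the squared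
  -- distance.
  have h₃ := (F.mink x y).trans (F'.mink x y).symm
  simp only [mink, h₁, h₂, sub_self] at h₃
  linarith

theorem radarized_line (hk : S.radarized.iob k) (hh : S.radarized.iob h)
    {x y z : Fin 4 → Q} (hx : S.radarized.wv k h x) (hy : S.radarized.wv k h y)
    (hz : S.radarized.wv k h z) : ∃ a : Q, z - x = a • (y - x) ∨ y - z = a • (z - x) := by
  obtain ⟨f, F⟩ := H.exists_frame he hc hk
  obtain ⟨x, rfl⟩ := F.bij.2 x
  obtain ⟨y, rfl⟩ := F.bij.2 y
  obtain ⟨z, rfl⟩ := F.bij.2 z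
  rw [F.wv] at hx hy hz
  obtain ⟨a, ha⟩ := H.line e h he.1 hh.1 x y z hx hy hz
  refine ⟨a, ha.imp (fun ha => ?_) fun ha => ?_⟩
  · have hz : z = x + a • (y - x) := by rw [← ha]; abel
    rw [hz, F.affine]
    abel
  · have hy : y = z + (-a) • (x - z) := by
      rw [neg_smul, ← smul_neg, neg_sub, ← ha]
      abel
    rw [hy, F.affine]
    module

theorem radarized_lightSpeedAt (hk : S.radarized.iob k) : S.radarized.LightSpeedAt k c := by
  obtain ⟨f, F⟩ := H.exists_frame he hc hk
  intro y x
  obtain ⟨x, rfl⟩ := F.bij.2 x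
  obtain ⟨y, rfl⟩ := F.bij.2 y
  rw [spaceV_eq_iff hc.1, F.mink, ← spaceV_eq_iff hc.1, ← hc.2 e he y x]
  simp only [F.wv]
  rfl

theorem radarized_iob_ether : S.radarized.iob e := by
  obtain ⟨ε, t₀, A, u, d, G⟩ := H.exists_gal he.1 he.1
  refine (H.radarized_iob_iff he hc he.1 G).2 ?_
  rw [(G.eq_zero_of_lightSpeedAt hc.1 hc.1 (hc.2 e he) (hc.2 e he)).1, zero_dotProduct]
  exact pow_pos hc.1 2

/-- In the coordinates of `e` the two points are still timelike separated, so an inertial observer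
through both, given by `AxThExpPlus`, has speed below `c` for `e` and survives the translation. -/
theorem radarized_thExp (hk : S.radarized.iob k) {x y : Fin 4 → Q} (hxy : 0 < mink c x y) :
    ∃ h, S.radarized.iob h ∧ S.radarized.wv k h x ∧ S.radarized.wv k h y := by
  obtain ⟨f, F⟩ := H.exists_frame he hc hk
  obtain ⟨x, rfl⟩ := F.bij.2 x
  obtain ⟨y, rfl⟩ := F.bij.2 y
  rw [F.mink] at hxy
  have h₀ : x 0 ≠ y 0 := by
    intro h₀
    have := dist2_nonneg x y
    rw [mink, h₀, sub_self] at hxy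
    linarith
  obtain ⟨h, hh, hx, hy⟩ := H.thExp e he.1 x y h₀
  refine ⟨h, ?_, (F.wv h x).2 hx, (F.wv h y).2 hy⟩
  obtain ⟨ε, t₀, A, u, d, G⟩ := H.exists_gal he.1 hh
  rw [H.radarized_iob_iff he hc hh G, ← norm_lt_iff hc.1]
  have h₁ := ((H.isSpeed_iff he.1 hh G _).2 rfl).2 y x hx hy
  rw [← spaceV_lt_iff hc.1, h₁] at hxy
  exact lt_of_mul_lt_mul_right hxy (timeV_nonneg x y)

/-- Radarization commutes with rotations if its velocity is rotated along: `A' ∘ Rad_w = Rad_{A'w} ∘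
A'`. A trivial transformation of the new coordinates therefore comes from a trivial transformation
of the classical ones. -/
theorem radarized_triv {t : Q} {d' : Fin 3 → Q} {A' : Matrix (Fin 3) (Fin 3) Q}
    (hA' : ∀ x y : Fin 4 → Q, dist2 (trivMap t d' A' x) (trivMap t d' A' y) = dist2 x y)
    (hk : S.radarized.iob k) : ∃ h, S.radarized.iob h ∧
      ∀ x y, S.radarized.SameEv k x h y ↔ y = trivMap t d' A' x := by
  have horth : ∀ p, A'.mulVec p ⬝ᵥ A'.mulVec p = p ⬝ᵥ p := by
    intro p
    simpa [dist2, trivMap] using hA' (mkPt 0 p) (mkPt 0 0)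
  have hdot := dot_mulVec (orthogonal_of_dot horth)
  obtain ⟨ε, t₀, A, u, d, G⟩ := H.exists_gal he.1 hk.1
  have hu := (H.radarized_iob_iff he hc hk.1 G).1 hk
  have hw : (ε • u) ⬝ᵥ (ε • u) < c ^ 2 := by rwa [dot_smul_self G.sq]
  have hu' : A'.mulVec u ⬝ᵥ A'.mulVec u < c ^ 2 := by rwa [hdot]
  have hw' : (ε • A'.mulVec u) ⬝ᵥ (ε • A'.mulVec u) < c ^ 2 := by rwa [dot_smul_self G.sq]
  -- The classical translation vector: the preimage of `(t, d')`. By linearity, translating by `τ`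
  -- before radarization translates by `(t, d')` after it.
  obtain ⟨τ, hτ⟩ := (rad_bijective hw').2 (mkPt t d')
  have hcomm : ∀ x, rad c (ε • A'.mulVec u) (trivMap (τ 0) (sp τ) A' x) =
      trivMap t d' A' (rad c (ε • u) x) := by
    intro x
    have h₁ : trivMap (τ 0) (sp τ) A' x = mkPt (x 0) (A'.mulVec (sp x)) + τ :=
      pt_ext (by simp [trivMap]) (by simp [trivMap])
    have hs : scaleV c (ε • A'.mulVec u) = scaleV c (ε • u) := by
      rw [scaleV, scaleV, dot_smul_self G.sq, dot_smul_self G.sq, hdot]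
    rw [h₁, ← radL_apply, map_add, radL_apply, radL_apply, hτ]
    refine pt_ext ?_ ?_
    · simp [rad, trivMap, hs, hdot]
    · simp [rad, trivMap, hs, hdot, Matrix.mulVec_add, Matrix.mulVec_smul]
  obtain ⟨h, hh, hev⟩ := H.triv (τ 0) (sp τ) A' (fun x y => by
    rw [dist2, trivMap, trivMap, sp_mkPt, sp_mkPt, add_sub_add_right_eq_sub, ← Matrix.mulVec_sub,
      hdot, dist2]) k hk.1
  -- The composite of the map from `e` to `k` with the classical trivial transformation; its boost
  -- is `A' u`, so `h` is as slow as `k`.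
  have G' : S.Gal e h ε (t₀ + τ 0) (A' * A) (A'.mulVec u) (A'.mulVec d + sp τ) := by
    refine ⟨G.sq, orthogonal_of_dot fun p => ?_, fun x y => ?_⟩
    · rw [← Matrix.mulVec_mulVec, hdot, dot_mulVec G.orth]
    · have h₁ : galMap ε (t₀ + τ 0) (A' * A) (A'.mulVec u) (A'.mulVec d + sp τ) x =
          trivMap (τ 0) (sp τ) A' (galMap ε t₀ A u d x) := by
        refine pt_ext ?_ ?_
        · simp [galMap, trivMap, add_assoc]
        · simp [galMap, trivMap, Matrix.mulVec_add, Matrix.mulVec_smul, add_assoc]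
      rw [h₁, ← hev]
      have h₂ := (G.ev x _).2 rfl
      exact ⟨h₂.symm.trans, h₂.trans⟩
  refine ⟨h, (H.radarized_iob_iff he hc hh G').2 hu', fun x y => ?_⟩
  obtain ⟨x, rfl⟩ := (rad_bijective hw).2 x
  obtain ⟨y, rfl⟩ := (rad_bijective hw').2 y
  rw [← hcomm, (rad_bijective hw').1.eq_iff, ← hev]
  exact forall_congr' fun b => by
    rw [H.radarized_wv_rad he hc hk.1 G hu, H.radarized_wv_rad he hc hh G' hu']

omit he hc in
/-- The translated structure is a model of special relativity. -/
theorem specRel_radarized : SpecRel S.radarized := by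
  obtain ⟨e, c, he, hc⟩ := H.exists_etherLightSpeed
  exact
    { ev := fun k h hk hh => H.radarized_ev he hc hk hh
      self := fun k hk => H.radarized_self he hc hk
      symD := fun k h hk hh x y x' y' => H.radarized_symD he hc hk hh
      line := fun k h hk hh x y z => H.radarized_line he hc hk hh
      triv := fun t d A hA k hk => H.radarized_triv he hc hA hk
      noAcc := fun k b x => H.radarized_noAcc he hc
      light := ⟨c, hc.1, fun k => H.radarized_lightSpeedAt he hc⟩
      exIob := ⟨e, H.radarized_iob_ether he hc⟩
      thExp := by
        intro k c' hk hc' x y hxy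
        -- `AxThExp` speaks of any invariant light speed of the new structure; the observer `k`
        -- identifies it with `c`.
        obtain rfl := Str.LightSpeedAt.unique hc.1 hc'.1 (H.radarized_lightSpeedAt he hc hk)
          (hc'.2 k hk)
        exact H.radarized_thExp he hc hk ((spaceV_lt_iff hc.1 x y).1 hxy) }

end ClassicalKin

theorem ClassicalKinFull_finite : ClassicalKinFull.Finite := by
  simp [ClassicalKinFull, KinFull]

end CompKin

theorem mainTheorem4 :
    CompKin.IsInterpretation CompKin.Tr CompKin.SpecRelFull CompKin.ClassicalKinFull := by
  intro φ hφ
  refine CompKin.Provable.complete CompKin.ClassicalKinFull_finite ?_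
  intro B Q iA iM iL S r s h
  have hF : S.Realize CompKin.AxEField r s :=
    h _ (by simp [CompKin.ClassicalKinFull, CompKin.KinFull])
  -- The equations between instances replace the bare operations and order of the model by those of
  -- an ordered field, so that the kinematic results apply.
  obtain ⟨F, L, _, rfl, rfl, rfl⟩ := CompKin.exists_field S r s hF
  have : CompKin.Euclidean Q := CompKin.Euclidean.of_axEField hF
  have hC := CompKin.ClassicalKin.of_realize S r s h
  have hR := hC.specRel_radarized.realize r s
    ((CompKin.Str.realize_apply_Tr S _ r s).1 hF)
  exact (CompKin.Str.realize_apply_Tr S φ r s).2 (hφ.sound S.radarized r s hR)
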